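/- For finite alphabets and a PMF $p_{X_1X_2Y}$, consider $X_1^n,X_2^n$ i.i.d. $\sim p_{X_1X_2}$. \emph{Achievability.} $(R_1,R_2,C)$ with $C\ge 0$ is achievable if for every $\epsilon>0$ and all sufficiently large $n$ there are, for $N=\lfloor 2^{nC}\rfloor$ and each $\mu\in[N]$, randomized encoders $E_j^{(\mu)}:\mathcal X_j^n\to[\Theta_j]$ ($j=1,2$) and randomized decoders $D^{(\mu)}:[\Theta_1]\times[\Theta_2]\to\mathcal Y^n$ with $\frac1n\log_2\Theta_j\le R_j+\epsilon$ and $$\tfrac12\sum_{x_1^n,x_2^n,y^n}\Big|p^n_{X_1X_2Y}(x_1^n,x_2^n,y^n)-\tfrac1N\sum_{\mu,m_1,m_2}p^n_{X_1X_2}(x_1^n,x_2^n)E_1^{(\mu)}(m_1|x_1^n)E_2^{(\mu)}(m_2|x_2^n)D^{(\mu)}(y^n|m_1,m_2)\Big|\le\epsilon .$$ Let $\mathcal R_d$ be the set of achievable triples. \emph{Auxiliary PMFs.} Let $\mathcal P$ be the set of PMFs of $(Q,W_1,W_2,X_1,X_2,Y)$ on finite alphabets such that $(X_1,X_2,Y)\sim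 p_{X_1X_2Y}$, the time-sharing variable $Q$ is independent of $(X_1,X_2,Y)$, $W_1-QX_1-QX_2-W_2$ and $X_1X_2-QW_1W_2-Y$ are Markov chains, and $|\mathcal W_i|\le|\mathcal X_i|$ for $i=1,2$. Write $\underline X=(X_1,X_2)$; all logarithms are to base $2$. \emph{Unstructured inner bound.} $\mathcal R_u$ is the closure of the union over $\mathcal P$ of the sets of $(R_1,R_2,C)$ with $C\ge0$ and \begin{align*} R_i&\ge I(X_i;W_i|Q)-I(W_1;W_2|Q),\quad i=1,2,\\ R_1+R_2&\ge I(X_1;W_1|Q)+I(X_2;W_2|Q)-I(W_1;W_2|Q),\\ R_i+C&\ge I(\underline XY;W_i|Q)-I(W_1;W_2|Q),\quad i=1,2,\\ R_1+R_2+C&\ge I(\underline XY;W_1W_2|Q). \end{align*} \emph{Structured inner bound.} $\mathcal R_s$ is the closure of the union, over primes $r$ and members of $\mathcal P$ with $\mathcal W_1=\mathcal W_2=\mathbb F_r$, of the sets of $(R_1,R_2,C)$ with $C\ge0$ and, for $\{i,j\}=\{1,2\}$, \begin{align*} R_i&\ge I(X_i;W_i|W_j,Q)+I(W_1\oplus W_2;W_j|Q),\\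 R_i+C&\ge I(\underline X;W_i|W_j,Q)+I(Y;W_i|\underline X,Q)+I(W_1\oplus W_2;W_j|Q),\\ R_1+R_2+C&\ge I(\underline X;W_1|W_2,Q)+I(\underline X;W_2|W_1,Q)+I(W_1\oplus W_2;W_1|Q)+I(W_1\oplus W_2;W_2|Q). \end{align*} \emph{Example.} Let $X_1$ be a uniform bit, $X_2=X_1\oplus B_p$ and $Y=X_1\oplus X_2\oplus B_q$, where $B_p\sim\mathrm{Bernoulli}(p)$ and $B_q\sim\mathrm{Bernoulli}(q)$ are such that $X_1,B_p,B_q$ are independent, and let $h_b$ be the binary entropy function in bits. (a) If $q=0$ and $0<p<\frac12$, then $$\mathcal R_u=\{R_1\ge h_b(p),\ R_2\ge h_b(p),\ R_1+R_2\ge1+h_b(p),\ C\ge0\},$$ $$\mathcal R_s=\mathcal R_d=\{R_1\ge h_b(p),\ R_2\ge h_b(p),\ C\ge0\};$$ so $\mathcal R_s$ is optimal, and $\mathcal R_s\setminus\mathcal R_u\neq\emptyset$. (b) If $p=q=0.1$, then the minimum of $R_1+R_2+C$ over $\mathcal R_u$ exists and equals $1.3965$ up to an error of at most $5\cdot10^{-5}$,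 while $\mathcal R_s$ contains a triple with $R_1+R_2+C=0.9596$; in particular $\mathcal R_s\setminus\mathcal R_u\ne\emptyset$. -/

import Mathlib

namespace CorrSynth

/-- `P` is a probability mass function on the finite set `Ω`. -/
def IsPMF {Ω : Type} [Fintype Ω] (P : Ω → ℝ) : Prop :=
  (∀ ω, 0 ≤ P ω) ∧ ∑ ω, P ω = 1

/-- The PMF of the random variable `A` when the outcome has PMF `P`. -/
def law {Ω α : Type} [Fintype Ω] [DecidableEq α] (P : Ω → ℝ) (A : Ω → α) (a : α) : ℝ :=
  ∑ ω, if A ω = a then P ω else 0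

/-- Shannon entropy `H(A)` in bits. -/
noncomputable def entropy {Ω α : Type} [Fintype Ω] [Fintype α] [DecidableEq α]
    (P : Ω → ℝ) (A : Ω → α) : ℝ :=
  (∑ a, Real.negMulLog (law P A a)) / Real.log 2

/-- Conditional mutual information `I(A ; B | D)` in bits. -/
noncomputable def condMI {Ω α β δ : Type} [Fintype Ω] [Fintype α] [DecidableEq α]
    [Fintype β] [DecidableEq β] [Fintype δ] [DecidableEq δ]
    (P : Ω → ℝ) (A : Ω → α) (B : Ω → β) (D : Ω → δ) : ℝ :=
  entropy P (fun ω => (A ω, D ω)) + entropy P (fun ω => (B ω, D ω))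
    - entropy P (fun ω => (A ω, B ω, D ω)) - entropy P D

/-- `A` and `B` are independent. -/
def Indep {Ω α β : Type} [Fintype Ω] [DecidableEq α] [DecidableEq β]
    (P : Ω → ℝ) (A : Ω → α) (B : Ω → β) : Prop :=
  ∀ a b, law P (fun ω => (A ω, B ω)) (a, b) = law P A a * law P B b

/-- `A - B - D` is a Markov chain: `A` and `D` are conditionally independent given `B`. -/
def Markov {Ω α β δ : Type} [Fintype Ω] [DecidableEq α] [DecidableEq β] [DecidableEq δ]
    (P : Ω → ℝ) (A : Ω → α) (B : Ω → β) (D : Ω → δ) : Prop :=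
  ∀ a b d, law P (fun ω => (A ω, B ω, D ω)) (a, b, d) * law P B b
    = law P (fun ω => (A ω, B ω)) (a, b) * law P (fun ω => (B ω, D ω)) (b, d)

/-- `A - B - D - E` is a Markov chain. -/
def Markov₄ {Ω α β δ η : Type} [Fintype Ω] [DecidableEq α] [DecidableEq β] [DecidableEq δ]
    [DecidableEq η] (P : Ω → ℝ) (A : Ω → α) (B : Ω → β) (D : Ω → δ) (E : Ω → η) : Prop :=
  Markov P A B (fun ω => (D ω, E ω)) ∧ Markov P (fun ω => (A ω, B ω)) D E

section Alphabets

variable {Q W₁ W₂ X₁ X₂ Y : Type}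

/-- Outcomes of `(Q, W₁, W₂, X₁, X₂, Y)`. -/
abbrev Outcome (Q W₁ W₂ X₁ X₂ Y : Type) : Type := Q × W₁ × W₂ × X₁ × X₂ × Y

/-- The time sharing variable `Q`. -/
abbrev rvQ (ω : Outcome Q W₁ W₂ X₁ X₂ Y) : Q := ω.1
/-- The auxiliary variable `W₁`. -/
abbrev rvW₁ (ω : Outcome Q W₁ W₂ X₁ X₂ Y) : W₁ := ω.2.1
/-- The auxiliary variable `W₂`. -/
abbrev rvW₂ (ω : Outcome Q W₁ W₂ X₁ X₂ Y) : W₂ := ω.2.2.1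
/-- The source `X₁`. -/
abbrev rvX₁ (ω : Outcome Q W₁ W₂ X₁ X₂ Y) : X₁ := ω.2.2.2.1
/-- The source `X₂`. -/
abbrev rvX₂ (ω : Outcome Q W₁ W₂ X₁ X₂ Y) : X₂ := ω.2.2.2.2.1
/-- The target `Y`. -/
abbrev rvY (ω : Outcome Q W₁ W₂ X₁ X₂ Y) : Y := ω.2.2.2.2.2
/-- The pair `(W₁, W₂)`. -/
abbrev rvW (ω : Outcome Q W₁ W₂ X₁ X₂ Y) : W₁ × W₂ := (rvW₁ ω, rvW₂ ω)
/-- The pair `(X₁, X₂)`. -/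
abbrev rvX (ω : Outcome Q W₁ W₂ X₁ X₂ Y) : X₁ × X₂ := (rvX₁ ω, rvX₂ ω)
/-- The triple `(X₁, X₂, Y)`. -/
abbrev rvXY (ω : Outcome Q W₁ W₂ X₁ X₂ Y) : X₁ × X₂ × Y := (rvX₁ ω, rvX₂ ω, rvY ω)
/-- The sum `W₁ ⊕ W₂`, for auxiliary variables with values in the same field. -/
abbrev rvZ {F : Type} [Add F] (ω : Outcome Q F F X₁ X₂ Y) : F := rvW₁ ω + rvW₂ ω

variable [Fintype Q] [Fintype W₁] [Fintype W₂] [Fintype X₁] [Fintype X₂] [Fintype Y]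
variable [DecidableEq Q] [DecidableEq W₁] [DecidableEq W₂] [DecidableEq X₁] [DecidableEq X₂]
  [DecidableEq Y]

/-- `P` is an admissible joint PMF of `(Q, W₁, W₂, X₁, X₂, Y)` for the target PMF `p`
of `(X₁, X₂, Y)`; the time sharing variable is independent of `(X₁, X₂, Y)`. -/
structure IsAdmissible (p : X₁ × X₂ × Y → ℝ) (P : Outcome Q W₁ W₂ X₁ X₂ Y → ℝ) : Prop where
  isPMF : IsPMF P
  marginal : ∀ t, law P rvXY t = p t
  timeSharing : Indep P rvQ rvXY
  encoders : Markov₄ P rvW₁ (fun ω => (rvQ ω, rvX₁ ω)) (fun ω => (rvQ ω, rvX₂ ω)) rvW₂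
  decoder : Markov P rvX (fun ω => (rvQ ω, rvW ω)) rvY
  card_W₁ : Fintype.card W₁ ≤ Fintype.card X₁
  card_W₂ : Fintype.card W₂ ≤ Fintype.card X₂

/-- Rate triples `(R₁, R₂, C)` allowed by a given auxiliary PMF in the unstructured
(i.i.d. random code) inner bound. -/
def unstructuredRates (P : Outcome Q W₁ W₂ X₁ X₂ Y → ℝ) : Set (ℝ × ℝ × ℝ) :=
  {t | condMI P rvX₁ rvW₁ rvQ - condMI P rvW₁ rvW₂ rvQ ≤ t.1 ∧
    condMI P rvX₂ rvW₂ rvQ - condMI P rvW₁ rvW₂ rvQ ≤ t.2.1 ∧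
    condMI P rvX₁ rvW₁ rvQ + condMI P rvX₂ rvW₂ rvQ - condMI P rvW₁ rvW₂ rvQ ≤ t.1 + t.2.1 ∧
    condMI P rvXY rvW₁ rvQ - condMI P rvW₁ rvW₂ rvQ ≤ t.1 + t.2.2 ∧
    condMI P rvXY rvW₂ rvQ - condMI P rvW₁ rvW₂ rvQ ≤ t.2.1 + t.2.2 ∧
    condMI P rvXY rvW rvQ ≤ t.1 + t.2.1 + t.2.2 ∧
    0 ≤ t.2.2}

/-- Rate triples `(R₁, R₂, C)` allowed by a given auxiliary PMF in the structured
(coset code) inner bound. -/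
def structuredRates {F : Type} [Fintype F] [DecidableEq F] [Add F]
    (P : Outcome Q F F X₁ X₂ Y → ℝ) : Set (ℝ × ℝ × ℝ) :=
  {t | condMI P rvX₁ rvW₁ (fun ω => (rvW₂ ω, rvQ ω)) + condMI P rvZ rvW₂ rvQ ≤ t.1 ∧
    condMI P rvX₂ rvW₂ (fun ω => (rvW₁ ω, rvQ ω)) + condMI P rvZ rvW₁ rvQ ≤ t.2.1 ∧
    condMI P rvX rvW₁ (fun ω => (rvW₂ ω, rvQ ω)) + condMI P rvY rvW₁ (fun ω => (rvX ω, rvQ ω))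
      + condMI P rvZ rvW₂ rvQ ≤ t.1 + t.2.2 ∧
    condMI P rvX rvW₂ (fun ω => (rvW₁ ω, rvQ ω)) + condMI P rvY rvW₂ (fun ω => (rvX ω, rvQ ω))
      + condMI P rvZ rvW₁ rvQ ≤ t.2.1 + t.2.2 ∧
    condMI P rvX rvW₁ (fun ω => (rvW₂ ω, rvQ ω)) + condMI P rvX rvW₂ (fun ω => (rvW₁ ω, rvQ ω))
      + condMI P rvZ rvW₁ rvQ + condMI P rvZ rvW₂ rvQ ≤ t.1 + t.2.1 + t.2.2 ∧
    0 ≤ t.2.2}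

/-- The unstructured inner bound `R_u(p)`. -/
def Ru (p : X₁ × X₂ × Y → ℝ) : Set (ℝ × ℝ × ℝ) :=
  closure {t | ∃ (k m₁ m₂ : ℕ) (P : Outcome (Fin k) (Fin m₁) (Fin m₂) X₁ X₂ Y → ℝ),
    IsAdmissible p P ∧ t ∈ unstructuredRates P}

/-- The structured inner bound `R_s(p)`: the auxiliary variables take values in a common
prime field. -/
def Rs (p : X₁ × X₂ × Y → ℝ) : Set (ℝ × ℝ × ℝ) :=
  closure {t | ∃ (k r : ℕ) (_ : Fact r.Prime)
    (P : Outcome (Fin k) (ZMod r) (ZMod r) X₁ X₂ Y → ℝ),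
    IsAdmissible p P ∧ t ∈ structuredRates P}

/-- The PMF of `(X₁ⁿ, X₂ⁿ, Yⁿ)` produced from the i.i.d. sources by the randomized encoders
`E₁ μ`, `E₂ μ` and decoders `D μ`, with `μ` uniform on `Fin N`. -/
noncomputable def inducedPMF (p : X₁ × X₂ × Y → ℝ) {n N Θ₁ Θ₂ : ℕ}
    (E₁ : Fin N → (Fin n → X₁) → Fin Θ₁ → ℝ) (E₂ : Fin N → (Fin n → X₂) → Fin Θ₂ → ℝ)
    (D : Fin N → Fin Θ₁ × Fin Θ₂ → (Fin n → Y) → ℝ)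
    (x₁ : Fin n → X₁) (x₂ : Fin n → X₂) (y : Fin n → Y) : ℝ :=
  ∑ μ, (1 / (N : ℝ)) * ∑ m : Fin Θ₁ × Fin Θ₂,
    (∏ i, ∑ y', p (x₁ i, x₂ i, y')) * E₁ μ x₁ m.1 * E₂ μ x₂ m.2 * D μ m y

/-- The rate triple `(R₁, R₂, C)` is achievable for synthesizing `p`. -/
def IsAchievable (p : X₁ × X₂ × Y → ℝ) (R₁ R₂ C : ℝ) : Prop :=
  0 ≤ C ∧ ∀ ε > 0, ∃ n₀ : ℕ, ∀ n ≥ n₀,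
    ∃ (Θ₁ Θ₂ : ℕ)
      (E₁ : Fin ⌊(2 : ℝ) ^ ((n : ℝ) * C)⌋₊ → (Fin n → X₁) → Fin Θ₁ → ℝ)
      (E₂ : Fin ⌊(2 : ℝ) ^ ((n : ℝ) * C)⌋₊ → (Fin n → X₂) → Fin Θ₂ → ℝ)
      (D : Fin ⌊(2 : ℝ) ^ ((n : ℝ) * C)⌋₊ → Fin Θ₁ × Fin Θ₂ → (Fin n → Y) → ℝ),
      (∀ μ x, IsPMF (E₁ μ x)) ∧ (∀ μ x, IsPMF (E₂ μ x)) ∧ (∀ μ m, IsPMF (D μ m)) ∧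
      (1 / 2) * ∑ x₁ : Fin n → X₁, ∑ x₂ : Fin n → X₂, ∑ y : Fin n → Y,
        |(∏ i, p (x₁ i, x₂ i, y i)) - inducedPMF p E₁ E₂ D x₁ x₂ y| ≤ ε ∧
      Real.logb 2 Θ₁ / n ≤ R₁ + ε ∧ Real.logb 2 Θ₂ / n ≤ R₂ + ε

/-- The achievable rate region `R_d(p)`. -/
def Rd (p : X₁ × X₂ × Y → ℝ) : Set (ℝ × ℝ × ℝ) :=
  {t | IsAchievable p t.1 t.2.1 t.2.2}

end Alphabets

/-- Joint PMF of `(X₁, X₂, Y)`, where `X₁` is a uniform bit, `X₂` is `X₁` flipped with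
probability `p`, and `Y` is `X₁ ⊕ X₂` flipped independently with probability `q`. -/
noncomputable def dsbs (p q : ℝ) (t : ZMod 2 × ZMod 2 × ZMod 2) : ℝ :=
  (1 / 2) * (if t.2.1 = t.1 then 1 - p else p) * (if t.2.2 = t.1 + t.2.1 then 1 - q else q)

/-- The binary entropy function in bits. -/
noncomputable def hb (p : ℝ) : ℝ := Real.binEntropy p / Real.log 2

end CorrSynth

/-!
Given the time sharing variable, an admissible joint PMF is the source PMF followed by two encoder
kernels with at most two outputs and a decoder kernel (`IsAdmissible.exists_testChannel`). All the
statements about the inner bounds are about these test channels.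

**Noiseless target.** For `q = 0` the decoder has to find `X₁ ⊕ X₂` without error. An output that an
encoder produces under both inputs would make this impossible, so each auxiliary variable is a
bijective image of its source (`IsAdmissible.recovers`), and every information quantity in the inner
bounds is determined by the sources, except `I(W₁ ⊕ W₂ ; Wⱼ | Q)`. The latter is nonnegative, and it
vanishes for `Wⱼ = Xⱼ`. This gives `Ru_noiseless` and `Rs_noiseless`.

The structured region is achieved by the scheme of Körner and Marton: both users send the syndrome
of their source under one random binary matrix; the sum of the syndromes is the syndrome of
`X₁ ⊕ X₂`, which determines a typical sequence as soon as it has slightly more than `n h_b(p)` bits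
(`exists_linear_code`, `exists_linear_scheme`). It is optimal, because for given `X₂` and given
messages the decoder is right for a single value of `X₁`, and each typical value of `X₁` has
conditional probability about `2 ^ (-n h_b(p))` (`sum_correct_le`, `IsAchievable.hb_le`).

**The case `p = q = 1 / 10`.** For any admissible PMF some triple of rates attains the constraint
on the sum (`exists_mem_unstructuredRates`), so the infimum in question is that of
`I(X₁, X₂, Y ; W₁, W₂ | Q)`, an average over `Q` of informations of test channels; it is attained,
since rates are nonnegative on the closed set `Ru`, whose points with a bounded sum form a compact
set. The encoders of a test channel determine its decoder, so its information is a function of four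
crossover probabilities (`IsTestChannel.massMI_eq`), and the requirement that the decoder have
probabilities in `[0, 1]` forces all of them to be small, up to a relabelling of the auxiliary
variables. No such channel beats the symmetric one with crossover probability `0.020565` by more than
`3 * 10 ^ (-5)` nats: each entropy is bounded by a second order expansion at that channel
(`binEntropy_le_near_zero`, `joint_entropy_lower`, `conditional_entropy_upper`), and the inequality between polynomials that is left holds up to
`2 * 10 ^ (-5)` (`polynomial_bound`, `test_channel_bound`). The structured bound, on the other hand,
contains `(h_b(p), h_b(p), C)` for every `C ≥ 0` and every noise level `q` (`subset_Rs`).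
-/

open Real

namespace CorrSynth

/-! ### Numerical values of logarithms -/

/-- Partial sums of `log r = 2 * ∑ t ^ (2 * i + 1) / (2 * i + 1)`, where `t = (r - 1) / (r + 1)`,
are lower bounds. -/
theorem le_log_of_series {r a : ℝ} (n : ℕ) (hr : 1 ≤ r)
    (h : a ≤ 2 * ∑ i ∈ Finset.range n, ((r - 1) / (r + 1)) ^ (2 * i + 1) / (2 * i + 1)) :
    a ≤ log r := by
  have h0 : 0 ≤ (r - 1) / (r + 1) := div_nonneg (by linarith) (by linarith)
  have h1 : (r - 1) / (r + 1) < 1 := by rw [div_lt_one (by linarith)]; linarith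
  have hx : (1 + (r - 1) / (r + 1)) / (1 - (r - 1) / (r + 1)) = r := by
    have : r + 1 ≠ 0 := by linarith
    field_simp
    ring_nf
  have hl := sum_range_le_log_div h0 h1 n
  rw [hx] at hl
  linarith

/-- The remainder of `log r = 2 * ∑ t ^ (2 * i + 1) / (2 * i + 1)` is bounded by a
geometric series. -/
theorem log_le_of_series {r a : ℝ} (n : ℕ) (hr : 1 ≤ r)
    (h : 2 * (∑ i ∈ Finset.range n, ((r - 1) / (r + 1)) ^ (2 * i + 1) / (2 * i + 1)
        + ((r - 1) / (r + 1)) ^ (2 * n + 1) / (1 - ((r - 1) / (r + 1)) ^ 2)) ≤ a) :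
    log r ≤ a := by
  have h0 : 0 ≤ (r - 1) / (r + 1) := div_nonneg (by linarith) (by linarith)
  have h1 : (r - 1) / (r + 1) < 1 := by rw [div_lt_one (by linarith)]; linarith
  have hx : (1 + (r - 1) / (r + 1)) / (1 - (r - 1) / (r + 1)) = r := by
    have : r + 1 ≠ 0 := by linarith
    field_simp
    ring_nf
  have hu := log_div_le_sum_range_add h0 h1 n
  rw [hx] at hu
  linarith

theorem log_scale {a r : ℝ} (k : ℕ) (ha : 0 < a) (h : r = a * 2 ^ k) :
    log a = log r - k * log 2 := by
  rw [h, log_mul ha.ne' (by positivity), log_pow]; ring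

theorem log_three_bounds : 1.0986122 ≤ log 3 ∧ log 3 ≤ 1.0986124 := by
  have h1 : (0.4054651 : ℝ) ≤ log (3 / 2) :=
    le_log_of_series 6 (by norm_num) (by norm_num [Finset.sum_range_succ])
  have h2 : log (3 / 2) ≤ (0.4054652 : ℝ) :=
    log_le_of_series 6 (by norm_num) (by norm_num [Finset.sum_range_succ])
  rw [log_div (by norm_num) (by norm_num)] at h1 h2
  constructor <;> linarith [log_two_gt_d9, log_two_lt_d9]

theorem log_five_bounds : 1.6094378 ≤ log 5 ∧ log 5 ≤ 1.6094381 := by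
  have h1 : (0.2231435 : ℝ) ≤ log (5 / 4) :=
    le_log_of_series 6 (by norm_num) (by norm_num [Finset.sum_range_succ])
  have h2 : log (5 / 4) ≤ (0.2231436 : ℝ) :=
    log_le_of_series 6 (by norm_num) (by norm_num [Finset.sum_range_succ])
  rw [log_div (by norm_num) (by norm_num), show (4 : ℝ) = 2 ^ 2 by norm_num, log_pow] at h1 h2
  push_cast at h1 h2
  constructor <;> linarith [log_two_gt_d9, log_two_lt_d9]

-- The remaining numbers are probabilities under the symmetric test channel whose encoders flip
-- their source with probability `4113 / 200000 = (1 - 0.95887) / 2`, which is optimal up to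
-- rounding.
theorem log_flip_bounds :
    -3.8841648 ≤ log (4113 / 200000) ∧ log (4113 / 200000) ≤ -3.8841646 := by
  have h1 : (0.2747184 : ℝ) ≤ log (4113 / 3125) :=
    le_log_of_series 6 (by norm_num) (by norm_num [Finset.sum_range_succ])
  have h2 : log (4113 / 3125) ≤ (0.27471841 : ℝ) :=
    log_le_of_series 6 (by norm_num) (by norm_num [Finset.sum_range_succ])
  have h3 : log (4113 / 200000 : ℝ) = log (4113 / 3125) - (6 : ℕ) * log 2 :=
    log_scale 6 (by norm_num) (by norm_num)
  rw [h3]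
  push_cast
  constructor <;> linarith [log_two_gt_d9, log_two_lt_d9]

theorem log_one_sub_flip_bounds :
    -0.0207795 ≤ log (195887 / 200000) ∧ log (195887 / 200000) ≤ -0.0207794 := by
  have h1 : (0.0207794 : ℝ) ≤ log (200000 / 195887) :=
    le_log_of_series 3 (by norm_num) (by norm_num [Finset.sum_range_succ])
  have h2 : log (200000 / 195887) ≤ (0.0207795 : ℝ) :=
    log_le_of_series 3 (by norm_num) (by norm_num [Finset.sum_range_succ])
  rw [show (195887 / 200000 : ℝ) = (200000 / 195887)⁻¹ by norm_num, log_inv]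
  constructor <;> linarith

/-- With `m = 0.95887 ^ 2 = 0.9194316769`, the probability that the auxiliary variables of this
test channel disagree is `(1 - 0.8 * m) / 2 = 3305683231 / 25000000000`. -/
theorem log_disagree_bounds :
    -2.0232327 ≤ log (3305683231 / 25000000000) ∧
      log (3305683231 / 25000000000) ≤ -2.0232326 := by
  have h1 : (0.05620889 : ℝ) ≤ log (3305683231 / 3125000000) :=
    le_log_of_series 4 (by norm_num) (by norm_num [Finset.sum_range_succ])
  have h2 : log (3305683231 / 3125000000) ≤ (0.0562089 : ℝ) :=
    log_le_of_series 4 (by norm_num) (by norm_num [Finset.sum_range_succ])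
  have h3 : log (3305683231 / 25000000000 : ℝ) = log (3305683231 / 3125000000) - (3 : ℕ) * log 2 :=
    log_scale 3 (by norm_num) (by norm_num)
  rw [h3]
  push_cast
  constructor <;> linarith [log_two_gt_d9, log_two_lt_d9]

theorem log_one_sub_disagree_bounds :
    -0.1418255 ≤ log (21694316769 / 25000000000) ∧
      log (21694316769 / 25000000000) ≤ -0.1418254 := by
  have h1 : (0.1418254 : ℝ) ≤ log (25000000000 / 21694316769) :=
    le_log_of_series 4 (by norm_num) (by norm_num [Finset.sum_range_succ])
  have h2 : log (25000000000 / 21694316769) ≤ (0.1418255 : ℝ) :=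
    log_le_of_series 4 (by norm_num) (by norm_num [Finset.sum_range_succ])
  rw [show (21694316769 / 25000000000 : ℝ) = (25000000000 / 21694316769)⁻¹ by norm_num, log_inv]
  constructor <;> linarith

/-- With `m = 0.95887 ^ 2 = 0.9194316769`, the decoder of this test channel outputs a bit other
than the sum of the auxiliary variables with probability
`(1 - 0.8 / m) / 2 = 1194316769 / 18388633538`. -/
theorem log_miss_bounds :
    -2.7341585 ≤ log (1194316769 / 18388633538) ∧
      log (1194316769 / 18388633538) ≤ -2.7341584 := by
  have h1 : (0.03843027 : ℝ) ≤ log (1194316769 * 8 / 9194316769) :=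
    le_log_of_series 4 (by norm_num) (by norm_num [Finset.sum_range_succ])
  have h2 : log (1194316769 * 8 / 9194316769) ≤ (0.03843028 : ℝ) :=
    log_le_of_series 4 (by norm_num) (by norm_num [Finset.sum_range_succ])
  have h3 : log (1194316769 / 18388633538 : ℝ)
      = log (1194316769 * 8 / 9194316769) - (4 : ℕ) * log 2 :=
    log_scale 4 (by norm_num) (by norm_num)
  rw [h3]
  push_cast
  constructor <;> linarith [log_two_gt_d9, log_two_lt_d9]

theorem log_one_sub_miss_bounds :
    -0.0671539 ≤ log (17194316769 / 18388633538) ∧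
      log (17194316769 / 18388633538) ≤ -0.0671538 := by
  have h1 : (0.0671538 : ℝ) ≤ log (18388633538 / 17194316769) :=
    le_log_of_series 4 (by norm_num) (by norm_num [Finset.sum_range_succ])
  have h2 : log (18388633538 / 17194316769) ≤ (0.0671539 : ℝ) :=
    log_le_of_series 4 (by norm_num) (by norm_num [Finset.sum_range_succ])
  rw [show (17194316769 / 18388633538 : ℝ) = (18388633538 / 17194316769)⁻¹ by norm_num, log_inv]
  constructor <;> linarith

/-! ### Quadratic estimates for the binary entropy function -/

/-- A convex function is minimal at a critical point. -/
theorem _root_.ConvexOn.le_of_hasDerivAt_zero {s : Set ℝ} {f : ℝ → ℝ} {x₀ x : ℝ}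
    (hf : ConvexOn ℝ s f) (h₀ : x₀ ∈ interior s) (hd : HasDerivAt f 0 x₀) (hx : x ∈ s) :
    f x₀ ≤ f x :=
  hf.isMinOn_of_rightDeriv_eq_zero h₀
    (hd.hasDerivWithinAt.derivWithin (uniqueDiffWithinAt_Ioi x₀)) hx

theorem hasDerivAt_deriv_binEntropy {x : ℝ} (h0 : 0 < x) (h1 : x < 1) :
    HasDerivAt (fun x => log (1 - x) - log x) (-(1 / (x * (1 - x)))) x := by
  have hx : x ≠ 0 := h0.ne'
  have hx1 : 1 - x ≠ 0 := by linarith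
  have := ((hasDerivAt_id x).const_sub 1).log hx1 |>.sub (hasDerivAt_log hx)
  refine this.congr_deriv ?_
  simp only [id]
  field_simp
  ring

theorem hasDerivAt_quadratic (c l k x₀ x : ℝ) :
    HasDerivAt (fun x => c + l * (x - x₀) - k * (x - x₀) ^ 2) (l - 2 * k * (x - x₀)) x := by
  have h := (hasDerivAt_id x).sub_const x₀
  have := ((h.const_mul l).const_add c).sub ((h.pow 2).const_mul k)
  refine this.congr_deriv ?_
  simp only [id]
  push_cast
  ring

theorem hasDerivAt_linear (l k x₀ x : ℝ) :
    HasDerivAt (fun x => l - 2 * k * (x - x₀)) (-(2 * k)) x := by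
  have h := (hasDerivAt_id x).sub_const x₀
  have := (h.const_mul (2 * k)).const_sub l
  refine this.congr_deriv ?_
  ring

/-- The entropy lies below its second order expansion at `x₀` with curvature `2 * k`, where
`2 * k` is at most the true curvature `1 / (x * (1 - x))` on the interval. -/
theorem binEntropy_le_quadratic {a b k x₀ x : ℝ} (ha : 0 ≤ a) (hb : b ≤ 1)
    (h₀ : x₀ ∈ Set.Ioo a b) (hk : ∀ x ∈ Set.Ioo a b, 2 * k * (x * (1 - x)) ≤ 1)
    (hx : x ∈ Set.Icc a b) :
    binEntropy x ≤ binEntropy x₀ + (log (1 - x₀) - log x₀) * (x - x₀) - k * (x - x₀) ^ 2 := by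
  have key : ConvexOn ℝ (Set.Icc a b) (fun x => binEntropy x₀
      + (log (1 - x₀) - log x₀) * (x - x₀) - k * (x - x₀) ^ 2 - binEntropy x) := by
    refine convexOn_of_hasDerivWithinAt2_nonneg (convex_Icc a b)
      (f' := fun x => ((log (1 - x₀) - log x₀) - 2 * k * (x - x₀)) - (log (1 - x) - log x))
      (f'' := fun x => -(2 * k) - -(1 / (x * (1 - x)))) ?_ ?_ ?_ ?_
    · fun_prop
    · intro y hy
      rw [interior_Icc] at hy
      exact ((hasDerivAt_quadratic _ _ _ _ y).sub (hasDerivAt_binEntropy (by linarith [hy.1])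
        (by linarith [hy.2]))).hasDerivWithinAt
    · intro y hy
      rw [interior_Icc] at hy
      exact ((hasDerivAt_linear _ _ _ y).sub (hasDerivAt_deriv_binEntropy (by linarith [hy.1])
        (by linarith [hy.2]))).hasDerivWithinAt
    · intro y hy
      rw [interior_Icc] at hy
      have h1 : 0 < y * (1 - y) := mul_pos (by linarith [hy.1]) (by linarith [hy.2])
      have := (le_div_iff₀ h1).2 (hk y hy)
      linarith
  have hd := (hasDerivAt_quadratic (binEntropy x₀) (log (1 - x₀) - log x₀) k x₀ x₀).sub
    (hasDerivAt_binEntropy (p := x₀) (by linarith [h₀.1]) (by linarith [h₀.2]))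
  have := key.le_of_hasDerivAt_zero (by rwa [interior_Icc]) (hd.congr_deriv (by ring)) hx
  simp only [sub_self] at this
  linarith

/-- The entropy lies above its second order expansion at `x₀` with curvature `2 * k`, where
`2 * k` is at least the true curvature `1 / (x * (1 - x))` on the interval. -/
theorem quadratic_le_binEntropy {a b k x₀ x : ℝ} (ha : 0 ≤ a) (hb : b ≤ 1)
    (h₀ : x₀ ∈ Set.Ioo a b) (hk : ∀ x ∈ Set.Ioo a b, 1 ≤ 2 * k * (x * (1 - x)))
    (hx : x ∈ Set.Icc a b) :
    binEntropy x₀ + (log (1 - x₀) - log x₀) * (x - x₀) - k * (x - x₀) ^ 2 ≤ binEntropy x := by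
  have key : ConvexOn ℝ (Set.Icc a b) (fun x => binEntropy x - (binEntropy x₀
      + (log (1 - x₀) - log x₀) * (x - x₀) - k * (x - x₀) ^ 2)) := by
    refine convexOn_of_hasDerivWithinAt2_nonneg (convex_Icc a b)
      (f' := fun x => (log (1 - x) - log x) - ((log (1 - x₀) - log x₀) - 2 * k * (x - x₀)))
      (f'' := fun x => -(1 / (x * (1 - x))) - -(2 * k)) ?_ ?_ ?_ ?_
    · fun_prop
    · intro y hy
      rw [interior_Icc] at hy
      exact ((hasDerivAt_binEntropy (by linarith [hy.1]) (by linarith [hy.2])).sub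
        (hasDerivAt_quadratic _ _ _ _ y)).hasDerivWithinAt
    · intro y hy
      rw [interior_Icc] at hy
      exact ((hasDerivAt_deriv_binEntropy (by linarith [hy.1]) (by linarith [hy.2])).sub
        (hasDerivAt_linear _ _ _ y)).hasDerivWithinAt
    · intro y hy
      rw [interior_Icc] at hy
      have h1 : 0 < y * (1 - y) := mul_pos (by linarith [hy.1]) (by linarith [hy.2])
      have := (div_le_iff₀ h1).2 (hk y hy)
      linarith
  have hd := (hasDerivAt_binEntropy (p := x₀) (by linarith [h₀.1]) (by linarith [h₀.2])).sub
    (hasDerivAt_quadratic (binEntropy x₀) (log (1 - x₀) - log x₀) k x₀ x₀)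
  have := key.le_of_hasDerivAt_zero (by rwa [interior_Icc]) (hd.congr_deriv (by ring)) hx
  simp only [sub_self] at this
  linarith

/-- On an interval on which the curvature of the entropy is at most `2 * k`, the entropy minus a
parabola of curvature `2 * k` is convex, so that comparing the two at the endpoints suffices. -/
theorem binEntropy_le_quadratic_of_endpoints {a b c l k x₀ x : ℝ} (ha : 0 < a) (hb : b < 1)
    (hk : ∀ x ∈ Set.Ioo a b, 1 ≤ 2 * k * (x * (1 - x)))
    (hfa : binEntropy a ≤ c + l * (a - x₀) - k * (a - x₀) ^ 2)
    (hfb : binEntropy b ≤ c + l * (b - x₀) - k * (b - x₀) ^ 2) (hx : x ∈ Set.Icc a b) :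
    binEntropy x ≤ c + l * (x - x₀) - k * (x - x₀) ^ 2 := by
  have key : ConvexOn ℝ (Set.Icc a b) (fun x => binEntropy x - (c
      + l * (x - x₀) - k * (x - x₀) ^ 2)) := by
    refine convexOn_of_hasDerivWithinAt2_nonneg (convex_Icc a b)
      (f' := fun x => (log (1 - x) - log x) - (l - 2 * k * (x - x₀)))
      (f'' := fun x => -(1 / (x * (1 - x))) - -(2 * k)) ?_ ?_ ?_ ?_
    · fun_prop
    · intro y hy
      rw [interior_Icc] at hy
      exact ((hasDerivAt_binEntropy (by linarith [hy.1]) (by linarith [hy.2])).sub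
        (hasDerivAt_quadratic _ _ _ _ y)).hasDerivWithinAt
    · intro y hy
      rw [interior_Icc] at hy
      exact ((hasDerivAt_deriv_binEntropy (by linarith [hy.1]) (by linarith [hy.2])).sub
        (hasDerivAt_linear _ _ _ y)).hasDerivWithinAt
    · intro y hy
      rw [interior_Icc] at hy
      have h1 : 0 < y * (1 - y) := mul_pos (by linarith [hy.1]) (by linarith [hy.2])
      have := (div_le_iff₀ h1).2 (hk y hy)
      linarith
  have hab : a ≤ b := hx.1.trans hx.2
  have := key.le_max_of_mem_Icc (Set.left_mem_Icc.2 hab) (Set.right_mem_Icc.2 hab) hx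
  have h2 : max (binEntropy a - (c + l * (a - x₀) - k * (a - x₀) ^ 2))
      (binEntropy b - (c + l * (b - x₀) - k * (b - x₀) ^ 2)) ≤ 0 :=
    max_le (by linarith) (by linarith)
  have h3 := this.trans h2
  linarith

theorem binEntropy_eq (x : ℝ) : binEntropy x = -(x * log x) - (1 - x) * log (1 - x) := by
  rw [binEntropy_eq_negMulLog_add_negMulLog_one_sub, negMulLog, negMulLog]; ring

/-- A quadratic upper bound for the entropy near `0`, touching it at the (up to rounding) optimal
crossover probability `0.020565`. -/
theorem binEntropy_le_near_zero {x : ℝ} (h0 : 0 ≤ x) (h1 : x ≤ 1 / 9) :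
    binEntropy x ≤ binEntropy (4113 / 200000)
      + (log (195887 / 200000) - log (4113 / 200000)) * (x - 4113 / 200000)
      - (if x ≤ 4113 / 200000 then 24.5 else 1 / 0.082302) * (x - 4113 / 200000) ^ 2 := by
  have e1 : (195887 / 200000 : ℝ) = 1 - 4113 / 200000 := by norm_num
  split_ifs with h
  · rw [e1]
    refine binEntropy_le_quadratic (a := 0) (b := 0.0208) le_rfl (by norm_num)
      ⟨by norm_num, by norm_num⟩ (fun y hy => ?_) ⟨h0, by linarith⟩
    nlinarith [hy.1, hy.2]
  have hnear : ∀ y ∈ Set.Icc (0.01 : ℝ) 0.043, binEntropy y ≤ binEntropy (4113 / 200000)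
      + (log (195887 / 200000) - log (4113 / 200000)) * (y - 4113 / 200000)
      - (1 / 0.082302) * (y - 4113 / 200000) ^ 2 := by
    intro y hy
    rw [e1]
    refine binEntropy_le_quadratic (a := 0.01) (b := 0.043) (by norm_num) (by norm_num)
      ⟨by norm_num, by norm_num⟩ (fun y hy => ?_) hy
    nlinarith [hy.1, hy.2]
  -- further to the right the true curvature drops below that of the parabola
  rcases le_total x 0.043 with h2 | h2
  · exact hnear x ⟨by linarith, h2⟩
  refine binEntropy_le_quadratic_of_endpoints (a := 0.043) (b := 1 / 9) (by norm_num) (by norm_num)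
    (fun y hy => ?_) (hnear _ ⟨by norm_num, le_rfl⟩) ?_ ⟨h2, h1⟩
  · nlinarith [hy.1, hy.2]
  · rw [binEntropy_eq, binEntropy_eq, show (1 - 1 / 9 : ℝ) = 2 ^ 3 / 3 ^ 2 by norm_num,
      show (1 / 9 : ℝ) = (3 ^ 2)⁻¹ by norm_num, log_div (by norm_num) (by norm_num), log_inv,
      log_pow, log_pow, show (1 - 4113 / 200000 : ℝ) = 195887 / 200000 by norm_num]
    have a1 := log_three_bounds
    have a2 := log_flip_bounds
    have a3 := log_one_sub_flip_bounds
    have a4 := log_two_gt_d9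
    have a5 := log_two_lt_d9
    norm_num at a1 a2 a3 a4 a5 ⊢
    linarith

/-- Near `1 / 2` the deficit of the entropy is barely more than its leading term `y ^ 2 / 2`. -/
theorem le_binEntropy_near_half {y : ℝ} (hy : |y| ≤ 0.48) :
    log 2 - 0.53 * y ^ 2 ≤ binEntropy ((1 + y) / 2) := by
  have hder : ∀ z : ℝ, |z| < 1 / 2 → HasDerivAt (fun y => binEntropy ((1 + y) / 2))
      ((log (1 - (1 + z) / 2) - log ((1 + z) / 2)) * (1 / 2)) z := by
    intro z hz
    have := abs_lt.1 hz
    have h1 : HasDerivAt (fun y : ℝ => (1 + y) / 2) (1 / 2) z :=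
      ((hasDerivAt_id z).const_add 1).div_const 2
    exact (hasDerivAt_binEntropy (p := (1 + z) / 2) (by linarith) (by linarith)).comp z h1
  have hder2 : ∀ z : ℝ, |z| < 1 / 2 →
      HasDerivAt (fun z => (log (1 - (1 + z) / 2) - log ((1 + z) / 2)) * (1 / 2))
      (-(1 / (1 - z ^ 2))) z := by
    intro z hz
    have := abs_lt.1 hz
    have h1 : HasDerivAt (fun y : ℝ => (1 + y) / 2) (1 / 2) z :=
      ((hasDerivAt_id z).const_add 1).div_const 2
    have h2 := ((hasDerivAt_deriv_binEntropy (x := (1 + z) / 2) (by linarith)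
      (by linarith)).comp z h1).mul_const (1 / 2)
    refine h2.congr_deriv ?_
    have : (1 + z) ≠ 0 := by linarith
    have : (1 - z) ≠ 0 := by linarith
    rw [show (1 - (1 + z) / 2) = (1 - z) / 2 by ring, show 1 - z ^ 2 = (1 + z) * (1 - z) by ring]
    field_simp
  have hpoly : ∀ z : ℝ, HasDerivAt (fun y : ℝ => log 2 - (y ^ 2 / 2 + y ^ 4 / 8))
      (-(z + z ^ 3 / 2)) z := by
    intro z
    have := (((hasDerivAt_pow 2 z).div_const 2).add ((hasDerivAt_pow 4 z).div_const 8)).const_sub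
      (log 2)
    refine this.congr_deriv ?_
    push_cast; ring
  have hpoly2 : ∀ z : ℝ, HasDerivAt (fun z : ℝ => -(z + z ^ 3 / 2)) (-(1 + 3 * z ^ 2 / 2)) z := by
    intro z
    have := ((hasDerivAt_id z).add ((hasDerivAt_pow 3 z).div_const 2)).neg
    refine this.congr_deriv ?_
    push_cast; ring
  have hmem : ∀ z ∈ interior (Set.Icc (-0.49 : ℝ) 0.49), |z| < 1 / 2 := by
    intro z hz
    rw [interior_Icc] at hz
    rw [abs_lt]; constructor <;> linarith [hz.1, hz.2]
  have key : ConvexOn ℝ (Set.Icc (-0.49 : ℝ) 0.49)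
      (fun y => binEntropy ((1 + y) / 2) - (log 2 - (y ^ 2 / 2 + y ^ 4 / 8))) := by
    refine convexOn_of_hasDerivWithinAt2_nonneg (convex_Icc _ _)
      (fun y hy => ?_)
      (fun z hz => ((hder z (hmem z hz)).sub (hpoly z)).hasDerivWithinAt)
      (fun z hz => ((hder2 z (hmem z hz)).sub (hpoly2 z)).hasDerivWithinAt) ?_
    · have : Continuous fun y : ℝ =>
          binEntropy ((1 + y) / 2) - (log 2 - (y ^ 2 / 2 + y ^ 4 / 8)) := by
        fun_prop
      exact this.continuousWithinAt
    · intro z hz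
      have h1 := abs_lt.1 (hmem z hz)
      have h2 : z ^ 2 ≤ 1 / 4 := by nlinarith
      have h3 : 1 / (1 - z ^ 2) ≤ 1 + 3 * z ^ 2 / 2 := by
        rw [div_le_iff₀ (by linarith)]
        nlinarith [sq_nonneg z]
      linarith
  have h0 : HasDerivAt
      (fun y => binEntropy ((1 + y) / 2) - (log 2 - (y ^ 2 / 2 + y ^ 4 / 8))) 0 0 := by
    refine ((hder 0 (by norm_num)).sub (hpoly 0)).congr_deriv ?_
    norm_num
  have hy' := abs_le.1 hy
  have := key.le_of_hasDerivAt_zero (x := y) (by rw [interior_Icc]; constructor <;> norm_num) h0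
    ⟨by linarith [hy'.1], by linarith [hy'.2]⟩
  norm_num at this
  rw [show (1 / 2 : ℝ) = 2⁻¹ by norm_num, binEntropy_two_inv] at this
  have h2 : y ^ 2 ≤ 0.24 := by nlinarith
  nlinarith [sq_nonneg y]

/-! ### The optimization over binary test channels -/

-- For two encoders with crossover probabilities `e₁`, `e₂` and `f₁`, `f₂`, put `D = 1 - e₁ - e₂`,
-- `E = 1 - f₁ - f₂`, `d = e₁ - e₂`, `g = f₁ - f₂`, `m = D * E` and `ρ = 0.8 * m + d * g`. Then
-- `(W₁, W₂)` has the masses `(1 ∓ d ∓ g + ρ) / 4` and `(1 ∓ d ± g - ρ) / 4`, and the decoder has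
-- the biases `0.8 * (1 ± d) * (1 ± g) / m`. The optimum is near `D = E = 0.95887`,
-- `d = g = 0`.
/-- The quadratic terms of `binEntropy_le_near_zero` for the two crossover probabilities of an
encoder penalize its asymmetry `e₁ - e₂` as well as its deviation from the optimal `D = 0.95887`. -/
theorem user_quadratic (e₁ e₂ : ℝ) :
    3.86 * (e₁ - e₂) ^ 2 + 1.0074 * (1 - e₁ - e₂ - 0.95887) ^ 2 ≤
      1 / 2 * ((if e₁ ≤ 4113 / 200000 then 24.5 else 1 / 0.082302) * (e₁ - 4113 / 200000) ^ 2
        + (if e₂ ≤ 4113 / 200000 then 24.5 else 1 / 0.082302) * (e₂ - 4113 / 200000) ^ 2) := by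
  obtain ⟨z, hz⟩ : ∃ z, z = e₁ - 4113 / 200000 := ⟨_, rfl⟩
  obtain ⟨w, hw⟩ : ∃ w, w = e₂ - 4113 / 200000 := ⟨_, rfl⟩
  have a1 : e₁ - e₂ = z - w := by rw [hz, hw]; ring
  have a2 : 1 - e₁ - e₂ - 0.95887 = -(z + w) := by rw [hz, hw]; norm_num; ring
  have a3 : (12.15 : ℝ) ≤ 1 / 0.082302 := by norm_num
  rw [a1, a2, ← hz, ← hw]
  split_ifs with c1 c2 c2
  · nlinarith [sq_nonneg (z - w), sq_nonneg (z + w)]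
  · have hz0 : z ≤ 0 := by rw [hz]; linarith
    have hw0 : 0 ≤ w := by rw [hw]; linarith
    have : 12.15 * w ^ 2 ≤ 1 / 0.082302 * w ^ 2 := mul_le_mul_of_nonneg_right a3 (sq_nonneg w)
    nlinarith [sq_nonneg (7.3 * z + 2.86 * w), sq_nonneg w]
  · have hz0 : 0 ≤ z := by rw [hz]; linarith
    have hw0 : w ≤ 0 := by rw [hw]; linarith
    have : 12.15 * z ^ 2 ≤ 1 / 0.082302 * z ^ 2 := mul_le_mul_of_nonneg_right a3 (sq_nonneg z)
    nlinarith [sq_nonneg (7.3 * w + 2.86 * z), sq_nonneg z]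
  · have hz0 : 0 ≤ z := by rw [hz]; linarith
    have hw0 : 0 ≤ w := by rw [hw]; linarith
    have : 12.15 * z ^ 2 ≤ 1 / 0.082302 * z ^ 2 := mul_le_mul_of_nonneg_right a3 (sq_nonneg z)
    have : 12.15 * w ^ 2 ≤ 1 / 0.082302 * w ^ 2 := mul_le_mul_of_nonneg_right a3 (sq_nonneg w)
    nlinarith [mul_nonneg hz0 hw0, sq_nonneg z, sq_nonneg w]

/-- The constraint `hc`, which says that the decoder has biases at most `1`, confines the encoders
to nearly symmetric ones with few flips. -/
theorem feasible_bounds {D E d g : ℝ} (hD1 : D ≤ 1) (hE1 : E ≤ 1)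
    (hD : 0 < D) (hE : 0 < E) (hd : |d| ≤ 1 - D) (hg : |g| ≤ 1 - E)
    (hc : (1 + |d|) * (1 + |g|) ≤ 1.25 * (D * E)) :
    0.8 ≤ D ∧ 0.8 ≤ E ∧ 0.8 ≤ D * E ∧ D * E ≤ 1 ∧
    0.6 ≤ 0.8 * (D * E) + d * g ∧ 0.2 + 0.6 * (1 - D * E) ≤ 1 - (0.8 * (D * E) + d * g) ∧
    |d - g| ≤ 0.48 * (1 - (0.8 * (D * E) + d * g)) ∧
    |d + g| ≤ 0.48 * (1 + (0.8 * (D * E) + d * g)) ∧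
    |d * g| ≤ 0.01 := by
  have a1 := abs_nonneg d
  have a2 := abs_nonneg g
  have a3 : |d * g| = |d| * |g| := abs_mul d g
  have hdg : d * g ≤ |d| * |g| := a3 ▸ le_abs_self _
  have hdg' : -(|d| * |g|) ≤ d * g := a3 ▸ neg_abs_le _
  have a4 : |d - g| ≤ |d| + |g| := abs_sub d g
  have a5 : |d + g| ≤ |d| + |g| := abs_add_le d g
  generalize |d| = x at *
  generalize |g| = y at *
  have hxy : 0 ≤ x * y := mul_nonneg a1 a2
  have b1 : 0.8 ≤ D * E := by nlinarith
  have b2 : 0.8 ≤ D := by nlinarith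
  have b3 : 0.8 ≤ E := by nlinarith
  have b4 : D * E ≤ 1 := by nlinarith
  -- `1 - DE = (1 - D) + (1 - E) - (1 - D) (1 - E)`, where the product is at most a tenth of the sum
  have b5 : 0.9 * (1 - D + (1 - E)) ≤ 1 - D * E := by
    nlinarith [mul_nonneg (sub_nonneg.2 hD1) (sub_nonneg.2 b3),
      mul_nonneg (sub_nonneg.2 hE1) (sub_nonneg.2 b2)]
  have b6 : x + y ≤ 0.12 := by nlinarith
  have b7 : x * y ≤ 0.1 * (x + y) := by nlinarith
  have b8 : x * y ≤ 0.0036 := by nlinarith [sq_nonneg (x - y)]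
  have b9 : x * y ≤ 0.2 * (1 - D * E) := by linarith
  refine ⟨b2, b3, b1, b4, by linarith, by linarith, ?_, ?_, by rw [a3]; linarith⟩
  · linarith
  · linarith

theorem entropy_pair_eq (a y : ℝ) :
    negMulLog (a * ((1 + y) / 2)) + negMulLog (a * ((1 - y) / 2))
      = negMulLog a + a * binEntropy ((1 + y) / 2) := by
  rw [negMulLog_mul, negMulLog_mul, binEntropy_eq_negMulLog_add_negMulLog_one_sub,
    show 1 - (1 + y) / 2 = (1 - y) / 2 by ring]
  ring

/-- A lower bound on the entropy of `(W₁, W₂)`, by the chain rule for `W₁ ⊕ W₂` followed by `W₁`. -/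
theorem joint_entropy_lower {d g ρ : ℝ} (h0 : 0.6 ≤ ρ) (h1 : ρ < 1)
    (hm : |d - g| ≤ 0.48 * (1 - ρ)) (hp : |d + g| ≤ 0.48 * (1 + ρ)) :
    log 2 + binEntropy ((1 - ρ) / 2) - 0.53 * (d ^ 2 + g ^ 2) / (1 - ρ) ≤
      negMulLog ((1 - d - g + ρ) / 4) + negMulLog ((1 - d + g - ρ) / 4)
        + negMulLog ((1 + d - g - ρ) / 4) + negMulLog ((1 + d + g + ρ) / 4) := by
  have hpos : 0 < 1 - ρ := by linarith
  have hpos' : 0 < 1 + ρ := by linarith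
  have e1 := entropy_pair_eq ((1 + ρ) / 2) ((d + g) / (1 + ρ))
  have e2 := entropy_pair_eq ((1 - ρ) / 2) ((d - g) / (1 - ρ))
  rw [show (1 + ρ) / 2 * ((1 + (d + g) / (1 + ρ)) / 2) = (1 + d + g + ρ) / 4 by field_simp; ring,
    show (1 + ρ) / 2 * ((1 - (d + g) / (1 + ρ)) / 2) = (1 - d - g + ρ) / 4 by field_simp; ring]
    at e1
  rw [show (1 - ρ) / 2 * ((1 + (d - g) / (1 - ρ)) / 2) = (1 + d - g - ρ) / 4 by field_simp; ring,
    show (1 - ρ) / 2 * ((1 - (d - g) / (1 - ρ)) / 2) = (1 - d + g - ρ) / 4 by field_simp; ring]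
    at e2
  have l1 := le_binEntropy_near_half (y := (d + g) / (1 + ρ)) (by
    rw [abs_div, abs_of_pos hpos', div_le_iff₀ hpos']; exact hp)
  have l2 := le_binEntropy_near_half (y := (d - g) / (1 - ρ)) (by
    rw [abs_div, abs_of_pos hpos, div_le_iff₀ hpos]; exact hm)
  have l1' := mul_le_mul_of_nonneg_left l1 (by linarith : 0 ≤ (1 + ρ) / 2)
  have l2' := mul_le_mul_of_nonneg_left l2 (by linarith : 0 ≤ (1 - ρ) / 2)
  have e3 := binEntropy_eq_negMulLog_add_negMulLog_one_sub ((1 - ρ) / 2)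
  rw [show 1 - (1 - ρ) / 2 = (1 + ρ) / 2 by ring] at e3
  have q : (1 + ρ) / 2 * (0.53 * ((d + g) / (1 + ρ)) ^ 2)
      + (1 - ρ) / 2 * (0.53 * ((d - g) / (1 - ρ)) ^ 2)
      ≤ 0.53 * (d ^ 2 + g ^ 2) / (1 - ρ) := by
    have : 0.53 * (d ^ 2 + g ^ 2) / (1 - ρ) - ((1 + ρ) / 2 * (0.53 * ((d + g) / (1 + ρ)) ^ 2)
        + (1 - ρ) / 2 * (0.53 * ((d - g) / (1 - ρ)) ^ 2))
        = 0.53 * (ρ * (d + g) ^ 2) / ((1 - ρ) * (1 + ρ)) := by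
      field_simp
      ring
    have h2 : 0 ≤ 0.53 * (ρ * (d + g) ^ 2) / ((1 - ρ) * (1 + ρ)) := by positivity
    linarith
  nlinarith

/-- Rounding the coefficient of a small quantity. -/
theorem mul_le_of_approx {A A₀ v δ : ℝ} (hA : |A - A₀| ≤ δ) (hv : |v| ≤ 1) :
    A * v ≤ A₀ * v + δ := by
  have h : (A - A₀) * v ≤ δ := by
    calc (A - A₀) * v ≤ |(A - A₀) * v| := le_abs_self _
      _ = |A - A₀| * |v| := abs_mul _ _
      _ ≤ |A - A₀| * 1 := mul_le_mul_of_nonneg_left hv (abs_nonneg _)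
      _ ≤ δ := by linarith
  linarith

/-- What asymmetry, measured by `S = d ^ 2 + g ^ 2`, gains in `H(W₁, W₂)` and in `H(Y | W₁, W₂)` is
less than the `3.86 * S` that it costs by `user_quadratic`. -/
theorem spread_cost {S m ρ : ℝ} (hS : 0 ≤ S) (h1 : 0.8 ≤ m) (h2 : m ≤ 1)
    (hρ : 0.2 + 0.6 * (1 - m) ≤ 1 - ρ) :
    0.53 * S / (1 - ρ) + 1.0669 * S / m ≤ 3.72 * S := by
  have hm : 0 < m := by linarith
  have h3 : 0 < 0.8 - 0.6 * m := by linarith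
  have h4 : 0.53 / (0.8 - 0.6 * m) + 1.0669 / m ≤ 3.72 := by
    rw [div_add_div _ _ h3.ne' hm.ne', div_le_iff₀ (mul_pos h3 hm)]
    nlinarith [mul_nonneg (sub_nonneg.2 h1) (sub_nonneg.2 h2)]
  have h5 : 0.53 * S / (1 - ρ) ≤ 0.53 * S / (0.8 - 0.6 * m) :=
    div_le_div_of_nonneg_left (by positivity) h3 (by linarith)
  calc _ ≤ 0.53 * S / (0.8 - 0.6 * m) + 1.0669 * S / m := by linarith
    _ = S * (0.53 / (0.8 - 0.6 * m) + 1.0669 / m) := by ring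
    _ ≤ S * 3.72 := mul_le_mul_of_nonneg_left h4 hS
    _ = _ := by ring

/-- After all entropies are replaced by their expansions at the optimum, this is what is left. The
factors `1.9316926`, `0.9407036` and `1.3335023` are half the derivatives of the entropy at the
optimal probabilities; the linear terms cancel up to rounding, and the quadratic ones
are dominated by those on the right. -/
theorem polynomial_bound {D E d g : ℝ} (hD1 : D ≤ 1) (hE1 : E ≤ 1)
    (hD : 0.8 ≤ D) (hE : 0.8 ≤ E) (hm : 0.8 ≤ D * E) (hP : |d * g| ≤ 0.01) :
    -1.9316926 * ((D - 0.95887) + (E - 0.95887))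
      + 0.9407036 * (0.8 * (D * E - 0.9194316769) + d * g)
      + 1.39 * (0.8 * (D * E - 0.9194316769) + d * g) ^ 2
      + 1.3335023 * (0.8 / 0.9194316769
        - 0.8 * ((1 - d ^ 2) * (1 - g ^ 2) / (D * E) + 0.8 * (d * g)))
    ≤ 1.0669 * (d ^ 2 + g ^ 2) / (D * E) + 0.14 * (d ^ 2 + g ^ 2)
      + 1.0074 * ((D - 0.95887) ^ 2 + (E - 0.95887) ^ 2) + 0.00002 := by
  obtain ⟨m, hmdef⟩ : ∃ m, m = D * E := ⟨_, rfl⟩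
  obtain ⟨P, hPdef⟩ : ∃ P, P = d * g := ⟨_, rfl⟩
  obtain ⟨S, hSdef⟩ : ∃ S, S = d ^ 2 + g ^ 2 := ⟨_, rfl⟩
  obtain ⟨x, hx⟩ : ∃ x, x = D - 0.95887 := ⟨_, rfl⟩
  obtain ⟨y, hy⟩ : ∃ y, y = E - 0.95887 := ⟨_, rfl⟩
  obtain ⟨μ, hμ⟩ : ∃ μ, μ = m - 0.9194316769 := ⟨_, rfl⟩
  have hm1 : m ≤ 1 := by rw [hmdef]; nlinarith
  rw [← hmdef] at hm
  have hm0 : 0 < m := by linarith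
  have e1 : (1 - d ^ 2) * (1 - g ^ 2) = 1 - S + P ^ 2 := by rw [hSdef, hPdef]; ring
  have e2 : μ = 0.95887 * (x + y) + x * y := by
    rw [hμ, hmdef, hx, hy]; ring
  rw [e1, ← hmdef, ← hPdef, ← hSdef, ← hx, ← hy, ← hμ]
  rw [← hPdef] at hP
  have hS : 2 * |P| ≤ S := by
    rw [hPdef, hSdef, abs_mul]
    nlinarith [sq_nonneg (|d| - |g|), sq_abs d, sq_abs g]
  -- expansion of `1 / m` at the optimum, with exact remainder
  have e3 : 0.8 / 0.9194316769 - 0.8 * ((1 - S + P ^ 2) / m + 0.8 * P)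
      = 0.8 / 0.9194316769 ^ 2 * μ - 0.8 / 0.9194316769 ^ 2 * (μ ^ 2 / m) + 0.8 * (S / m)
        - 0.8 * (P ^ 2 / m) - 0.64 * P := by
    rw [hμ]; field_simp; ring
  have b1 : μ ^ 2 ≤ μ ^ 2 / m := by rw [le_div_iff₀ hm0]; nlinarith [sq_nonneg μ]
  have b2 : P ^ 2 ≤ P ^ 2 / m := by rw [le_div_iff₀ hm0]; nlinarith [sq_nonneg P]
  have b3 : 0 ≤ S / m := div_nonneg (by linarith [abs_nonneg P]) hm0.le
  have e4 : 1.0669 * S / m = 1.0669 * (S / m) := by ring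
  rw [e3, e4]
  have hμ1 : -0.12 ≤ μ := by linarith
  have hμ2 : μ ≤ 0.081 := by linarith
  have hP1 := abs_le.1 hP
  have hc : (0.0873 + 2.224 * μ) * P ≤ 0.27 * |P| := by
    calc (0.0873 + 2.224 * μ) * P ≤ |(0.0873 + 2.224 * μ) * P| := le_abs_self _
      _ = |0.0873 + 2.224 * μ| * |P| := abs_mul _ _
      _ ≤ 0.27 * |P| := mul_le_mul_of_nonneg_right (abs_le.2 ⟨by linarith, by linarith⟩)
        (abs_nonneg _)
  have hP2 : P ^ 2 ≤ 0.01 * |P| := by rw [← sq_abs]; nlinarith [abs_nonneg P]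
  have hxy : x * y ≤ (x ^ 2 + y ^ 2) / 2 := by nlinarith [sq_nonneg (x - y)]
  have hx1 : |x + y| ≤ 0.4 := by rw [hx, hy, abs_le]; constructor <;> linarith
  have hx2 := abs_le.1 hx1
  have hPP := neg_abs_le P
  have hPP' := le_abs_self P
  norm_num at *
  nlinarith [sq_nonneg μ]

/-- The tangent bound on `H(Y | W₁, W₂)`: the entropy is concave, and `(1 - d ^ 2) (1 - g ^ 2) / m
+ 0.8 d g` is the average over `(W₁, W₂)` of the decoder's bias divided by `0.8`. -/
theorem conditional_entropy_upper {m d g ρ : ℝ} (hm : 0 < m) (hρ : ρ = 0.8 * m + d * g)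
    (h1 : |d| ≤ 1) (h2 : |g| ≤ 1) (hc : (1 + |d|) * (1 + |g|) ≤ 1.25 * m)
    (p₁ : 0 ≤ 1 - d - g + ρ) (p₂ : 0 ≤ 1 - d + g - ρ) (p₃ : 0 ≤ 1 + d - g - ρ)
    (p₄ : 0 ≤ 1 + d + g + ρ) :
    (1 - d - g + ρ) / 4 * binEntropy ((1 - 0.8 * ((1 + d) * (1 + g) / m)) / 2)
      + (1 - d + g - ρ) / 4 * binEntropy ((1 - 0.8 * ((1 + d) * (1 - g) / m)) / 2)
      + (1 + d - g - ρ) / 4 * binEntropy ((1 - 0.8 * ((1 - d) * (1 + g) / m)) / 2)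
      + (1 + d + g + ρ) / 4 * binEntropy ((1 - 0.8 * ((1 - d) * (1 - g) / m)) / 2)
    ≤ binEntropy (1194316769 / 18388633538)
      + (log (17194316769 / 18388633538) - log (1194316769 / 18388633538)) / 2
        * (0.8 / 0.9194316769 - 0.8 * ((1 - d ^ 2) * (1 - g ^ 2) / m + 0.8 * (d * g))) := by
  have d1 := abs_le.1 h1
  have g1 := abs_le.1 h2
  have key : ∀ u v : ℝ, 0 ≤ u → 0 ≤ v → u ≤ 1 + |d| → v ≤ 1 + |g| →
      binEntropy ((1 - 0.8 * (u * v / m)) / 2) ≤ binEntropy (1194316769 / 18388633538)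
      + (log (17194316769 / 18388633538) - log (1194316769 / 18388633538)) / 2
        * (0.8 / 0.9194316769 - 0.8 * (u * v / m)) := by
    intro u v hu hv hu' hv'
    have h3 : u * v / m ≤ 1.25 := by
      rw [div_le_iff₀ hm]
      exact (mul_le_mul hu' hv' hv (by linarith)).trans hc
    have h4 : 0 ≤ u * v / m := by positivity
    have := binEntropy_le_quadratic (a := 0) (b := 1) (k := 0) (x₀ := 1194316769 / 18388633538)
      (x := (1 - 0.8 * (u * v / m)) / 2) le_rfl le_rfl
      ⟨by norm_num, by norm_num⟩ (fun y _ => by norm_num) ⟨by linarith, by linarith⟩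
    rw [show (1 - 1194316769 / 18388633538 : ℝ) = 17194316769 / 18388633538 by norm_num] at this
    refine this.trans (le_of_eq ?_)
    rw [show (1194316769 / 18388633538 : ℝ) = (1 - 0.8 / 0.9194316769) / 2 by norm_num]
    ring
  have k1 := key (1 + d) (1 + g) (by linarith) (by linarith) (by linarith [le_abs_self d])
    (by linarith [le_abs_self g])
  have k2 := key (1 + d) (1 - g) (by linarith) (by linarith) (by linarith [le_abs_self d])
    (by linarith [neg_abs_le g])
  have k3 := key (1 - d) (1 + g) (by linarith) (by linarith) (by linarith [neg_abs_le d])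
    (by linarith [le_abs_self g])
  have k4 := key (1 - d) (1 - g) (by linarith) (by linarith) (by linarith [neg_abs_le d])
    (by linarith [neg_abs_le g])
  have l1 := mul_le_mul_of_nonneg_left k1 (by linarith : 0 ≤ (1 - d - g + ρ) / 4)
  have l2 := mul_le_mul_of_nonneg_left k2 (by linarith : 0 ≤ (1 - d + g - ρ) / 4)
  have l3 := mul_le_mul_of_nonneg_left k3 (by linarith : 0 ≤ (1 + d - g - ρ) / 4)
  have l4 := mul_le_mul_of_nonneg_left k4 (by linarith : 0 ≤ (1 + d + g + ρ) / 4)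
  refine (add_le_add (add_le_add (add_le_add l1 l2) l3) l4).trans (le_of_eq ?_)
  clear l1 l2 l3 l4 k1 k2 k3 k4 key
  generalize binEntropy (1194316769 / 18388633538) = B
  generalize (log (17194316769 / 18388633538) - log (1194316769 / 18388633538)) / 2 = C
  generalize (0.8 / 0.9194316769 : ℝ) = t
  rw [hρ]
  field_simp
  ring

/-- The value of `H(W₁ | X₁) + H(W₂ | X₂) - H(W₁, W₂) + H(Y | W₁, W₂)`, in nats, at the symmetric
test channel with crossover probability `0.020565`, where `W₁` and `W₂` disagree with probability
`3305683231 / 25000000000` and `Y` differs from `W₁ ⊕ W₂` with probability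
`1194316769 / 18388633538`. -/
noncomputable def optimalValue : ℝ :=
  2 * binEntropy (4113 / 200000) - log 2 - binEntropy (3305683231 / 25000000000)
    + binEntropy (1194316769 / 18388633538)


/-- No pair of binary encoders that admits a decoder beats the symmetric test channel by more than
`3 * 10 ^ (-5)` nats in `H(W₁ | X₁) + H(W₂ | X₂) - H(W₁, W₂) + H(Y | W₁, W₂)`. -/
theorem test_channel_bound {e₁ e₂ f₁ f₂ : ℝ} (he₁ : 0 ≤ e₁) (he₂ : 0 ≤ e₂) (hf₁ : 0 ≤ f₁)
    (hf₂ : 0 ≤ f₂) {D E d g m ρ : ℝ} (hDdef : D = 1 - e₁ - e₂) (hEdef : E = 1 - f₁ - f₂)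
    (hd : d = e₁ - e₂) (hg : g = f₁ - f₂) (hm : m = D * E) (hρ : ρ = 0.8 * m + d * g)
    (hD : 0 < D) (hE : 0 < E) (hc : (1 + |d|) * (1 + |g|) ≤ 1.25 * m) :
    (binEntropy e₁ + binEntropy e₂) / 2 + (binEntropy f₁ + binEntropy f₂) / 2
      - (negMulLog ((1 - d - g + ρ) / 4) + negMulLog ((1 - d + g - ρ) / 4)
        + negMulLog ((1 + d - g - ρ) / 4) + negMulLog ((1 + d + g + ρ) / 4))
      + ((1 - d - g + ρ) / 4 * binEntropy ((1 - 0.8 * ((1 + d) * (1 + g) / m)) / 2)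
      + (1 - d + g - ρ) / 4 * binEntropy ((1 - 0.8 * ((1 + d) * (1 - g) / m)) / 2)
      + (1 + d - g - ρ) / 4 * binEntropy ((1 - 0.8 * ((1 - d) * (1 + g) / m)) / 2)
      + (1 + d + g + ρ) / 4 * binEntropy ((1 - 0.8 * ((1 - d) * (1 - g) / m)) / 2))
    ≤ optimalValue + 0.00003 := by
  have hD1 : D ≤ 1 := by linarith only [hDdef, he₁, he₂]
  have hE1 : E ≤ 1 := by linarith only [hEdef, hf₁, hf₂]
  have hdD : |d| ≤ 1 - D := by
    rw [abs_le]; constructor <;> linarith only [hDdef, he₁, he₂, hd]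
  have hgE : |g| ≤ 1 - E := by
    rw [abs_le]; constructor <;> linarith only [hEdef, hf₁, hf₂, hg]
  rw [hm] at hc
  obtain ⟨c1, c2, c3, c4, c5, c6, c7, c8, c9⟩ := feasible_bounds hD1 hE1 hD hE hdD hgE hc
  have hpoly := polynomial_bound hD1 hE1 c1 c2 c3 c9
  have hS : 0 ≤ d ^ 2 + g ^ 2 := by positivity
  have hspread := spread_cost hS c3 c4 c6
  have hd1 : 1 + |d| ≤ 1.25 * D := by
    nlinarith only [hc, abs_nonneg d, abs_nonneg g, hE1, hD]
  have hg1 : 1 + |g| ≤ 1.25 * E := by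
    nlinarith only [hc, abs_nonneg d, abs_nonneg g, hD1, hE]
  rw [← hm] at hc c3 c4 hpoly hspread c5 c6 c7 c8
  rw [← hρ] at hspread c5 c6 c7 c8
  have c7' := abs_le.1 c7
  have c8' := abs_le.1 c8
  have hρ1 : ρ ≤ 0.8 := by linarith only [c6, c4]
  have hdg : |d * g| ≤ 0.01 := c9
  have hdg' := abs_le.1 hdg
  have hY := conditional_entropy_upper (by linarith only [c3]) hρ
    (by linarith only [hdD, hD] : |d| ≤ 1) (by linarith only [hgE, hE] : |g| ≤ 1) hc
    (by linarith only [c8'.2, hρ1, c5]) (by linarith only [c7'.2, hρ1])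
    (by linarith only [c7'.1, hρ1]) (by linarith only [c8'.1, c5])
  have hW := joint_entropy_lower (d := d) (g := g) c5 (by linarith only [hρ1]) c7 c8
  have hρ2 := quadratic_le_binEntropy (a := 0.1) (b := 0.21) (k := 5.56)
    (x₀ := 3305683231 / 25000000000) (x := (1 - ρ) / 2) (by norm_num) (by norm_num)
    ⟨by norm_num, by norm_num⟩ (fun y hy => by nlinarith only [hy.1, hy.2])
    ⟨by linarith only [hρ1], by linarith only [c5]⟩
  rw [show (1 - 3305683231 / 25000000000 : ℝ) = 21694316769 / 25000000000 by norm_num,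
    show (1 - ρ) / 2 - 3305683231 / 25000000000
      = -(0.8 * (m - 0.9194316769) + d * g) / 2 by rw [hρ]; ring] at hρ2
  have q₁ := binEntropy_le_near_zero he₁ (by linarith only [hd1, le_abs_self d, hd, hDdef, he₂])
  have q₂ := binEntropy_le_near_zero he₂ (by linarith only [hd1, neg_abs_le d, hd, hDdef, he₁])
  have r₁ := binEntropy_le_near_zero hf₁ (by linarith only [hg1, le_abs_self g, hg, hEdef, hf₂])
  have r₂ := binEntropy_le_near_zero hf₂ (by linarith only [hg1, neg_abs_le g, hg, hEdef, hf₁])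
  have u := user_quadratic e₁ e₂
  have v := user_quadratic f₁ f₂
  rw [← hd, ← hDdef] at u
  rw [← hg, ← hEdef] at v
  have a₁ := mul_le_of_approx (A := (log (195887 / 200000) - log (4113 / 200000)) / 2)
    (A₀ := 1.9316926) (δ := 0.000001) (v := -((D - 0.95887) + (E - 0.95887)))
    (by
      have := log_flip_bounds
      have := log_one_sub_flip_bounds
      rw [abs_le]; constructor <;> linarith)
    (by rw [abs_le]; constructor <;> linarith only [c1, c2, hD1, hE1])
  have a₂ := mul_le_of_approx
    (A := (log (21694316769 / 25000000000) - log (3305683231 / 25000000000)) / 2)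
    (A₀ := 0.9407036) (δ := 0.000001) (v := 0.8 * (m - 0.9194316769) + d * g)
    (by
      have := log_disagree_bounds
      have := log_one_sub_disagree_bounds
      rw [abs_le]; constructor <;> linarith)
    (by rw [abs_le]; constructor <;> linarith only [c3, c4, hdg'.1, hdg'.2])
  have hq : 0 ≤ (1 - d ^ 2) * (1 - g ^ 2) / m ∧ (1 - d ^ 2) * (1 - g ^ 2) / m ≤ 1.25 := by
    have hd2 : d ^ 2 ≤ 1 := by rw [← sq_abs]; nlinarith only [abs_nonneg d, hdD, c1]
    have hg2 : g ^ 2 ≤ 1 := by rw [← sq_abs]; nlinarith only [abs_nonneg g, hgE, c2]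
    have hm0 : 0 < m := by linarith only [c3]
    refine ⟨div_nonneg (mul_nonneg (by linarith only [hd2]) (by linarith only [hg2])) hm0.le, ?_⟩
    rw [div_le_iff₀ hm0]
    nlinarith only [sq_nonneg d, sq_nonneg g, hd2, hg2, c3]
  have a₃ := mul_le_of_approx
    (A := (log (17194316769 / 18388633538) - log (1194316769 / 18388633538)) / 2)
    (A₀ := 1.3335023) (δ := 0.000001)
    (v := 0.8 / 0.9194316769 - 0.8 * ((1 - d ^ 2) * (1 - g ^ 2) / m + 0.8 * (d * g)))
    (by
      have := log_miss_bounds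
      have := log_one_sub_miss_bounds
      rw [abs_le]; constructor <;> linarith)
    (by rw [abs_le]; constructor <;> linarith only [hq.1, hq.2, hdg'.1, hdg'.2])
  refine (add_le_add_right hY _).trans ?_
  refine (add_le_add_left (sub_le_sub_left hW _) _).trans ?_
  rw [optimalValue]
  -- the terms linear in the crossover probabilities
  have lin : (log (195887 / 200000) - log (4113 / 200000)) / 2 * (-((D - 0.95887) + (E - 0.95887)))
      = ((log (195887 / 200000) - log (4113 / 200000)) * (e₁ - 4113 / 200000)
        + (log (195887 / 200000) - log (4113 / 200000)) * (e₂ - 4113 / 200000)) / 2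
        + ((log (195887 / 200000) - log (4113 / 200000)) * (f₁ - 4113 / 200000)
        + (log (195887 / 200000) - log (4113 / 200000)) * (f₂ - 4113 / 200000)) / 2 := by
    rw [hDdef, hEdef]; ring
  rw [lin] at a₁
  have sq : 5.56 * (-(0.8 * (m - 0.9194316769) + d * g) / 2) ^ 2
      = 1.39 * (0.8 * (m - 0.9194316769) + d * g) ^ 2 := by ring
  have sq' : (log (21694316769 / 25000000000) - log (3305683231 / 25000000000))
      * (-(0.8 * (m - 0.9194316769) + d * g) / 2)
      = -((log (21694316769 / 25000000000) - log (3305683231 / 25000000000)) / 2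
        * (0.8 * (m - 0.9194316769) + d * g)) := by ring
  rw [sq, sq'] at hρ2
  linarith only [hpoly, hspread, a₁, a₂, a₃, hρ2, q₁, q₂, r₁, r₂, u, v, hS]

/-! ### Laws, entropies and conditional mutual information -/

section Mass

variable {α β : Type} [Fintype α] [Fintype β]

/-- Mutual information, in nats, of a (not necessarily normalized) matrix of masses. -/
noncomputable def massMI (f : α → β → ℝ) : ℝ :=
  ∑ a, negMulLog (∑ b, f a b) + ∑ b, negMulLog (∑ a, f a b) - ∑ a, ∑ b, negMulLog (f a b)
    - negMulLog (∑ a, ∑ b, f a b)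

theorem massMI_smul (c : ℝ) (f : α → β → ℝ) :
    massMI (fun a b => c * f a b) = c * massMI f := by
  unfold massMI
  simp_rw [← Finset.mul_sum, negMulLog_mul, Finset.sum_add_distrib, ← Finset.sum_mul,
    ← Finset.mul_sum]
  rw [Finset.sum_comm (f := fun b a => f a b)]
  ring

theorem massMI_nonneg {f : α → β → ℝ} (hf : ∀ a b, 0 ≤ f a b) :
    0 ≤ massMI f := by
  set T := ∑ a, ∑ b, f a b with hT
  have hT0 : 0 ≤ T := Finset.sum_nonneg fun a _ => Finset.sum_nonneg fun b _ => hf a b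
  have hrow : ∀ a, 0 ≤ ∑ b, f a b := fun a => Finset.sum_nonneg fun b _ => hf a b
  have hcol : ∀ b, 0 ≤ ∑ a, f a b := fun b => Finset.sum_nonneg fun a _ => hf a b
  have hTcol : ∑ b, ∑ a, f a b = T := by rw [hT, Finset.sum_comm]
  have point : ∀ a b, f a b - (∑ b, f a b) * (∑ a, f a b) / T ≤
      f a b * log (f a b) - f a b * log (∑ b, f a b) - f a b * log (∑ a, f a b)
        + f a b * log T := by
    intro a b
    rcases (hf a b).eq_or_lt with h | h
    · rw [← h]
      simp only [zero_mul, sub_zero, add_zero, zero_sub, Left.neg_nonpos_iff]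
      exact div_nonneg (mul_nonneg (hrow a) (hcol b)) hT0
    have h1 : 0 < ∑ b, f a b := h.trans_le (Finset.single_le_sum (f := fun b => f a b)
      (fun b _ => hf a b) (Finset.mem_univ b))
    have h2 : 0 < ∑ a, f a b := h.trans_le (Finset.single_le_sum (f := fun a => f a b)
      (fun a _ => hf a b) (Finset.mem_univ a))
    have h3 : 0 < T := h1.trans_le (Finset.single_le_sum (f := fun a => ∑ b, f a b)
      (fun a _ => hrow a) (Finset.mem_univ a))
    have h4 := log_le_sub_one_of_pos (div_pos (div_pos (mul_pos h1 h2) h3) h)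
    rw [log_div (by positivity) h.ne', log_div (by positivity) h3.ne',
      log_mul h1.ne' h2.ne'] at h4
    have h5 := mul_le_mul_of_nonneg_left h4 h.le
    rw [mul_sub, mul_sub (f a b) _ 1, mul_div_cancel₀ _ h.ne'] at h5
    linarith
  have hsum := Finset.sum_le_sum fun a (_ : a ∈ Finset.univ) =>
    Finset.sum_le_sum fun b (_ : b ∈ Finset.univ) => point a b
  simp only [Finset.sum_add_distrib, Finset.sum_sub_distrib] at hsum
  have s1 : ∑ a, ∑ b, (∑ b, f a b) * (∑ a, f a b) / T = T := by
    simp_rw [← Finset.sum_div, ← Finset.mul_sum, hTcol, ← Finset.sum_mul, ← hT]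
    exact mul_self_div_self T
  have s2 : ∑ a, ∑ b, f a b * log (∑ b, f a b) = ∑ a, (∑ b, f a b) * log (∑ b, f a b) :=
    Finset.sum_congr rfl fun a _ => by rw [Finset.sum_mul]
  have s3 : ∑ a, ∑ b, f a b * log (∑ a, f a b) = ∑ b, (∑ a, f a b) * log (∑ a, f a b) := by
    rw [Finset.sum_comm]
    exact Finset.sum_congr rfl fun a _ => by rw [Finset.sum_mul]
  have s4 : ∑ a, ∑ b, f a b * log T = T * log T := by
    simp_rw [← Finset.sum_mul, ← hT]
  rw [s1, s2, s3, s4, ← hT] at hsum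
  unfold massMI
  simp only [negMulLog, neg_mul, Finset.sum_neg_distrib, ← hT]
  linarith

/-- A matrix of masses of rank one carries no information. -/
theorem massMI_eq_zero {f : α → β → ℝ} (hf : ∀ a b, 0 ≤ f a b)
    (h : ∀ a b, f a b * ∑ a, ∑ b, f a b = (∑ b, f a b) * ∑ a, f a b) : massMI f = 0 := by
  set T := ∑ a, ∑ b, f a b with hT
  rcases eq_or_ne T 0 with h0 | h0
  · have hz : ∀ a b, f a b = 0 := by
      intro a b
      rw [hT] at h0
      have h1 := (Finset.sum_eq_zero_iff_of_nonneg
        (fun a _ => Finset.sum_nonneg fun b _ => hf a b)).1 h0 a (Finset.mem_univ a)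
      exact (Finset.sum_eq_zero_iff_of_nonneg (fun b _ => hf a b)).1 h1 b (Finset.mem_univ b)
    simp [massMI, hz]
  have hTcol : ∑ b, ∑ a, f a b = T := by rw [hT, Finset.sum_comm]
  have e1 : ∀ a b, T * negMulLog (f a b) + f a b * negMulLog T
      = (∑ a, f a b) * negMulLog (∑ b, f a b) + (∑ b, f a b) * negMulLog (∑ a, f a b) := by
    intro a b
    have := negMulLog_mul (∑ b, f a b) (∑ a, f a b)
    rw [← h a b, negMulLog_mul] at this
    exact this
  have e2 := Finset.sum_congr rfl fun a (_ : a ∈ Finset.univ) =>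
    Finset.sum_congr rfl fun b (_ : b ∈ Finset.univ) => e1 a b
  simp only [Finset.sum_add_distrib, ← Finset.mul_sum, ← Finset.sum_mul, hTcol, ← hT] at e2
  unfold massMI
  rw [← hT]
  refine mul_left_cancel₀ h0 ?_
  linarith

end Mass

section General

variable {Ω α β δ : Type} [Fintype Ω] [DecidableEq α] [DecidableEq β] [DecidableEq δ]

theorem law_nonneg {P : Ω → ℝ} (hP : ∀ ω, 0 ≤ P ω) (A : Ω → α) (a : α) : 0 ≤ law P A a :=
  Finset.sum_nonneg fun ω _ => by split_ifs <;> simp [hP ω]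

theorem sum_law [Fintype α] (P : Ω → ℝ) (A : Ω → α) : ∑ a, law P A a = ∑ ω, P ω := by
  unfold law
  rw [Finset.sum_comm]
  exact Finset.sum_congr rfl fun ω _ => by simp

theorem law_snd [Fintype α] [Fintype β] (P : Ω → ℝ) (A : Ω → α) (B : Ω → β) (b : β) :
    law P B b = ∑ a, law P (fun ω => (A ω, B ω)) (a, b) := by
  unfold law
  rw [Finset.sum_comm]
  refine Finset.sum_congr rfl fun ω _ => ?_
  by_cases h : B ω = b <;> simp [h]

/-- The entropy of `A` only depends on the partition of the support that `A` induces. -/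
theorem entropy_congr [Fintype α] [Fintype β] {P : Ω → ℝ} {A : Ω → α} {B : Ω → β}
    (h : ∀ ω ω', P ω ≠ 0 → P ω' ≠ 0 → (A ω = A ω' ↔ B ω = B ω')) :
    entropy P A = entropy P B := by
  -- `H(A)` as an expectation over the outcomes, in which only the fibres of `A` matter
  have key : ∀ {γ : Type} [Fintype γ] [DecidableEq γ] (C : Ω → γ),
      ∑ c, negMulLog (law P C c)
        = -∑ ω, P ω * log (∑ ω', if C ω' = C ω then P ω' else 0) := by
    intro γ _ _ C
    have : ∀ c, negMulLog (law P C c)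
        = -∑ ω, if C ω = c then P ω * log (law P C c) else 0 := by
      intro c
      rw [negMulLog, neg_mul]
      conv_lhs => rw [show law P C c * log (law P C c)
        = (∑ ω, if C ω = c then P ω else 0) * log (law P C c) from rfl]
      rw [Finset.sum_mul]
      congr 1
      exact Finset.sum_congr rfl fun ω _ => by split_ifs <;> simp
    simp_rw [this]
    rw [Finset.sum_neg_distrib, Finset.sum_comm]
    congr 1
    refine Finset.sum_congr rfl fun ω _ => ?_
    rw [Finset.sum_ite_eq]
    simp [law]
  unfold entropy
  rw [key A, key B]
  congr 2
  refine Finset.sum_congr rfl fun ω _ => ?_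
  by_cases h0 : P ω = 0
  · simp [h0]
  congr 2
  refine Finset.sum_congr rfl fun ω' _ => ?_
  by_cases h1 : P ω' = 0
  · simp [h1]
  · simp only [h ω' ω h1 h0]

variable [Fintype α] [Fintype β] [Fintype δ]

theorem condMI_eq_sum_massMI (P : Ω → ℝ) (A : Ω → α) (B : Ω → β) (D : Ω → δ) :
    condMI P A B D
      = (∑ d, massMI fun a b => law P (fun ω => (A ω, B ω, D ω)) (a, b, d)) / log 2 := by
  have h1 : ∀ a d, law P (fun ω => (A ω, D ω)) (a, d)
      = ∑ b, law P (fun ω => (A ω, B ω, D ω)) (a, b, d) := by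
    intro a d
    unfold law
    rw [Finset.sum_comm]
    refine Finset.sum_congr rfl fun ω _ => ?_
    by_cases h : A ω = a <;> by_cases h' : D ω = d <;> simp [h, h']
  have h2 : ∀ b d, law P (fun ω => (B ω, D ω)) (b, d)
      = ∑ a, law P (fun ω => (A ω, B ω, D ω)) (a, b, d) := fun b d =>
    law_snd P A (fun ω => (B ω, D ω)) (b, d)
  have h3 : ∀ d, law P D d = ∑ a, ∑ b, law P (fun ω => (A ω, B ω, D ω)) (a, b, d) := by
    intro d
    rw [law_snd P A D d]
    exact Finset.sum_congr rfl fun a _ => h1 a d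
  unfold condMI entropy massMI
  rw [← add_div, ← sub_div, ← sub_div]
  congr 1
  simp only [Fintype.sum_prod_type, h1, h2, h3]
  rw [Finset.sum_sub_distrib, Finset.sum_sub_distrib, Finset.sum_add_distrib]
  rw [Finset.sum_comm (f := fun a d => negMulLog (∑ b, law P (fun ω => (A ω, B ω, D ω)) (a, b, d))),
    Finset.sum_comm (f := fun b d => negMulLog (∑ a, law P (fun ω => (A ω, B ω, D ω)) (a, b, d)))]
  congr 2
  rw [Finset.sum_comm]
  conv_rhs => rw [Finset.sum_comm]
  conv_lhs => rw [Finset.sum_comm]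
  exact Finset.sum_congr rfl fun a _ => Finset.sum_comm

theorem condMI_nonneg {P : Ω → ℝ} (hP : ∀ ω, 0 ≤ P ω) (A : Ω → α) (B : Ω → β) (D : Ω → δ) :
    0 ≤ condMI P A B D := by
  rw [condMI_eq_sum_massMI]
  exact div_nonneg (Finset.sum_nonneg fun d _ => massMI_nonneg fun a b => law_nonneg hP _ _)
    (log_nonneg (by norm_num))

theorem Markov.condMI_eq_zero {P : Ω → ℝ} (hP : ∀ ω, 0 ≤ P ω) {A : Ω → α} {D : Ω → δ} {B : Ω → β}
    (h : Markov P A D B) : condMI P A B D = 0 := by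
  rw [condMI_eq_sum_massMI, Finset.sum_eq_zero, zero_div]
  intro d _
  have e : ∀ a b, law P (fun ω => (A ω, B ω, D ω)) (a, b, d)
      = law P (fun ω => (A ω, D ω, B ω)) (a, d, b) := by
    intro a b
    refine Finset.sum_congr rfl fun ω _ => ?_
    simp only [Prod.mk.injEq]
    congr 1
    exact propext (by tauto)
  have h1 : ∀ a, ∑ b, law P (fun ω => (A ω, D ω, B ω)) (a, d, b)
      = law P (fun ω => (A ω, D ω)) (a, d) := by
    intro a
    unfold law
    rw [Finset.sum_comm]
    refine Finset.sum_congr rfl fun ω _ => ?_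
    by_cases h : A ω = a <;> by_cases h' : D ω = d <;> simp [h, h']
  have h2 : ∀ b, ∑ a, law P (fun ω => (A ω, D ω, B ω)) (a, d, b)
      = law P (fun ω => (D ω, B ω)) (d, b) := fun b =>
    (law_snd P A (fun ω => (D ω, B ω)) (d, b)).symm
  have h3 : ∑ a, law P (fun ω => (A ω, D ω)) (a, d) = law P D d := (law_snd P A D d).symm
  refine massMI_eq_zero (fun a b => law_nonneg hP _ _) fun a b => ?_
  simp only [e, h1, h2, h3]
  exact h a d b

end General

/-! ### Marginals of a joint PMF of `(Q, W₁, W₂, X₁, X₂, Y)` -/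

/-- The indicator of `a = b`. -/
noncomputable def kron {α : Type} [DecidableEq α] (a b : α) : ℝ := if a = b then 1 else 0

theorem kron_pair {α β : Type} [DecidableEq α] [DecidableEq β] (a a' : α) (b b' : β) :
    kron (a, b) (a', b') = kron a a' * kron b b' := by
  by_cases h : a = a' <;> by_cases h' : b = b' <;> simp [kron, h, h']

theorem law_eq_sum_kron {Ω α : Type} [Fintype Ω] [DecidableEq α] (P : Ω → ℝ) (A : Ω → α) (a : α) :
    law P A a = ∑ ω, P ω * kron (A ω) a := by
  simp [law, kron]

section Marginals

variable {Q W₁ W₂ X₁ X₂ Y : Type}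
variable [Fintype Q] [Fintype W₁] [Fintype W₂] [Fintype X₁] [Fintype X₂] [Fintype Y]
variable [DecidableEq Q] [DecidableEq W₁] [DecidableEq W₂] [DecidableEq X₁] [DecidableEq X₂]
  [DecidableEq Y]

set_option linter.unusedSectionVars false
set_option linter.unusedSimpArgs false

variable (P : Outcome Q W₁ W₂ X₁ X₂ Y → ℝ)

-- The tuples, with their repetitions, are those in which `IsAdmissible` states its conditions.
theorem law_rvQ (q : Q) :
    law P rvQ q
      = ∑ w₁, ∑ w₂, ∑ x₁, ∑ x₂, ∑ y, P (q, w₁, w₂, x₁, x₂, y) := by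
  simp only [law_eq_sum_kron, kron_pair, Fintype.sum_prod_type, rvQ, rvX₁, rvX₂, rvY, rvW₁, rvW₂,
    rvX, rvW, rvXY]
  simp [kron]

theorem law_QXY (q : Q) (x₁ : X₁) (x₂ : X₂) (y : Y) :
    law P (fun ω => (rvQ ω, rvXY ω)) (q, (x₁, x₂, y))
      = ∑ w₁, ∑ w₂, P (q, w₁, w₂, x₁, x₂, y) := by
  simp only [law_eq_sum_kron, kron_pair, Fintype.sum_prod_type, rvQ, rvX₁, rvX₂, rvY, rvW₁, rvW₂,
    rvX, rvW, rvXY]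
  simp [kron]

theorem law_rvXY (x₁ : X₁) (x₂ : X₂) (y : Y) :
    law P rvXY (x₁, x₂, y)
      = ∑ q, ∑ w₁, ∑ w₂, P (q, w₁, w₂, x₁, x₂, y) := by
  simp only [law_eq_sum_kron, kron_pair, Fintype.sum_prod_type, rvQ, rvX₁, rvX₂, rvY, rvW₁, rvW₂,
    rvX, rvW, rvXY]
  simp [kron]

theorem law_encoder₁ (q : Q) (w₁ : W₁) (w₂ : W₂) (x₁ : X₁) (x₂ : X₂) :
    law P (fun ω => (rvW₁ ω, (rvQ ω, rvX₁ ω), (rvQ ω, rvX₂ ω), rvW₂ ω)) (w₁, (q, x₁), (q, x₂), w₂)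
      = ∑ y, P (q, w₁, w₂, x₁, x₂, y) := by
  simp only [law_eq_sum_kron, kron_pair, Fintype.sum_prod_type, rvQ, rvX₁, rvX₂, rvY, rvW₁, rvW₂,
    rvX, rvW, rvXY]
  simp [kron]

theorem law_QX₁ (q : Q) (x₁ : X₁) :
    law P (fun ω => (rvQ ω, rvX₁ ω)) (q, x₁)
      = ∑ w₁, ∑ w₂, ∑ x₂, ∑ y, P (q, w₁, w₂, x₁, x₂, y) := by
  simp only [law_eq_sum_kron, kron_pair, Fintype.sum_prod_type, rvQ, rvX₁, rvX₂, rvY, rvW₁, rvW₂,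
    rvX, rvW, rvXY]
  simp [kron]

theorem law_W₁QX₁ (q : Q) (w₁ : W₁) (x₁ : X₁) :
    law P (fun ω => (rvW₁ ω, rvQ ω, rvX₁ ω)) (w₁, q, x₁)
      = ∑ w₂, ∑ x₂, ∑ y, P (q, w₁, w₂, x₁, x₂, y) := by
  simp only [law_eq_sum_kron, kron_pair, Fintype.sum_prod_type, rvQ, rvX₁, rvX₂, rvY, rvW₁, rvW₂,
    rvX, rvW, rvXY]
  simp [kron]

theorem law_X₁X₂W₂ (q : Q) (w₂ : W₂) (x₁ : X₁) (x₂ : X₂) :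
    law P (fun ω => ((rvQ ω, rvX₁ ω), (rvQ ω, rvX₂ ω), rvW₂ ω)) ((q, x₁), (q, x₂), w₂)
      = ∑ w₁, ∑ y, P (q, w₁, w₂, x₁, x₂, y) := by
  simp only [law_eq_sum_kron, kron_pair, Fintype.sum_prod_type, rvQ, rvX₁, rvX₂, rvY, rvW₁, rvW₂,
    rvX, rvW, rvXY]
  simp [kron]

theorem law_encoder₂ (q : Q) (w₁ : W₁) (w₂ : W₂) (x₁ : X₁) (x₂ : X₂) :
    law P (fun ω => ((rvW₁ ω, (rvQ ω, rvX₁ ω)), (rvQ ω, rvX₂ ω), rvW₂ ω))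
        ((w₁, (q, x₁)), (q, x₂), w₂)
      = ∑ y, P (q, w₁, w₂, x₁, x₂, y) := by
  simp only [law_eq_sum_kron, kron_pair, Fintype.sum_prod_type, rvQ, rvX₁, rvX₂, rvY, rvW₁, rvW₂,
    rvX, rvW, rvXY]
  simp [kron]

theorem law_QX₂ (q : Q) (x₂ : X₂) :
    law P (fun ω => (rvQ ω, rvX₂ ω)) (q, x₂)
      = ∑ w₁, ∑ w₂, ∑ x₁, ∑ y, P (q, w₁, w₂, x₁, x₂, y) := by
  simp only [law_eq_sum_kron, kron_pair, Fintype.sum_prod_type, rvQ, rvX₁, rvX₂, rvY, rvW₁, rvW₂,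
    rvX, rvW, rvXY]
  simp [kron]

theorem law_W₁X₁X₂ (q : Q) (w₁ : W₁) (x₁ : X₁) (x₂ : X₂) :
    law P (fun ω => ((rvW₁ ω, (rvQ ω, rvX₁ ω)), (rvQ ω, rvX₂ ω))) ((w₁, (q, x₁)), (q, x₂))
      = ∑ w₂, ∑ y, P (q, w₁, w₂, x₁, x₂, y) := by
  simp only [law_eq_sum_kron, kron_pair, Fintype.sum_prod_type, rvQ, rvX₁, rvX₂, rvY, rvW₁, rvW₂,
    rvX, rvW, rvXY]
  simp [kron]

theorem law_QX₂W₂ (q : Q) (w₂ : W₂) (x₂ : X₂) :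
    law P (fun ω => ((rvQ ω, rvX₂ ω), rvW₂ ω)) ((q, x₂), w₂)
      = ∑ w₁, ∑ x₁, ∑ y, P (q, w₁, w₂, x₁, x₂, y) := by
  simp only [law_eq_sum_kron, kron_pair, Fintype.sum_prod_type, rvQ, rvX₁, rvX₂, rvY, rvW₁, rvW₂,
    rvX, rvW, rvXY]
  simp [kron]

theorem law_decoder (q : Q) (w₁ : W₁) (w₂ : W₂) (x₁ : X₁) (x₂ : X₂) (y : Y) :
    law P (fun ω => (rvX ω, (rvQ ω, rvW ω), rvY ω)) ((x₁, x₂), (q, (w₁, w₂)), y)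
      = P (q, w₁, w₂, x₁, x₂, y) := by
  simp only [law_eq_sum_kron, kron_pair, Fintype.sum_prod_type, rvQ, rvX₁, rvX₂, rvY, rvW₁, rvW₂,
    rvX, rvW, rvXY]
  simp [kron]

theorem law_QW (q : Q) (w₁ : W₁) (w₂ : W₂) :
    law P (fun ω => (rvQ ω, rvW ω)) (q, (w₁, w₂))
      = ∑ x₁, ∑ x₂, ∑ y, P (q, w₁, w₂, x₁, x₂, y) := by
  simp only [law_eq_sum_kron, kron_pair, Fintype.sum_prod_type, rvQ, rvX₁, rvX₂, rvY, rvW₁, rvW₂,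
    rvX, rvW, rvXY]
  simp [kron]

theorem law_XQW (q : Q) (w₁ : W₁) (w₂ : W₂) (x₁ : X₁) (x₂ : X₂) :
    law P (fun ω => (rvX ω, (rvQ ω, rvW ω))) ((x₁, x₂), (q, (w₁, w₂)))
      = ∑ y, P (q, w₁, w₂, x₁, x₂, y) := by
  simp only [law_eq_sum_kron, kron_pair, Fintype.sum_prod_type, rvQ, rvX₁, rvX₂, rvY, rvW₁, rvW₂,
    rvX, rvW, rvXY]
  simp [kron]

theorem law_QWY (q : Q) (w₁ : W₁) (w₂ : W₂) (y : Y) :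
    law P (fun ω => ((rvQ ω, rvW ω), rvY ω)) ((q, (w₁, w₂)), y)
      = ∑ x₁, ∑ x₂, P (q, w₁, w₂, x₁, x₂, y) := by
  simp only [law_eq_sum_kron, kron_pair, Fintype.sum_prod_type, rvQ, rvX₁, rvX₂, rvY, rvW₁, rvW₂,
    rvX, rvW, rvXY]
  simp [kron]

theorem law_XYWQ (q : Q) (w₁ : W₁) (w₂ : W₂) (x₁ : X₁) (x₂ : X₂) (y : Y) :
    law P (fun ω => (rvXY ω, rvW ω, rvQ ω)) ((x₁, x₂, y), (w₁, w₂), q)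
      = P (q, w₁, w₂, x₁, x₂, y) := by
  simp only [law_eq_sum_kron, kron_pair, Fintype.sum_prod_type, rvQ, rvX₁, rvX₂, rvY, rvW₁, rvW₂,
    rvX, rvW, rvXY]
  simp [kron]

end Marginals

/-! ### Test channels: admissible joint PMFs in product form -/

theorem zmod_two_cases (x : ZMod 2) : x = 0 ∨ x = 1 := by revert x; decide

theorem sum_zmod_two (f : ZMod 2 → ℝ) : ∑ x, f x = f 0 + f 1 := Fin.sum_univ_two f

/-- The joint PMF of the sources `(X₁, X₂)`. -/
noncomputable def source (p : ℝ) (x₁ x₂ : ZMod 2) : ℝ := (1 / 2) * (if x₂ = x₁ then 1 - p else p)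

/-- The conditional PMF of `Y` given `X₁ ⊕ X₂ = s`. -/
noncomputable def target (q : ℝ) (s y : ZMod 2) : ℝ := if y = s then 1 - q else q

theorem dsbs_eq (p q : ℝ) (x₁ x₂ y : ZMod 2) :
    dsbs p q (x₁, x₂, y) = source p x₁ x₂ * target q (x₁ + x₂) y := rfl

theorem sum_source_right (p : ℝ) (x₁ : ZMod 2) : ∑ x₂, source p x₁ x₂ = 1 / 2 := by
  rw [sum_zmod_two]
  rcases zmod_two_cases x₁ with rfl | rfl <;> simp [source] <;> ring

theorem sum_source_left (p : ℝ) (x₂ : ZMod 2) : ∑ x₁, source p x₁ x₂ = 1 / 2 := by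
  rw [sum_zmod_two]
  rcases zmod_two_cases x₂ with rfl | rfl <;> simp [source] <;> ring

theorem sum_target (q : ℝ) (s : ZMod 2) : ∑ y, target q s y = 1 := by
  rw [sum_zmod_two]
  rcases zmod_two_cases s with rfl | rfl <;> simp [target]

theorem source_pos {p : ℝ} (h0 : 0 < p) (h1 : p < 1) (x₁ x₂ : ZMod 2) : 0 < source p x₁ x₂ := by
  unfold source
  split_ifs <;> linarith

/-- Two encoder kernels and a decoder kernel that synthesize the target exactly. -/
structure IsTestChannel {W₁ W₂ : Type} [Fintype W₁] [Fintype W₂] (p q : ℝ)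
    (A : ZMod 2 → W₁ → ℝ) (B : ZMod 2 → W₂ → ℝ) (G : W₁ → W₂ → ZMod 2 → ℝ) : Prop where
  encoder₁ : ∀ x, IsPMF (A x)
  encoder₂ : ∀ x, IsPMF (B x)
  decoder : ∀ w₁ w₂, IsPMF (G w₁ w₂)
  output : ∀ x₁ x₂ y, ∑ w₁, ∑ w₂, A x₁ w₁ * B x₂ w₂ * G w₁ w₂ y = target q (x₁ + x₂) y

section Disintegration

variable {Q W₁ W₂ : Type} [Fintype Q] [Fintype W₁] [Fintype W₂]
  [DecidableEq Q] [DecidableEq W₁] [DecidableEq W₂]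
  {p q : ℝ} {P : Outcome Q W₁ W₂ (ZMod 2) (ZMod 2) (ZMod 2) → ℝ}

/-- Given `Q = t`, an admissible joint PMF is the source PMF followed by a test channel. -/
theorem IsAdmissible.exists_testChannel (h : IsAdmissible (dsbs p q) P) (hp0 : 0 < p) (hp1 : p < 1)
    {t : Q} (ht : law P rvQ t ≠ 0) :
    ∃ (A : ZMod 2 → W₁ → ℝ) (B : ZMod 2 → W₂ → ℝ) (G : W₁ → W₂ → ZMod 2 → ℝ),
      IsTestChannel p q A B G ∧ ∀ w₁ w₂ x₁ x₂ y, P (t, w₁, w₂, x₁, x₂, y)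
        = law P rvQ t * (source p x₁ x₂ * A x₁ w₁ * B x₂ w₂ * G w₁ w₂ y) := by
  have hP := h.isPMF.1
  have hw : 0 < law P rvQ t := lt_of_le_of_ne (law_nonneg hP _ _) (Ne.symm ht)
  set w := law P rvQ t with hwdef
  -- the law of `(Q, X₁, X₂, Y)`
  have hQXY : ∀ x₁ x₂ y, ∑ w₁, ∑ w₂, P (t, w₁, w₂, x₁, x₂, y)
      = w * (source p x₁ x₂ * target q (x₁ + x₂) y) := by
    intro x₁ x₂ y
    have := h.timeSharing t (x₁, x₂, y)
    rw [h.marginal, dsbs_eq] at this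
    rw [← this, ← law_QXY]
  have hQX : ∀ x₁ x₂, ∑ w₁, ∑ w₂, ∑ y, P (t, w₁, w₂, x₁, x₂, y) = w * source p x₁ x₂ := by
    intro x₁ x₂
    have e := Finset.sum_congr rfl fun y (_ : y ∈ Finset.univ) => hQXY x₁ x₂ y
    rw [← Finset.mul_sum, ← Finset.mul_sum, sum_target, mul_one] at e
    rw [← e, Finset.sum_comm]
    rw [Finset.sum_comm (s := (Finset.univ : Finset (ZMod 2)))]
    rw [Finset.sum_comm]
    exact Finset.sum_congr rfl fun w₁ _ => Finset.sum_comm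
  have hQX₁ : ∀ x₁, ∑ w₁, ∑ w₂, ∑ x₂, ∑ y, P (t, w₁, w₂, x₁, x₂, y) = w / 2 := by
    intro x₁
    have e := Finset.sum_congr rfl fun x₂ (_ : x₂ ∈ Finset.univ) => hQX x₁ x₂
    rw [← Finset.mul_sum, sum_source_right] at e
    rw [show w / 2 = w * (1 / 2) by ring, ← e,
      Finset.sum_comm (s := (Finset.univ : Finset (ZMod 2)))]
    exact Finset.sum_congr rfl fun w₁ _ => Finset.sum_comm
  have hQX₂ : ∀ x₂, ∑ w₁, ∑ w₂, ∑ x₁, ∑ y, P (t, w₁, w₂, x₁, x₂, y) = w / 2 := by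
    intro x₂
    have e := Finset.sum_congr rfl fun x₁ (_ : x₁ ∈ Finset.univ) => hQX x₁ x₂
    rw [← Finset.mul_sum, sum_source_left] at e
    rw [show w / 2 = w * (1 / 2) by ring, ← e,
      Finset.sum_comm (s := (Finset.univ : Finset (ZMod 2)))]
    exact Finset.sum_congr rfl fun w₁ _ => Finset.sum_comm
  have mk1 : ∀ w₁ x₁ x₂ w₂, (∑ y, P (t, w₁, w₂, x₁, x₂, y)) * (w / 2)
      = (∑ w₂, ∑ x₂, ∑ y, P (t, w₁, w₂, x₁, x₂, y)) * ∑ w₁, ∑ y, P (t, w₁, w₂, x₁, x₂, y) := by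
    intro w₁ x₁ x₂ w₂
    have := h.encoders.1 w₁ (t, x₁) ((t, x₂), w₂)
    rw [law_QX₁, hQX₁] at this
    rw [← law_encoder₁, ← law_W₁QX₁, ← law_X₁X₂W₂]
    exact this
  have mk2 : ∀ w₁ x₁ x₂ w₂, (∑ y, P (t, w₁, w₂, x₁, x₂, y)) * (w / 2)
      = (∑ w₂, ∑ y, P (t, w₁, w₂, x₁, x₂, y)) * ∑ w₁, ∑ x₁, ∑ y, P (t, w₁, w₂, x₁, x₂, y) := by
    intro w₁ x₁ x₂ w₂
    have := h.encoders.2 (w₁, (t, x₁)) (t, x₂) w₂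
    rw [law_QX₂, hQX₂] at this
    rw [← law_encoder₂, ← law_W₁X₁X₂, ← law_QX₂W₂]
    exact this
  have mk3 : ∀ w₁ w₂ x₁ x₂ y, P (t, w₁, w₂, x₁, x₂, y) * (∑ x₁, ∑ x₂, ∑ y, P (t, w₁, w₂, x₁, x₂, y))
      = (∑ y, P (t, w₁, w₂, x₁, x₂, y)) * ∑ x₁, ∑ x₂, P (t, w₁, w₂, x₁, x₂, y) := by
    intro w₁ w₂ x₁ x₂ y
    have := h.decoder (x₁, x₂) (t, (w₁, w₂)) y
    rw [law_QW] at this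
    rw [← law_XQW, ← law_QWY, ← law_decoder P t w₁ w₂ x₁ x₂ y]
    exact this
  set A : ZMod 2 → W₁ → ℝ := fun x₁ w₁ => (∑ w₂, ∑ x₂, ∑ y, P (t, w₁, w₂, x₁, x₂, y)) / (w / 2)
    with hA
  set B : ZMod 2 → W₂ → ℝ := fun x₂ w₂ => (∑ w₁, ∑ x₁, ∑ y, P (t, w₁, w₂, x₁, x₂, y)) / (w / 2)
    with hB
  set c : W₁ → W₂ → ℝ := fun w₁ w₂ => ∑ x₁, ∑ x₂, ∑ y, P (t, w₁, w₂, x₁, x₂, y) with hc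
  -- where `W` has probability zero, the decoder is irrelevant; it then outputs `0`
  set G : W₁ → W₂ → ZMod 2 → ℝ := fun w₁ w₂ y =>
    if c w₁ w₂ = 0 then (if y = 0 then 1 else 0)
    else (∑ x₁, ∑ x₂, P (t, w₁, w₂, x₁, x₂, y)) / c w₁ w₂ with hG
  have hAB : ∀ w₁ w₂ x₁ x₂, ∑ y, P (t, w₁, w₂, x₁, x₂, y)
      = w * (source p x₁ x₂ * A x₁ w₁ * B x₂ w₂) := by
    intro w₁ w₂ x₁ x₂
    have e1 := mk1 w₁ x₁ x₂ w₂
    have e2 : (∑ w₁, ∑ y, P (t, w₁, w₂, x₁, x₂, y)) * (w / 2)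
        = w * source p x₁ x₂ * ∑ w₁, ∑ x₁, ∑ y, P (t, w₁, w₂, x₁, x₂, y) := by
      rw [Finset.sum_mul, ← hQX x₁ x₂, Finset.sum_mul]
      exact Finset.sum_congr rfl fun w₁ _ => mk2 w₁ x₁ x₂ w₂
    simp only [hA, hB]
    have hw2 : w ≠ 0 := hw.ne'
    field_simp
    have : (∑ y, P (t, w₁, w₂, x₁, x₂, y)) * (w / 2) * (w / 2)
        = (∑ w₂, ∑ x₂, ∑ y, P (t, w₁, w₂, x₁, x₂, y))
          * (w * source p x₁ x₂ * ∑ w₁, ∑ x₁, ∑ y, P (t, w₁, w₂, x₁, x₂, y)) := by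
      rw [e1, mul_assoc, e2]
    refine mul_left_cancel₀ hw2 ?_
    linarith
  have hcz : ∀ w₁ w₂, c w₁ w₂ = 0 → ∀ x₁ x₂ y, P (t, w₁, w₂, x₁, x₂, y) = 0 := by
    intro w₁ w₂ h0 x₁ x₂ y
    have h1 := (Finset.sum_eq_zero_iff_of_nonneg fun x₁ _ => Finset.sum_nonneg fun x₂ _ =>
      Finset.sum_nonneg fun y _ => hP _).1 h0 x₁ (Finset.mem_univ _)
    have h2 := (Finset.sum_eq_zero_iff_of_nonneg fun x₂ _ =>
      Finset.sum_nonneg fun y _ => hP _).1 h1 x₂ (Finset.mem_univ _)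
    exact (Finset.sum_eq_zero_iff_of_nonneg fun y _ => hP _).1 h2 y (Finset.mem_univ _)
  have hfull : ∀ w₁ w₂ x₁ x₂ y, P (t, w₁, w₂, x₁, x₂, y)
      = w * (source p x₁ x₂ * A x₁ w₁ * B x₂ w₂ * G w₁ w₂ y) := by
    intro w₁ w₂ x₁ x₂ y
    rw [← mul_assoc w, ← hAB]
    by_cases h0 : c w₁ w₂ = 0
    · simp [hcz w₁ w₂ h0]
    · simp only [hG, if_neg h0]
      rw [← mul_div_assoc, eq_div_iff h0]
      exact mk3 w₁ w₂ x₁ x₂ y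
  refine ⟨A, B, G, ⟨fun x => ⟨fun w₁ => ?_, ?_⟩, fun x => ⟨fun w₂ => ?_, ?_⟩,
    fun w₁ w₂ => ⟨fun y => ?_, ?_⟩, fun x₁ x₂ y => ?_⟩, hfull⟩
  · exact div_nonneg (Finset.sum_nonneg fun _ _ => Finset.sum_nonneg fun _ _ =>
      Finset.sum_nonneg fun _ _ => hP _) (by linarith)
  · rw [← Finset.sum_div, hQX₁, div_self (by linarith)]
  · exact div_nonneg (Finset.sum_nonneg fun _ _ => Finset.sum_nonneg fun _ _ =>
      Finset.sum_nonneg fun _ _ => hP _) (by linarith)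
  · rw [← Finset.sum_div, Finset.sum_comm, hQX₂, div_self (by linarith)]
  · simp only [hG]
    split_ifs
    · norm_num
    · norm_num
    · exact div_nonneg (Finset.sum_nonneg fun _ _ => Finset.sum_nonneg fun _ _ => hP _)
        (Finset.sum_nonneg fun _ _ => Finset.sum_nonneg fun _ _ =>
          Finset.sum_nonneg fun _ _ => hP _)
  · simp only [hG]
    split_ifs with h0
    · simp
    · rw [← Finset.sum_div, div_eq_one_iff_eq h0, hc, Finset.sum_comm]
      exact Finset.sum_congr rfl fun x₁ _ => Finset.sum_comm
  · have e := hQXY x₁ x₂ y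
    simp only [hfull, ← Finset.mul_sum, mul_assoc] at e
    have e2 := mul_left_cancel₀ hw.ne' e
    have e3 := mul_left_cancel₀ (source_pos hp0 hp1 x₁ x₂).ne' e2
    rw [← e3]
    refine Finset.sum_congr rfl fun w₁ _ => ?_
    rw [Finset.mul_sum]
    exact Finset.sum_congr rfl fun _ _ => by ring

end Disintegration

/-! ### The information of a test channel -/

theorem sum_negMulLog_mul {ι : Type} [Fintype ι] (a : ℝ) {k : ι → ℝ} (hk : ∑ i, k i = 1) :
    ∑ i, negMulLog (a * k i) = negMulLog a + a * ∑ i, negMulLog (k i) := by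
  simp_rw [negMulLog_mul, Finset.sum_add_distrib, ← Finset.sum_mul, hk, ← Finset.mul_sum, one_mul]

theorem sum_negMulLog_target (q : ℝ) (s : ZMod 2) :
    ∑ y, negMulLog (target q s y) = binEntropy q := by
  rw [sum_zmod_two, binEntropy_eq_negMulLog_add_negMulLog_one_sub]
  rcases zmod_two_cases s with rfl | rfl
  · simp [target]; ring
  · simp [target]

/-- The joint mass of `((X₁, X₂, Y), (W₁, W₂))` of a test channel. -/
noncomputable def channelMass {W₁ W₂ : Type} (p : ℝ) (A : ZMod 2 → W₁ → ℝ) (B : ZMod 2 → W₂ → ℝ)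
    (G : W₁ → W₂ → ZMod 2 → ℝ) (t : ZMod 2 × ZMod 2 × ZMod 2) (w : W₁ × W₂) : ℝ :=
  source p t.1 t.2.1 * A t.1 w.1 * B t.2.1 w.2 * G w.1 w.2 t.2.2

/-- The mass of `(W₁, W₂)` of a test channel. -/
noncomputable def auxMass {W₁ W₂ : Type} (p : ℝ) (A : ZMod 2 → W₁ → ℝ) (B : ZMod 2 → W₂ → ℝ)
    (w₁ : W₁) (w₂ : W₂) : ℝ :=
  ∑ x₁, ∑ x₂, source p x₁ x₂ * A x₁ w₁ * B x₂ w₂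

section Information

variable {W₁ W₂ : Type} [Fintype W₁] [Fintype W₂] {p q : ℝ} {A : ZMod 2 → W₁ → ℝ}
  {B : ZMod 2 → W₂ → ℝ} {G : W₁ → W₂ → ZMod 2 → ℝ}

theorem IsTestChannel.sum_channelMass_right (h : IsTestChannel p q A B G) (x₁ x₂ y : ZMod 2) :
    ∑ w, channelMass p A B G (x₁, x₂, y) w = source p x₁ x₂ * target q (x₁ + x₂) y := by
  rw [← h.output x₁ x₂ y, Fintype.sum_prod_type, Finset.mul_sum]
  refine Finset.sum_congr rfl fun w₁ _ => ?_
  rw [Finset.mul_sum]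
  refine Finset.sum_congr rfl fun w₂ _ => ?_
  simp only [channelMass]
  ring

theorem IsTestChannel.sum_channelMass_left (h : IsTestChannel p q A B G) (w₁ : W₁) (w₂ : W₂) :
    ∑ t, channelMass p A B G t (w₁, w₂) = auxMass p A B w₁ w₂ := by
  simp only [Fintype.sum_prod_type, channelMass, ← Finset.mul_sum, (h.decoder w₁ w₂).2, mul_one,
    auxMass]

theorem IsTestChannel.sum_channelMass (h : IsTestChannel p q A B G) :
    ∑ t, ∑ w, channelMass p A B G t w = 1 := by
  simp only [h.sum_channelMass_right]
  simp only [Fintype.sum_prod_type, ← Finset.mul_sum, sum_target, mul_one, sum_source_right]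
  simp

theorem IsTestChannel.massMI_eq (h : IsTestChannel p q A B G) :
    massMI (channelMass p A B G) = binEntropy q + ∑ w₁, ∑ w₂, negMulLog (auxMass p A B w₁ w₂)
      - (∑ x, ∑ w, negMulLog (A x w)) / 2 - (∑ x, ∑ w, negMulLog (B x w)) / 2
      - ∑ w₁, ∑ w₂, auxMass p A B w₁ w₂ * ∑ y, negMulLog (G w₁ w₂ y) := by
  set S := ∑ x₁, ∑ x₂, negMulLog (source p x₁ x₂) with hS
  have h1 : ∑ t, negMulLog (∑ w, channelMass p A B G t w) = S + binEntropy q := by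
    simp only [h.sum_channelMass_right]
    simp only [Fintype.sum_prod_type, sum_negMulLog_mul _ (sum_target q _), sum_negMulLog_target,
      Finset.sum_add_distrib, ← Finset.sum_mul, sum_source_right]
    simp
    rfl
  have h2 : ∑ w, negMulLog (∑ t, channelMass p A B G t w)
      = ∑ w₁, ∑ w₂, negMulLog (auxMass p A B w₁ w₂) := by
    simp only [h.sum_channelMass_left, Fintype.sum_prod_type]
  have h3 : ∑ t, ∑ w, negMulLog (channelMass p A B G t w) = S
      + (∑ x, ∑ w, negMulLog (A x w)) / 2 + (∑ x, ∑ w, negMulLog (B x w)) / 2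
      + ∑ w₁, ∑ w₂, auxMass p A B w₁ w₂ * ∑ y, negMulLog (G w₁ w₂ y) := by
    have e1 : ∑ t, ∑ w, negMulLog (channelMass p A B G t w) = ∑ x₁, ∑ x₂, ∑ w₁, ∑ w₂,
        (negMulLog (source p x₁ x₂ * A x₁ w₁ * B x₂ w₂)
          + source p x₁ x₂ * A x₁ w₁ * B x₂ w₂ * ∑ y, negMulLog (G w₁ w₂ y)) := by
      rw [Fintype.sum_prod_type]
      refine Finset.sum_congr rfl fun x₁ _ => ?_
      rw [Fintype.sum_prod_type]
      refine Finset.sum_congr rfl fun x₂ _ => ?_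
      rw [Finset.sum_comm, Fintype.sum_prod_type]
      refine Finset.sum_congr rfl fun w₁ _ => ?_
      refine Finset.sum_congr rfl fun w₂ _ => ?_
      exact sum_negMulLog_mul _ (h.decoder w₁ w₂).2
    have e2 : ∀ x₁ x₂, ∑ w₁, ∑ w₂, negMulLog (source p x₁ x₂ * A x₁ w₁ * B x₂ w₂)
        = negMulLog (source p x₁ x₂) + source p x₁ x₂ * ∑ w, negMulLog (A x₁ w)
          + source p x₁ x₂ * ∑ w, negMulLog (B x₂ w) := by
      intro x₁ x₂
      simp only [sum_negMulLog_mul _ (h.encoder₂ x₂).2, Finset.sum_add_distrib, ← Finset.sum_mul,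
        ← Finset.mul_sum, (h.encoder₁ x₁).2, sum_negMulLog_mul _ (h.encoder₁ x₁).2, mul_one]
    have e3 : ∑ x₁, ∑ x₂, source p x₁ x₂ * ∑ w, negMulLog (A x₁ w)
        = (∑ x, ∑ w, negMulLog (A x w)) / 2 := by
      simp only [← Finset.sum_mul, sum_source_right]
      rw [← Finset.mul_sum]; ring
    have e4 : ∑ x₁, ∑ x₂, source p x₁ x₂ * ∑ w, negMulLog (B x₂ w)
        = (∑ x, ∑ w, negMulLog (B x w)) / 2 := by
      rw [Finset.sum_comm]
      simp only [← Finset.sum_mul, sum_source_left]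
      rw [← Finset.mul_sum]; ring
    have e5 : ∑ x₁, ∑ x₂, ∑ w₁, ∑ w₂,
          source p x₁ x₂ * A x₁ w₁ * B x₂ w₂ * ∑ y, negMulLog (G w₁ w₂ y)
        = ∑ w₁, ∑ w₂, auxMass p A B w₁ w₂ * ∑ y, negMulLog (G w₁ w₂ y) := by
      simp only [auxMass, Finset.sum_mul _ _ (∑ y, negMulLog (G _ _ y))]
      rw [Finset.sum_congr rfl fun x₁ _ => Finset.sum_comm]
      rw [Finset.sum_comm]
      refine Finset.sum_congr rfl fun w₁ _ => ?_
      rw [Finset.sum_congr rfl fun x₁ _ => Finset.sum_comm]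
      rw [Finset.sum_comm]
    rw [e1]
    simp only [Finset.sum_add_distrib, e2, e3, e4, e5]
    rfl
  unfold massMI
  rw [h1, h2, h3, h.sum_channelMass, negMulLog_one]
  ring

/-- The two outputs of an encoder can be labelled so that the first one is likelier under `0`. -/
theorem exists_labels {W : Type} [Fintype W] {K : ZMod 2 → W → ℝ} (hK : ∀ x, IsPMF (K x))
    (hcard : Fintype.card W ≤ 2) (hne : K 0 ≠ K 1) :
    ∃ a b : W, (∀ f : W → ℝ, ∑ w, f w = f a + f b) ∧ K 1 a < K 0 a := by
  classical
  have hs : ∑ w, K 0 w = ∑ w, K 1 w := (hK 0).2.trans (hK 1).2.symm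
  obtain ⟨a, ha⟩ : ∃ a, K 1 a < K 0 a := by
    by_contra! hcon
    exact hne (funext fun w =>
      (Finset.sum_eq_sum_iff_of_le fun w _ => hcon w).1 hs w (Finset.mem_univ w))
  obtain ⟨b, hb⟩ : ∃ b, K 0 b < K 1 b := by
    by_contra! hcon
    exact hne (funext fun w =>
      ((Finset.sum_eq_sum_iff_of_le fun w _ => hcon w).1 hs.symm w (Finset.mem_univ w)).symm)
  have hab : a ≠ b := by rintro rfl; exact lt_asymm ha hb
  have huniv : (Finset.univ : Finset W) = {a, b} := by
    symm
    apply Finset.eq_univ_of_card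
    rw [Finset.card_pair hab]
    have := Finset.card_le_univ ({a, b} : Finset W)
    rw [Finset.card_pair hab] at this
    omega
  exact ⟨a, b, fun f => by rw [huniv, Finset.sum_pair hab], ha⟩

theorem IsTestChannel.encoder₁_ne (h : IsTestChannel p q A B G) (hq : q ≠ 1 / 2) : A 0 ≠ A 1 := by
  intro hA
  have h1 := h.output 0 0 0
  have h2 := h.output 1 0 0
  rw [hA, h2] at h1
  simp [target] at h1
  exact hq (by linarith)

theorem IsTestChannel.encoder₂_ne (h : IsTestChannel p q A B G) (hq : q ≠ 1 / 2) : B 0 ≠ B 1 := by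
  intro hB
  have h1 := h.output 0 0 0
  have h2 := h.output 0 1 0
  rw [hB, h2] at h1
  simp [target] at h1
  exact hq (by linarith)

theorem sum_negMulLog_eq_binEntropy {k : ZMod 2 → ℝ} (hk : ∑ y, k y = 1) :
    ∑ y, negMulLog (k y) = binEntropy (k 0) := by
  rw [sum_zmod_two] at hk ⊢
  rw [binEntropy_eq_negMulLog_add_negMulLog_one_sub, ← hk, add_sub_cancel_left]

/-- Every test channel with binary auxiliary variables for `p = q = 1 / 10` carries at least the
information of the symmetric one with crossover probability `0.020565`, up to `3 * 10 ^ (-5)`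
nats. -/
theorem IsTestChannel.le_massMI (h : IsTestChannel (1 / 10) (1 / 10) A B G)
    (hc₁ : Fintype.card W₁ ≤ 2) (hc₂ : Fintype.card W₂ ≤ 2) :
    binEntropy (1 / 10) - optimalValue - 0.00003 ≤ massMI (channelMass (1 / 10) A B G) := by
  obtain ⟨a, b, hab, ha⟩ := exists_labels h.encoder₁ hc₁ (h.encoder₁_ne (by norm_num))
  obtain ⟨a', b', hab', ha'⟩ := exists_labels h.encoder₂ hc₂ (h.encoder₂_ne (by norm_num))
  have sA0 := (h.encoder₁ 0).2
  have sA1 := (h.encoder₁ 1).2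
  have sB0 := (h.encoder₂ 0).2
  have sB1 := (h.encoder₂ 1).2
  rw [hab] at sA0 sA1
  rw [hab'] at sB0 sB1
  -- the crossover probabilities of the two encoders
  obtain ⟨e₁, he₁⟩ : ∃ e, e = A 0 b := ⟨_, rfl⟩
  obtain ⟨e₂, he₂⟩ : ∃ e, e = A 1 a := ⟨_, rfl⟩
  obtain ⟨f₁, hf₁⟩ : ∃ e, e = B 0 b' := ⟨_, rfl⟩
  obtain ⟨f₂, hf₂⟩ : ∃ e, e = B 1 a' := ⟨_, rfl⟩
  have A0a : A 0 a = 1 - e₁ := by rw [he₁]; linarith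
  have A1b : A 1 b = 1 - e₂ := by rw [he₂]; linarith
  have B0a : B 0 a' = 1 - f₁ := by rw [hf₁]; linarith
  have B1b : B 1 b' = 1 - f₂ := by rw [hf₂]; linarith
  have ne₁ : 0 ≤ e₁ := he₁ ▸ (h.encoder₁ 0).1 b
  have ne₂ : 0 ≤ e₂ := he₂ ▸ (h.encoder₁ 1).1 a
  have nf₁ : 0 ≤ f₁ := hf₁ ▸ (h.encoder₂ 0).1 b'
  have nf₂ : 0 ≤ f₂ := hf₂ ▸ (h.encoder₂ 1).1 a'
  rw [A0a, ← he₂] at ha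
  rw [B0a, ← hf₂] at ha'
  obtain ⟨D, hD⟩ : ∃ D, D = 1 - e₁ - e₂ := ⟨_, rfl⟩
  obtain ⟨E, hE⟩ : ∃ E, E = 1 - f₁ - f₂ := ⟨_, rfl⟩
  obtain ⟨d, hd⟩ : ∃ d, d = e₁ - e₂ := ⟨_, rfl⟩
  obtain ⟨g, hg⟩ : ∃ g, g = f₁ - f₂ := ⟨_, rfl⟩
  obtain ⟨m, hm⟩ : ∃ m, m = D * E := ⟨_, rfl⟩
  obtain ⟨ρ, hρ⟩ : ∃ ρ, ρ = 0.8 * m + d * g := ⟨_, rfl⟩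
  have hD0 : 0 < D := by linarith
  have hE0 : 0 < E := by linarith
  have hm0 : 0 < m := hm ▸ mul_pos hD0 hE0
  -- the decoder is determined by the encoders
  have o00 := h.output 0 0 0
  have o01 := h.output 0 1 0
  have o10 := h.output 1 0 0
  have o11 := h.output 1 1 0
  simp only [hab, hab', A0a, A1b, B0a, B1b, ← he₁, ← he₂, ← hf₁, ← hf₂, target] at o00 o01 o10 o11
  rw [if_pos (by decide)] at o00 o11
  rw [if_neg (by decide)] at o01 o10
  have G1 : G a a' 0 = (1 + 0.8 * ((1 + d) * (1 + g) / m)) / 2 := by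
    field_simp
    rw [hm, hD, hE, hd, hg]
    linear_combination 2 * ((1 - e₂) * (1 - f₂) * o00 - (1 - e₂) * f₁ * o01 - e₁ * (1 - f₂) * o10
      + e₁ * f₁ * o11)
  have G2 : G a b' 0 = (1 - 0.8 * ((1 + d) * (1 - g) / m)) / 2 := by
    field_simp
    rw [hm, hD, hE, hd, hg]
    linear_combination 2 * (-(1 - e₂) * f₂ * o00 + (1 - e₂) * (1 - f₁) * o01 + e₁ * f₂ * o10
      - e₁ * (1 - f₁) * o11)
  have G3 : G b a' 0 = (1 - 0.8 * ((1 - d) * (1 + g) / m)) / 2 := by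
    field_simp
    rw [hm, hD, hE, hd, hg]
    linear_combination 2 * (-e₂ * (1 - f₂) * o00 + e₂ * f₁ * o01 + (1 - e₁) * (1 - f₂) * o10
      - (1 - e₁) * f₁ * o11)
  have G4 : G b b' 0 = (1 + 0.8 * ((1 - d) * (1 - g) / m)) / 2 := by
    field_simp
    rw [hm, hD, hE, hd, hg]
    linear_combination 2 * (e₂ * f₂ * o00 - e₂ * (1 - f₁) * o01 - (1 - e₁) * f₂ * o10
      + (1 - e₁) * (1 - f₁) * o11)
  have Gle : ∀ w₁ w₂, 0 ≤ G w₁ w₂ 0 ∧ G w₁ w₂ 0 ≤ 1 := by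
    intro w₁ w₂
    have h1 := (h.decoder w₁ w₂).2
    rw [sum_zmod_two] at h1
    have h2 := (h.decoder w₁ w₂).1 1
    exact ⟨(h.decoder w₁ w₂).1 0, by linarith⟩
  have hfeas : (1 + |d|) * (1 + |g|) ≤ 1.25 * m := by
    have i1 := (Gle a a').2
    have i2 := (Gle a b').1
    have i3 := (Gle b a').1
    have i4 := (Gle b b').2
    rw [G1] at i1
    rw [G2] at i2
    rw [G3] at i3
    rw [G4] at i4
    have j1 : (1 + d) * (1 + g) / m ≤ 1.25 := by linarith
    have j2 : (1 + d) * (1 - g) / m ≤ 1.25 := by linarith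
    have j3 : (1 - d) * (1 + g) / m ≤ 1.25 := by linarith
    have j4 : (1 - d) * (1 - g) / m ≤ 1.25 := by linarith
    rw [div_le_iff₀ hm0] at j1 j2 j3 j4
    rcases abs_cases d with ⟨h1, _⟩ | ⟨h1, _⟩ <;> rcases abs_cases g with ⟨h2, _⟩ | ⟨h2, _⟩ <;>
      rw [h1, h2] <;> linarith
  have key := test_channel_bound ne₁ ne₂ nf₁ nf₂ hD hE hd hg hm hρ hD0 hE0 hfeas
  have c1 : auxMass (1 / 10) A B a a' = (1 - d - g + ρ) / 4 := by
    simp only [auxMass, sum_zmod_two, A0a, B0a, ← he₂, ← hf₂, source]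
    rw [hρ, hm, hD, hE, hd, hg]; norm_num; ring
  have c2 : auxMass (1 / 10) A B a b' = (1 - d + g - ρ) / 4 := by
    simp only [auxMass, sum_zmod_two, A0a, B1b, ← he₂, ← hf₁, source]
    rw [hρ, hm, hD, hE, hd, hg]; norm_num; ring
  have c3 : auxMass (1 / 10) A B b a' = (1 + d - g - ρ) / 4 := by
    simp only [auxMass, sum_zmod_two, A1b, B0a, ← he₁, ← hf₂, source]
    rw [hρ, hm, hD, hE, hd, hg]; norm_num; ring
  have c4 : auxMass (1 / 10) A B b b' = (1 + d + g + ρ) / 4 := by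
    simp only [auxMass, sum_zmod_two, A1b, B1b, ← he₁, ← hf₁, source]
    rw [hρ, hm, hD, hE, hd, hg]; norm_num; ring
  have hflip : ∀ t : ℝ, binEntropy ((1 + t) / 2) = binEntropy ((1 - t) / 2) := by
    intro t
    rw [← binEntropy_one_sub]; congr 1; ring
  rw [h.massMI_eq]
  simp only [sum_negMulLog_eq_binEntropy (h.decoder _ _).2]
  simp only [hab, hab', c1, c2, c3, c4, G1, G2, G3, G4, sum_zmod_two, A0a, A1b, B0a, B1b,
    ← he₁, ← he₂, ← hf₁, ← hf₂, hflip]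
  simp only [binEntropy_eq_negMulLog_add_negMulLog_one_sub e₁,
    binEntropy_eq_negMulLog_add_negMulLog_one_sub e₂,
    binEntropy_eq_negMulLog_add_negMulLog_one_sub f₁,
    binEntropy_eq_negMulLog_add_negMulLog_one_sub f₂] at key
  linarith

end Information

/-! ### Independence and entropies of the sources -/

section IndepEntropy

variable {Ω α β γ : Type} [Fintype Ω] [Fintype α] [DecidableEq α] [Fintype β] [DecidableEq β]
  [DecidableEq γ]

theorem law_comp (P : Ω → ℝ) (B : Ω → β) (g : β → γ) (c : γ) :
    law P (fun ω => g (B ω)) c = ∑ b, law P B b * kron (g b) c := by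
  simp only [law_eq_sum_kron, Finset.sum_mul]
  rw [Finset.sum_comm]
  refine Finset.sum_congr rfl fun ω _ => ?_
  rw [Finset.sum_eq_single (B ω)]
  · simp [kron]
  · intro b _ hb
    simp [kron, Ne.symm hb]
  · simp

theorem Indep.comp_right {P : Ω → ℝ} {A : Ω → α} {B : Ω → β} (h : Indep P A B) (g : β → γ) :
    Indep P A (fun ω => g (B ω)) := by
  intro a c
  have h1 := law_comp P (fun ω => (A ω, B ω)) (fun ab => (ab.1, g ab.2)) (a, c)
  simp only [Fintype.sum_prod_type, kron_pair] at h1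
  rw [h1, law_comp P B g c, Finset.sum_eq_single a, Finset.mul_sum]
  · refine Finset.sum_congr rfl fun b _ => ?_
    rw [h a b]
    simp [kron]
  · intro a' _ ha'
    refine Finset.sum_eq_zero fun b _ => ?_
    simp [kron, ha']
  · simp

theorem Indep.entropy_eq {P : Ω → ℝ} (hP : ∑ ω, P ω = 1) {A : Ω → α} {B : Ω → β}
    (h : Indep P A B) : entropy P (fun ω => (B ω, A ω)) = entropy P B + entropy P A := by
  have hswap : entropy P (fun ω => (B ω, A ω)) = entropy P (fun ω => (A ω, B ω)) :=
    entropy_congr fun _ _ _ _ => by simp only [Prod.mk.injEq]; tauto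
  rw [hswap]
  unfold entropy
  rw [← add_div]
  congr 1
  rw [Fintype.sum_prod_type]
  simp_rw [h _ _, sum_negMulLog_mul _ ((sum_law P B).trans hP)]
  rw [Finset.sum_add_distrib, ← Finset.sum_mul, (sum_law P A).trans hP]
  ring

end IndepEntropy

section SourceEntropy

variable {Q W₁ W₂ : Type} [Fintype Q] [Fintype W₁] [Fintype W₂]
  [DecidableEq Q] [DecidableEq W₁] [DecidableEq W₂]
  {p q : ℝ} {P : Outcome Q W₁ W₂ (ZMod 2) (ZMod 2) (ZMod 2) → ℝ}

theorem log_two_ne_zero : log 2 ≠ 0 := (log_pos (by norm_num)).ne'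

/-- A function of the sources and the target has the entropy that its PMF dictates, and `Q` is
independent of it. -/
theorem IsAdmissible.entropy_comp_rvQ {γ : Type} [Fintype γ] [DecidableEq γ]
    (h : IsAdmissible (dsbs p q) P) (g : ZMod 2 × ZMod 2 × ZMod 2 → γ) :
    entropy P (fun ω => (g (rvXY ω), rvQ ω))
      = (∑ c, negMulLog (∑ t, dsbs p q t * kron (g t) c)) / log 2 + entropy P rvQ := by
  rw [Indep.entropy_eq h.isPMF.2 (h.timeSharing.comp_right g)]
  congr 1
  unfold entropy
  congr 1
  refine Finset.sum_congr rfl fun c _ => ?_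
  rw [law_comp P rvXY g c]
  simp only [h.marginal]

theorem negMulLog_half : negMulLog (1 / 2) = log 2 / 2 := by
  rw [negMulLog, show (1 / 2 : ℝ) = 2⁻¹ by norm_num, log_inv]; ring

theorem IsAdmissible.entropy_X₁Q (h : IsAdmissible (dsbs p q) P) :
    entropy P (fun ω => (rvX₁ ω, rvQ ω)) = 1 + entropy P rvQ := by
  have h1 := h.entropy_comp_rvQ (fun t => t.1)
  have h2 : ∀ c, ∑ t, dsbs p q t * kron t.1 c = 1 / 2 := by
    intro c
    rw [Fintype.sum_prod_type]
    simp only [Fintype.sum_prod_type, dsbs_eq, ← Finset.sum_mul, ← Finset.mul_sum, sum_target,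
      mul_one, sum_source_right]
    simp [kron]
  simp only [h2] at h1
  rw [h1, negMulLog_half]
  have := log_two_ne_zero
  simp
  field_simp

theorem IsAdmissible.entropy_X₂Q (h : IsAdmissible (dsbs p q) P) :
    entropy P (fun ω => (rvX₂ ω, rvQ ω)) = 1 + entropy P rvQ := by
  have h1 := h.entropy_comp_rvQ (fun t => t.2.1)
  have h2 : ∀ c, ∑ t, dsbs p q t * kron t.2.1 c = 1 / 2 := by
    intro c
    rw [Fintype.sum_prod_type]
    simp only [Fintype.sum_prod_type, dsbs_eq, ← Finset.sum_mul, ← Finset.mul_sum, sum_target,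
      mul_one]
    rw [Finset.sum_comm]
    simp only [← Finset.sum_mul, sum_source_left]
    simp [kron]
  simp only [h2] at h1
  rw [h1, negMulLog_half]
  have := log_two_ne_zero
  simp
  field_simp

theorem sum_negMulLog_source (p : ℝ) :
    ∑ x₁, ∑ x₂, negMulLog (source p x₁ x₂) = log 2 + binEntropy p := by
  simp only [sum_zmod_two, source, negMulLog_mul, negMulLog_half,
    binEntropy_eq_negMulLog_add_negMulLog_one_sub]
  simp
  ring

theorem IsAdmissible.entropy_X₁X₂Q (h : IsAdmissible (dsbs p q) P) :
    entropy P (fun ω => (rvX₁ ω, rvX₂ ω, rvQ ω)) = 1 + hb p + entropy P rvQ := by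
  have h1 := h.entropy_comp_rvQ (fun t => (t.1, t.2.1))
  have h0 : entropy P (fun ω => (rvX₁ ω, rvX₂ ω, rvQ ω))
      = entropy P (fun ω => ((fun t => (t.1, t.2.1)) (rvXY ω), rvQ ω)) :=
    entropy_congr fun _ _ _ _ => by simp only [Prod.mk.injEq, and_assoc]
  have h2 : ∀ c : ZMod 2 × ZMod 2, ∑ t : ZMod 2 × ZMod 2 × ZMod 2,
      dsbs p q t * kron (t.1, t.2.1) c = source p c.1 c.2 := by
    intro c
    rw [Fintype.sum_prod_type]
    simp only [Fintype.sum_prod_type, dsbs_eq, ← Finset.sum_mul, ← Finset.mul_sum, sum_target,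
      mul_one]
    rw [Finset.sum_eq_single c.1, Finset.sum_eq_single c.2]
    · simp [kron]
    · intro b _ hb; simp [kron, Prod.ext_iff, hb]
    · simp
    · intro b _ hb
      exact Finset.sum_eq_zero fun x _ => by simp [kron, Prod.ext_iff, hb]
    · simp
  simp only [h2] at h1
  rw [h0, h1, Fintype.sum_prod_type, sum_negMulLog_source, add_div, div_self log_two_ne_zero]
  rfl

theorem IsAdmissible.entropy_sumQ (h : IsAdmissible (dsbs p q) P) :
    entropy P (fun ω => (rvX₁ ω + rvX₂ ω, rvQ ω)) = hb p + entropy P rvQ := by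
  have h1 := h.entropy_comp_rvQ (fun t => t.1 + t.2.1)
  have h2 : ∀ c : ZMod 2, ∑ t : ZMod 2 × ZMod 2 × ZMod 2,
      dsbs p q t * kron (t.1 + t.2.1) c = target p 0 c := by
    intro c
    rw [Fintype.sum_prod_type]
    simp only [Fintype.sum_prod_type, dsbs_eq, ← Finset.sum_mul, ← Finset.mul_sum, sum_target,
      mul_one]
    simp only [sum_zmod_two, source, target, kron]
    rcases zmod_two_cases c with rfl | rfl <;> simp [show (1 : ZMod 2) + 1 = 0 from rfl] <;> ring
  simp only [h2] at h1
  rw [h1, sum_negMulLog_target]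
  rfl

end SourceEntropy

/-! ### Information inequalities for admissible PMFs -/

section Inequalities

variable {Q W₁ W₂ X₁ X₂ Y : Type}
variable [Fintype Q] [Fintype W₁] [Fintype W₂] [Fintype X₁] [Fintype X₂] [Fintype Y]
variable [DecidableEq Q] [DecidableEq W₁] [DecidableEq W₂] [DecidableEq X₁] [DecidableEq X₂]
  [DecidableEq Y] {p : X₁ × X₂ × Y → ℝ} {P : Outcome Q W₁ W₂ X₁ X₂ Y → ℝ}

theorem IsAdmissible.condMI_W_le₁ (h : IsAdmissible p P) :
    condMI P rvW₁ rvW₂ rvQ ≤ condMI P rvX₁ rvW₁ rvQ := by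
  have hP := h.isPMF.1
  have a := h.encoders.1.condMI_eq_zero hP
  have b := condMI_nonneg hP rvW₁ rvX₂ (fun ω => (rvW₂ ω, rvQ ω, rvX₁ ω))
  have c := condMI_nonneg hP rvW₁ rvX₁ (fun ω => (rvW₂ ω, rvQ ω))
  unfold condMI at a b c ⊢
  have e1 : entropy P (fun ω => (rvW₁ ω, rvQ ω, rvX₁ ω))
      = entropy P (fun ω => (rvX₁ ω, rvW₁ ω, rvQ ω)) :=
    entropy_congr fun _ _ _ _ => by simp only [Prod.mk.injEq]; tauto
  have e2 : entropy P (fun ω => (((rvQ ω, rvX₂ ω), rvW₂ ω), rvQ ω, rvX₁ ω))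
      = entropy P (fun ω => (rvX₂ ω, rvW₂ ω, rvQ ω, rvX₁ ω)) :=
    entropy_congr fun _ _ _ _ => by simp only [Prod.mk.injEq]; tauto
  have e3 : entropy P (fun ω => (rvW₁ ω, ((rvQ ω, rvX₂ ω), rvW₂ ω), rvQ ω, rvX₁ ω))
      = entropy P (fun ω => (rvW₁ ω, rvX₂ ω, rvW₂ ω, rvQ ω, rvX₁ ω)) :=
    entropy_congr fun _ _ _ _ => by simp only [Prod.mk.injEq]; tauto
  have e4 : entropy P (fun ω => (rvQ ω, rvX₁ ω)) = entropy P (fun ω => (rvX₁ ω, rvQ ω)) :=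
    entropy_congr fun _ _ _ _ => by simp only [Prod.mk.injEq]; tauto
  have e5 : entropy P (fun ω => (rvW₂ ω, rvQ ω, rvX₁ ω))
      = entropy P (fun ω => (rvX₁ ω, rvW₂ ω, rvQ ω)) :=
    entropy_congr fun _ _ _ _ => by simp only [Prod.mk.injEq]; tauto
  have e6 : entropy P (fun ω => (rvW₁ ω, rvW₂ ω, rvQ ω, rvX₁ ω))
      = entropy P (fun ω => (rvW₁ ω, rvX₁ ω, rvW₂ ω, rvQ ω)) :=
    entropy_congr fun _ _ _ _ => by simp only [Prod.mk.injEq]; tauto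
  linarith

theorem IsAdmissible.condMI_W_le₂ (h : IsAdmissible p P) :
    condMI P rvW₁ rvW₂ rvQ ≤ condMI P rvX₂ rvW₂ rvQ := by
  have hP := h.isPMF.1
  have a := h.encoders.2.condMI_eq_zero hP
  have b := condMI_nonneg hP rvW₂ rvX₁ (fun ω => (rvW₁ ω, rvQ ω, rvX₂ ω))
  have c := condMI_nonneg hP rvW₂ rvX₂ (fun ω => (rvW₁ ω, rvQ ω))
  unfold condMI at a b c ⊢
  have e1 : entropy P (fun ω => (rvW₂ ω, rvQ ω, rvX₂ ω))
      = entropy P (fun ω => (rvX₂ ω, rvW₂ ω, rvQ ω)) :=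
    entropy_congr fun _ _ _ _ => by simp only [Prod.mk.injEq]; tauto
  have e2 : entropy P (fun ω => ((rvW₁ ω, rvQ ω, rvX₁ ω), rvQ ω, rvX₂ ω))
      = entropy P (fun ω => (rvX₁ ω, rvW₁ ω, rvQ ω, rvX₂ ω)) :=
    entropy_congr fun _ _ _ _ => by simp only [Prod.mk.injEq]; tauto
  have e3 : entropy P (fun ω => ((rvW₁ ω, rvQ ω, rvX₁ ω), rvW₂ ω, rvQ ω, rvX₂ ω))
      = entropy P (fun ω => (rvW₂ ω, rvX₁ ω, rvW₁ ω, rvQ ω, rvX₂ ω)) :=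
    entropy_congr fun _ _ _ _ => by simp only [Prod.mk.injEq]; tauto
  have e4 : entropy P (fun ω => (rvQ ω, rvX₂ ω)) = entropy P (fun ω => (rvX₂ ω, rvQ ω)) :=
    entropy_congr fun _ _ _ _ => by simp only [Prod.mk.injEq]; tauto
  have e5 : entropy P (fun ω => (rvW₁ ω, rvQ ω, rvX₂ ω))
      = entropy P (fun ω => (rvX₂ ω, rvW₁ ω, rvQ ω)) :=
    entropy_congr fun _ _ _ _ => by simp only [Prod.mk.injEq]; tauto
  have e6 : entropy P (fun ω => (rvW₂ ω, rvW₁ ω, rvQ ω, rvX₂ ω))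
      = entropy P (fun ω => (rvW₂ ω, rvX₂ ω, rvW₁ ω, rvQ ω)) :=
    entropy_congr fun _ _ _ _ => by simp only [Prod.mk.injEq]; tauto
  have e7 : entropy P (fun ω => (rvW₂ ω, rvW₁ ω, rvQ ω))
      = entropy P (fun ω => (rvW₁ ω, rvW₂ ω, rvQ ω)) :=
    entropy_congr fun _ _ _ _ => by simp only [Prod.mk.injEq]; tauto
  linarith

/-- The sum constraint of the unstructured bound is attained: some triple of rates allowed by `P`
has sum `I(X₁, X₂, Y ; W₁, W₂ | Q)`. -/
theorem exists_mem_unstructuredRates (hP : ∀ ω, 0 ≤ P ω) :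
    ∃ t ∈ unstructuredRates P, t.1 + t.2.1 + t.2.2 = condMI P rvXY rvW rvQ := by
  have a := condMI_nonneg hP rvW₁ (fun ω => (rvX₂ ω, rvY ω, rvW₂ ω)) (fun ω => (rvX₁ ω, rvQ ω))
  have b := condMI_nonneg hP rvW₂ (fun ω => (rvX₁ ω, rvY ω)) (fun ω => (rvX₂ ω, rvQ ω))
  have c := condMI_nonneg hP rvW₂ (fun ω => (rvX₁ ω, rvY ω, rvW₁ ω)) (fun ω => (rvX₂ ω, rvQ ω))
  have d := condMI_nonneg hP rvW₁ rvW₂ rvQ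
  have e1 : entropy P (fun ω => (rvW₁ ω, rvX₁ ω, rvQ ω))
      = entropy P (fun ω => (rvX₁ ω, rvW₁ ω, rvQ ω)) :=
    entropy_congr fun _ _ _ _ => by simp only [Prod.mk.injEq]; tauto
  have e2 : entropy P (fun ω => (rvW₂ ω, rvX₂ ω, rvQ ω))
      = entropy P (fun ω => (rvX₂ ω, rvW₂ ω, rvQ ω)) :=
    entropy_congr fun _ _ _ _ => by simp only [Prod.mk.injEq]; tauto
  have e3 : entropy P (fun ω => ((rvX₂ ω, rvY ω, rvW₂ ω), rvX₁ ω, rvQ ω))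
      = entropy P (fun ω => (rvXY ω, rvW₂ ω, rvQ ω)) :=
    entropy_congr fun _ _ _ _ => by simp only [Prod.mk.injEq]; tauto
  have e4 : entropy P (fun ω => ((rvX₁ ω, rvY ω, rvW₁ ω), rvX₂ ω, rvQ ω))
      = entropy P (fun ω => (rvXY ω, rvW₁ ω, rvQ ω)) :=
    entropy_congr fun _ _ _ _ => by simp only [Prod.mk.injEq]; tauto
  have e5 : entropy P (fun ω => ((rvX₁ ω, rvY ω), rvX₂ ω, rvQ ω))
      = entropy P (fun ω => (rvXY ω, rvQ ω)) :=
    entropy_congr fun _ _ _ _ => by simp only [Prod.mk.injEq]; tauto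
  have e6 : entropy P (fun ω => (rvW₁ ω, (rvX₂ ω, rvY ω, rvW₂ ω), rvX₁ ω, rvQ ω))
      = entropy P (fun ω => (rvXY ω, rvW ω, rvQ ω)) :=
    entropy_congr fun _ _ _ _ => by simp only [Prod.mk.injEq]; tauto
  have e7 : entropy P (fun ω => (rvW₂ ω, (rvX₁ ω, rvY ω, rvW₁ ω), rvX₂ ω, rvQ ω))
      = entropy P (fun ω => (rvXY ω, rvW ω, rvQ ω)) :=
    entropy_congr fun _ _ _ _ => by simp only [Prod.mk.injEq]; tauto
  have e8 : entropy P (fun ω => (rvW₂ ω, (rvX₁ ω, rvY ω), rvX₂ ω, rvQ ω))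
      = entropy P (fun ω => (rvXY ω, rvW₂ ω, rvQ ω)) :=
    entropy_congr fun _ _ _ _ => by simp only [Prod.mk.injEq]; tauto
  have e9 : entropy P (fun ω => (rvW₁ ω, rvW₂ ω, rvQ ω))
      = entropy P (fun ω => (rvW ω, rvQ ω)) :=
    entropy_congr fun _ _ _ _ => by simp only [Prod.mk.injEq]; tauto
  -- the corner point at which the constraints on `R₂` and on the sums are tight
  refine ⟨(condMI P rvX₁ rvW₁ rvQ, condMI P rvX₂ rvW₂ rvQ - condMI P rvW₁ rvW₂ rvQ,
    condMI P rvXY rvW rvQ - condMI P rvX₁ rvW₁ rvQ - condMI P rvX₂ rvW₂ rvQ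
      + condMI P rvW₁ rvW₂ rvQ), ⟨?_, ?_, ?_, ?_, ?_, ?_, ?_⟩, ?_⟩
  all_goals
    dsimp only
    unfold condMI at *
    linarith

end Inequalities

/-! ### Auxiliary variables that determine the sources -/

section Recovery

/-- For each value of `Q`, the auxiliary variables are injective images of the sources. -/
def Recovers {Q W₁ W₂ X₁ X₂ Y : Type} (P : Outcome Q W₁ W₂ X₁ X₂ Y → ℝ) : Prop :=
  ∀ ω ω', P ω ≠ 0 → P ω' ≠ 0 → rvQ ω = rvQ ω' →
    (rvX₁ ω = rvX₁ ω' ↔ rvW₁ ω = rvW₁ ω') ∧ (rvX₂ ω = rvX₂ ω' ↔ rvW₂ ω = rvW₂ ω')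

variable {Q W₁ W₂ : Type} [Fintype Q] [Fintype W₁] [Fintype W₂]
  [DecidableEq Q] [DecidableEq W₁] [DecidableEq W₂]
  {p q : ℝ} {P : Outcome Q W₁ W₂ (ZMod 2) (ZMod 2) (ZMod 2) → ℝ}

theorem Recovers.unstructuredRates_eq (hr : Recovers P) (h : IsAdmissible (dsbs p q) P) :
    unstructuredRates P = {t : ℝ × ℝ × ℝ | hb p ≤ t.1 ∧ hb p ≤ t.2.1 ∧
      1 + hb p ≤ t.1 + t.2.1 ∧ 0 ≤ t.2.2} := by
  have x₁ := h.entropy_X₁Q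
  have x₂ := h.entropy_X₂Q
  have x₁₂ := h.entropy_X₁X₂Q
  have e1 : entropy P (fun ω => (rvW₁ ω, rvQ ω)) = entropy P (fun ω => (rvX₁ ω, rvQ ω)) :=
    entropy_congr fun ω ω' h0 h1 => by
      have := hr ω ω' h0 h1; simp only [Prod.mk.injEq]; tauto
  have e2 : entropy P (fun ω => (rvW₂ ω, rvQ ω)) = entropy P (fun ω => (rvX₂ ω, rvQ ω)) :=
    entropy_congr fun ω ω' h0 h1 => by
      have := hr ω ω' h0 h1; simp only [Prod.mk.injEq]; tauto
  have e3 : entropy P (fun ω => (rvX₁ ω, rvW₁ ω, rvQ ω)) = entropy P (fun ω => (rvX₁ ω, rvQ ω)) :=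
    entropy_congr fun ω ω' h0 h1 => by
      have := hr ω ω' h0 h1; simp only [Prod.mk.injEq]; tauto
  have e4 : entropy P (fun ω => (rvX₂ ω, rvW₂ ω, rvQ ω)) = entropy P (fun ω => (rvX₂ ω, rvQ ω)) :=
    entropy_congr fun ω ω' h0 h1 => by
      have := hr ω ω' h0 h1; simp only [Prod.mk.injEq]; tauto
  have e5 : entropy P (fun ω => (rvW₁ ω, rvW₂ ω, rvQ ω))
      = entropy P (fun ω => (rvX₁ ω, rvX₂ ω, rvQ ω)) :=
    entropy_congr fun ω ω' h0 h1 => by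
      have := hr ω ω' h0 h1; simp only [Prod.mk.injEq]; tauto
  have e6 : entropy P (fun ω => (rvXY ω, rvW₁ ω, rvQ ω)) = entropy P (fun ω => (rvXY ω, rvQ ω)) :=
    entropy_congr fun ω ω' h0 h1 => by
      have := hr ω ω' h0 h1; simp only [Prod.mk.injEq]; tauto
  have e7 : entropy P (fun ω => (rvXY ω, rvW₂ ω, rvQ ω)) = entropy P (fun ω => (rvXY ω, rvQ ω)) :=
    entropy_congr fun ω ω' h0 h1 => by
      have := hr ω ω' h0 h1; simp only [Prod.mk.injEq]; tauto
  have e8 : entropy P (fun ω => (rvXY ω, rvW ω, rvQ ω)) = entropy P (fun ω => (rvXY ω, rvQ ω)) :=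
    entropy_congr fun ω ω' h0 h1 => by
      have := hr ω ω' h0 h1; simp only [Prod.mk.injEq]; tauto
  have e9 : entropy P (fun ω => (rvW ω, rvQ ω)) = entropy P (fun ω => (rvX₁ ω, rvX₂ ω, rvQ ω)) :=
    entropy_congr fun ω ω' h0 h1 => by
      have := hr ω ω' h0 h1; simp only [Prod.mk.injEq]; tauto
  ext ⟨R₁, R₂, C⟩
  simp only [unstructuredRates, Set.mem_ofPred_eq, condMI, e1, e2, e3, e4, e5, e6, e7, e8, e9, x₁,
    x₂, x₁₂]
  constructor
  · rintro ⟨h1, h2, h3, h4, h5, h6, h7⟩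
    refine ⟨?_, ?_, ?_, ?_⟩ <;> linarith
  · rintro ⟨h1, h2, h3, h4⟩
    refine ⟨?_, ?_, ?_, ?_, ?_, ?_, ?_⟩ <;> linarith

variable {F : Type} [Fintype F] [DecidableEq F] [Add F]
  {P : Outcome Q F F (ZMod 2) (ZMod 2) (ZMod 2) → ℝ}

theorem Recovers.mem_structuredRates_iff (hr : Recovers P) (h : IsAdmissible (dsbs p q) P)
    (t : ℝ × ℝ × ℝ) :
    t ∈ structuredRates P ↔ hb p + condMI P rvZ rvW₂ rvQ ≤ t.1 ∧
      hb p + condMI P rvZ rvW₁ rvQ ≤ t.2.1 ∧ hb p + condMI P rvZ rvW₂ rvQ ≤ t.1 + t.2.2 ∧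
      hb p + condMI P rvZ rvW₁ rvQ ≤ t.2.1 + t.2.2 ∧
      2 * hb p + condMI P rvZ rvW₁ rvQ + condMI P rvZ rvW₂ rvQ ≤ t.1 + t.2.1 + t.2.2 ∧
      0 ≤ t.2.2 := by
  have x₁ := h.entropy_X₁Q
  have x₂ := h.entropy_X₂Q
  have x₁₂ := h.entropy_X₁X₂Q
  have i1 : condMI P rvX₁ rvW₁ (fun ω => (rvW₂ ω, rvQ ω)) = hb p := by
    have e1 : entropy P (fun ω => (rvX₁ ω, rvW₂ ω, rvQ ω))
        = entropy P (fun ω => (rvX₁ ω, rvX₂ ω, rvQ ω)) :=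
      entropy_congr fun ω ω' h0 h1 => by
        have := hr ω ω' h0 h1; simp only [Prod.mk.injEq]; tauto
    have e2 : entropy P (fun ω => (rvW₁ ω, rvW₂ ω, rvQ ω))
        = entropy P (fun ω => (rvX₁ ω, rvW₁ ω, rvW₂ ω, rvQ ω)) :=
      entropy_congr fun ω ω' h0 h1 => by
        have := hr ω ω' h0 h1; simp only [Prod.mk.injEq]; tauto
    have e3 : entropy P (fun ω => (rvW₂ ω, rvQ ω)) = entropy P (fun ω => (rvX₂ ω, rvQ ω)) :=
      entropy_congr fun ω ω' h0 h1 => by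
        have := hr ω ω' h0 h1; simp only [Prod.mk.injEq]; tauto
    unfold condMI
    linarith
  have i2 : condMI P rvX₂ rvW₂ (fun ω => (rvW₁ ω, rvQ ω)) = hb p := by
    have e1 : entropy P (fun ω => (rvX₂ ω, rvW₁ ω, rvQ ω))
        = entropy P (fun ω => (rvX₁ ω, rvX₂ ω, rvQ ω)) :=
      entropy_congr fun ω ω' h0 h1 => by
        have := hr ω ω' h0 h1; simp only [Prod.mk.injEq]; tauto
    have e2 : entropy P (fun ω => (rvW₂ ω, rvW₁ ω, rvQ ω))
        = entropy P (fun ω => (rvX₂ ω, rvW₂ ω, rvW₁ ω, rvQ ω)) :=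
      entropy_congr fun ω ω' h0 h1 => by
        have := hr ω ω' h0 h1; simp only [Prod.mk.injEq]; tauto
    have e3 : entropy P (fun ω => (rvW₁ ω, rvQ ω)) = entropy P (fun ω => (rvX₁ ω, rvQ ω)) :=
      entropy_congr fun ω ω' h0 h1 => by
        have := hr ω ω' h0 h1; simp only [Prod.mk.injEq]; tauto
    unfold condMI
    linarith
  have i3 : condMI P rvX rvW₁ (fun ω => (rvW₂ ω, rvQ ω)) = hb p := by
    have e1 : entropy P (fun ω => (rvX ω, rvW₂ ω, rvQ ω))
        = entropy P (fun ω => (rvX₁ ω, rvX₂ ω, rvQ ω)) :=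
      entropy_congr fun ω ω' h0 h1 => by
        have := hr ω ω' h0 h1; simp only [Prod.mk.injEq]; tauto
    have e2 : entropy P (fun ω => (rvW₁ ω, rvW₂ ω, rvQ ω))
        = entropy P (fun ω => (rvX ω, rvW₁ ω, rvW₂ ω, rvQ ω)) :=
      entropy_congr fun ω ω' h0 h1 => by
        have := hr ω ω' h0 h1; simp only [Prod.mk.injEq]; tauto
    have e3 : entropy P (fun ω => (rvW₂ ω, rvQ ω)) = entropy P (fun ω => (rvX₂ ω, rvQ ω)) :=
      entropy_congr fun ω ω' h0 h1 => by
        have := hr ω ω' h0 h1; simp only [Prod.mk.injEq]; tauto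
    unfold condMI
    linarith
  have i4 : condMI P rvX rvW₂ (fun ω => (rvW₁ ω, rvQ ω)) = hb p := by
    have e1 : entropy P (fun ω => (rvX ω, rvW₁ ω, rvQ ω))
        = entropy P (fun ω => (rvX₁ ω, rvX₂ ω, rvQ ω)) :=
      entropy_congr fun ω ω' h0 h1 => by
        have := hr ω ω' h0 h1; simp only [Prod.mk.injEq]; tauto
    have e2 : entropy P (fun ω => (rvW₂ ω, rvW₁ ω, rvQ ω))
        = entropy P (fun ω => (rvX ω, rvW₂ ω, rvW₁ ω, rvQ ω)) :=
      entropy_congr fun ω ω' h0 h1 => by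
        have := hr ω ω' h0 h1; simp only [Prod.mk.injEq]; tauto
    have e3 : entropy P (fun ω => (rvW₁ ω, rvQ ω)) = entropy P (fun ω => (rvX₁ ω, rvQ ω)) :=
      entropy_congr fun ω ω' h0 h1 => by
        have := hr ω ω' h0 h1; simp only [Prod.mk.injEq]; tauto
    unfold condMI
    linarith
  have i5 : condMI P rvY rvW₁ (fun ω => (rvX ω, rvQ ω)) = 0 := by
    have e1 : entropy P (fun ω => (rvW₁ ω, rvX ω, rvQ ω)) = entropy P (fun ω => (rvX ω, rvQ ω)) :=
      entropy_congr fun ω ω' h0 h1 => by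
        have := hr ω ω' h0 h1; simp only [Prod.mk.injEq]; tauto
    have e2 : entropy P (fun ω => (rvY ω, rvW₁ ω, rvX ω, rvQ ω))
        = entropy P (fun ω => (rvY ω, rvX ω, rvQ ω)) :=
      entropy_congr fun ω ω' h0 h1 => by
        have := hr ω ω' h0 h1; simp only [Prod.mk.injEq]; tauto
    unfold condMI
    linarith
  have i6 : condMI P rvY rvW₂ (fun ω => (rvX ω, rvQ ω)) = 0 := by
    have e1 : entropy P (fun ω => (rvW₂ ω, rvX ω, rvQ ω)) = entropy P (fun ω => (rvX ω, rvQ ω)) :=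
      entropy_congr fun ω ω' h0 h1 => by
        have := hr ω ω' h0 h1; simp only [Prod.mk.injEq]; tauto
    have e2 : entropy P (fun ω => (rvY ω, rvW₂ ω, rvX ω, rvQ ω))
        = entropy P (fun ω => (rvY ω, rvX ω, rvQ ω)) :=
      entropy_congr fun ω ω' h0 h1 => by
        have := hr ω ω' h0 h1; simp only [Prod.mk.injEq]; tauto
    unfold condMI
    linarith
  simp only [structuredRates, Set.mem_ofPred_eq, i1, i2, i3, i4, i5, i6]
  rw [two_mul, add_zero]

/-- If the auxiliary variables equal the sources, their sum is independent of either of them. -/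
theorem IsAdmissible.condMI_sum_eq_zero
    {P : Outcome Q (ZMod 2) (ZMod 2) (ZMod 2) (ZMod 2) (ZMod 2) → ℝ}
    (h : IsAdmissible (dsbs p q) P)
    (hW : ∀ ω, P ω ≠ 0 → rvW₁ ω = rvX₁ ω ∧ rvW₂ ω = rvX₂ ω) :
    condMI P rvZ rvW₁ rvQ = 0 ∧ condMI P rvZ rvW₂ rvQ = 0 := by
  have x₁ := h.entropy_X₁Q
  have x₂ := h.entropy_X₂Q
  have x₁₂ := h.entropy_X₁X₂Q
  have z := h.entropy_sumQ
  have ez : entropy P (fun ω => (rvZ ω, rvQ ω))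
      = entropy P (fun ω => (rvX₁ ω + rvX₂ ω, rvQ ω)) :=
    entropy_congr fun ω ω' h0 h1 => by
      rw [rvZ, rvZ, (hW ω h0).1, (hW ω h0).2, (hW ω' h1).1, (hW ω' h1).2]
  have ew₁ : entropy P (fun ω => (rvW₁ ω, rvQ ω)) = entropy P (fun ω => (rvX₁ ω, rvQ ω)) :=
    entropy_congr fun ω ω' h0 h1 => by rw [(hW ω h0).1, (hW ω' h1).1]
  have ew₂ : entropy P (fun ω => (rvW₂ ω, rvQ ω)) = entropy P (fun ω => (rvX₂ ω, rvQ ω)) :=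
    entropy_congr fun ω ω' h0 h1 => by rw [(hW ω h0).2, (hW ω' h1).2]
  have ezw₁ : entropy P (fun ω => (rvZ ω, rvW₁ ω, rvQ ω))
      = entropy P (fun ω => (rvX₁ ω, rvX₂ ω, rvQ ω)) :=
    entropy_congr fun ω ω' h0 h1 => by
      rw [rvZ, rvZ, (hW ω h0).1, (hW ω h0).2, (hW ω' h1).1, (hW ω' h1).2]
      simp only [Prod.mk.injEq]
      constructor
      · rintro ⟨e1, e2, e3⟩
        rw [e2] at e1
        exact ⟨e2, add_left_cancel e1, e3⟩
      · rintro ⟨e1, e2, e3⟩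
        exact ⟨by rw [e1, e2], e1, e3⟩
  have ezw₂ : entropy P (fun ω => (rvZ ω, rvW₂ ω, rvQ ω))
      = entropy P (fun ω => (rvX₁ ω, rvX₂ ω, rvQ ω)) :=
    entropy_congr fun ω ω' h0 h1 => by
      rw [rvZ, rvZ, (hW ω h0).1, (hW ω h0).2, (hW ω' h1).1, (hW ω' h1).2]
      simp only [Prod.mk.injEq]
      constructor
      · rintro ⟨e1, e2, e3⟩
        rw [e2] at e1
        exact ⟨add_right_cancel e1, e2, e3⟩
      · rintro ⟨e1, e2, e3⟩
        exact ⟨by rw [e1, e2], e2, e3⟩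
  unfold condMI
  constructor <;> linarith

end Recovery

/-! ### The inner bounds in the noiseless case -/

section Disjoint

variable {W₁ W₂ : Type} [Fintype W₁] [Fintype W₂] {p : ℝ}

/-- A binary encoder whose outputs under the two inputs have disjoint supports is a bijection. -/
theorem eq_iff_eq_of_disjoint {W : Type} [Fintype W] {K : ZMod 2 → W → ℝ} (hK : ∀ x, IsPMF (K x))
    (hcard : Fintype.card W ≤ 2) (hd : ∀ w, K 0 w * K 1 w = 0) {x x' : ZMod 2} {w w' : W}
    (hx : K x w ≠ 0) (hx' : K x' w' ≠ 0) : x = x' ↔ w = w' := by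
  have hne : K 0 ≠ K 1 := by
    intro he
    have hz : ∀ w, K 1 w = 0 := fun w => by simpa [he] using hd w
    have := (hK 1).2
    simp [hz] at this
  obtain ⟨a, b, hab, ha⟩ := exists_labels hK hcard hne
  have h0 := (hK 0).2
  have h1 := (hK 1).2
  rw [hab] at h0 h1
  have ha1 : K 1 a = 0 := by
    rcases mul_eq_zero.1 (hd a) with h | h
    · have := (hK 1).1 a; linarith
    · exact h
  have hb0 : K 0 b = 0 := by
    rcases mul_eq_zero.1 (hd b) with h | h
    · exact h
    · linarith
  have hcov : ∀ w, w = a ∨ w = b := by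
    intro w
    classical
    by_contra! hcon
    have := hab fun v => if v = w then 1 else 0
    simp [hcon.1.symm, hcon.2.symm] at this
  have hne' : a ≠ b := by rintro rfl; linarith
  rcases zmod_two_cases x with rfl | rfl <;> rcases zmod_two_cases x' with rfl | rfl <;>
    rcases hcov w with rfl | rfl <;> rcases hcov w' with rfl | rfl <;>
      simp_all [eq_comm]

/-- An output of the first encoder that occurs under both inputs would have to be decoded to two
different sums. -/
theorem IsTestChannel.disjoint₁ {A : ZMod 2 → W₁ → ℝ} {B : ZMod 2 → W₂ → ℝ}
    {G : W₁ → W₂ → ZMod 2 → ℝ} (h : IsTestChannel p 0 A B G) (w : W₁) : A 0 w * A 1 w = 0 := by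
  obtain ⟨v, hv⟩ : ∃ v, B 0 v ≠ 0 := by
    by_contra! hcon
    have := (h.encoder₂ 0).2
    simp [hcon] at this
  have hz : ∀ x y, y ≠ x → A x w * B 0 v * G w v y = 0 := by
    intro x y hxy
    have ho := h.output x 0 y
    rw [target, if_neg (by simpa using hxy)] at ho
    have hn : ∀ w₁ w₂, 0 ≤ A x w₁ * B 0 w₂ * G w₁ w₂ y := fun w₁ w₂ =>
      mul_nonneg (mul_nonneg ((h.encoder₁ x).1 _) ((h.encoder₂ 0).1 _)) ((h.decoder _ _).1 _)
    have h1 := (Finset.sum_eq_zero_iff_of_nonneg fun w₁ _ =>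
      Finset.sum_nonneg fun w₂ _ => hn w₁ w₂).1 ho w (Finset.mem_univ _)
    exact (Finset.sum_eq_zero_iff_of_nonneg fun w₂ _ => hn w w₂).1 h1 v (Finset.mem_univ _)
  have h1 := hz 0 1 (by decide)
  have h2 := hz 1 0 (by decide)
  have h3 := (h.decoder w v).2
  rw [sum_zmod_two] at h3
  simp only [mul_eq_zero, hv, or_false] at h1 h2 ⊢
  rcases h1 with h1 | h1
  · exact Or.inl h1
  · rcases h2 with h2 | h2
    · exact Or.inr h2
    · linarith

theorem IsTestChannel.disjoint₂ {A : ZMod 2 → W₁ → ℝ} {B : ZMod 2 → W₂ → ℝ}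
    {G : W₁ → W₂ → ZMod 2 → ℝ} (h : IsTestChannel p 0 A B G) (w : W₂) : B 0 w * B 1 w = 0 :=
  IsTestChannel.disjoint₁ (p := p) (A := B) (B := A) (G := fun w₂ w₁ => G w₁ w₂)
    ⟨h.encoder₂, h.encoder₁, fun w₂ w₁ => h.decoder w₁ w₂, fun x₂ x₁ y => by
      rw [add_comm, ← h.output x₁ x₂ y, Finset.sum_comm]
      simp only [mul_comm (B _ _)]⟩ w

end Disjoint

section Recovery

variable {Q W₁ W₂ : Type} [Fintype Q] [Fintype W₁] [Fintype W₂]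
  [DecidableEq Q] [DecidableEq W₁] [DecidableEq W₂]
  {p : ℝ} {P : Outcome Q W₁ W₂ (ZMod 2) (ZMod 2) (ZMod 2) → ℝ}

/-- Without noise in the target, every admissible PMF has auxiliary variables that determine the
sources. -/
theorem IsAdmissible.recovers (h : IsAdmissible (dsbs p 0) P) (hp0 : 0 < p) (hp1 : p < 1) :
    Recovers P := by
  rintro ⟨t, w₁, w₂, x₁, x₂, y⟩ ⟨t', w₁', w₂', x₁', x₂', y'⟩ h0 h1 hQ
  obtain rfl : t = t' := hQ
  have hle : P (t, w₁, w₂, x₁, x₂, y) ≤ law P rvQ t := by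
    rw [law_rvQ]
    have hP := h.isPMF.1
    have s1 := Finset.single_le_sum (f := fun w₁ => ∑ w₂, ∑ x₁, ∑ x₂, ∑ y, P (t, w₁, w₂, x₁, x₂, y))
      (fun _ _ => Finset.sum_nonneg fun _ _ => Finset.sum_nonneg fun _ _ =>
        Finset.sum_nonneg fun _ _ => Finset.sum_nonneg fun _ _ => hP _) (Finset.mem_univ w₁)
    have s2 := Finset.single_le_sum (f := fun w₂ => ∑ x₁, ∑ x₂, ∑ y, P (t, w₁, w₂, x₁, x₂, y))
      (fun _ _ => Finset.sum_nonneg fun _ _ =>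
        Finset.sum_nonneg fun _ _ => Finset.sum_nonneg fun _ _ => hP _) (Finset.mem_univ w₂)
    have s3 := Finset.single_le_sum (f := fun x₁ => ∑ x₂, ∑ y, P (t, w₁, w₂, x₁, x₂, y))
      (fun _ _ => Finset.sum_nonneg fun _ _ => Finset.sum_nonneg fun _ _ => hP _)
      (Finset.mem_univ x₁)
    have s4 := Finset.single_le_sum (f := fun x₂ => ∑ y, P (t, w₁, w₂, x₁, x₂, y))
      (fun _ _ => Finset.sum_nonneg fun _ _ => hP _) (Finset.mem_univ x₂)
    have s5 := Finset.single_le_sum (f := fun y => P (t, w₁, w₂, x₁, x₂, y))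
      (fun _ _ => hP _) (Finset.mem_univ y)
    exact s5.trans (s4.trans (s3.trans (s2.trans s1)))
  have hpos : 0 < P (t, w₁, w₂, x₁, x₂, y) := lt_of_le_of_ne (h.isPMF.1 _) (Ne.symm h0)
  obtain ⟨A, B, G, hch, hform⟩ := h.exists_testChannel hp0 hp1 (t := t) (by linarith)
  rw [hform] at h0 h1
  simp only [ne_eq, mul_eq_zero, not_or] at h0 h1
  have hc₁ : Fintype.card W₁ ≤ 2 := h.card_W₁
  have hc₂ : Fintype.card W₂ ≤ 2 := h.card_W₂
  exact ⟨eq_iff_eq_of_disjoint hch.encoder₁ hc₁ hch.disjoint₁ h0.2.1.1.2 h1.2.1.1.2,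
    eq_iff_eq_of_disjoint hch.encoder₂ hc₂ hch.disjoint₂ h0.2.1.2 h1.2.1.2⟩

end Recovery

section Construction

variable {W₁ W₂ : Type} [Fintype W₁] [Fintype W₂] {p q : ℝ} {A : ZMod 2 → W₁ → ℝ}
  {B : ZMod 2 → W₂ → ℝ} {G : W₁ → W₂ → ZMod 2 → ℝ}

/-- The joint PMF of a test channel, without time sharing. -/
noncomputable def channelPMF (p : ℝ) (A : ZMod 2 → W₁ → ℝ) (B : ZMod 2 → W₂ → ℝ)
    (G : W₁ → W₂ → ZMod 2 → ℝ) (ω : Outcome (Fin 1) W₁ W₂ (ZMod 2) (ZMod 2) (ZMod 2)) : ℝ :=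
  channelMass p A B G (rvXY ω) (rvW ω)

theorem IsTestChannel.channelMass_nonneg (h : IsTestChannel p q A B G) (hp0 : 0 < p) (hp1 : p < 1)
    (t : ZMod 2 × ZMod 2 × ZMod 2) (w : W₁ × W₂) : 0 ≤ channelMass p A B G t w :=
  mul_nonneg (mul_nonneg (mul_nonneg (source_pos hp0 hp1 _ _).le ((h.encoder₁ _).1 _))
    ((h.encoder₂ _).1 _)) ((h.decoder _ _).1 _)

variable [DecidableEq W₁] [DecidableEq W₂]

theorem IsTestChannel.isAdmissible (h : IsTestChannel p q A B G) (hp0 : 0 < p) (hp1 : p < 1)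
    (hc₁ : Fintype.card W₁ ≤ 2) (hc₂ : Fintype.card W₂ ≤ 2) :
    IsAdmissible (dsbs p q) (channelPMF p A B G) := by
  have hval : ∀ t w₁ w₂ x₁ x₂ y, channelPMF p A B G (t, w₁, w₂, x₁, x₂, y)
      = source p x₁ x₂ * A x₁ w₁ * B x₂ w₂ * G w₁ w₂ y := fun _ _ _ _ _ _ => rfl
  have sG := fun w₁ w₂ => (h.decoder w₁ w₂).2
  have sA := fun x => (h.encoder₁ x).2
  have sB := fun x => (h.encoder₂ x).2
  have hXY : ∀ x₁ x₂ y, ∑ w₁, ∑ w₂, source p x₁ x₂ * A x₁ w₁ * B x₂ w₂ * G w₁ w₂ y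
      = dsbs p q (x₁, x₂, y) := by
    intro x₁ x₂ y
    rw [dsbs_eq, ← h.output, Finset.mul_sum]
    refine Finset.sum_congr rfl fun _ _ => ?_
    rw [Finset.mul_sum]
    exact Finset.sum_congr rfl fun _ _ => by ring
  have hone : ∑ ω, channelPMF p A B G ω = 1 := by
    rw [← h.sum_channelMass]
    simp only [Fintype.sum_prod_type, Finset.univ_unique, Finset.sum_singleton, channelPMF]
    rw [Finset.sum_congr rfl fun w₁ _ => Finset.sum_comm, Finset.sum_comm]
    refine Finset.sum_congr rfl fun x₁ _ => ?_
    rw [Finset.sum_congr rfl fun w₁ _ => Finset.sum_comm, Finset.sum_comm]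
    refine Finset.sum_congr rfl fun x₂ _ => ?_
    rw [Finset.sum_congr rfl fun w₁ _ => Finset.sum_comm, Finset.sum_comm]
  have hmarg : ∀ t, law (channelPMF p A B G) rvXY t = dsbs p q t := by
    rintro ⟨x₁, x₂, y⟩
    rw [law_rvXY, ← hXY]
    simp only [Finset.univ_unique, Finset.sum_singleton, hval]
  refine ⟨⟨fun ω => h.channelMass_nonneg hp0 hp1 _ _, hone⟩, hmarg, ?_, ⟨?_, ?_⟩, ?_, hc₁, hc₂⟩
  · rintro t ⟨x₁, x₂, y⟩
    have h1 : law (channelPMF p A B G) rvQ t = 1 := by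
      have := sum_law (channelPMF p A B G) rvQ
      rw [hone] at this
      rw [← this, Finset.univ_unique, Finset.sum_singleton, Subsingleton.elim t default]
    rw [h1, one_mul, hmarg, law_QXY, ← hXY]
    simp only [hval]
  · rintro w₁ ⟨t, x₁⟩ ⟨⟨t', x₂⟩, w₂⟩
    obtain rfl := Subsingleton.elim t t'
    have e1 := law_encoder₁ (channelPMF p A B G) t w₁ w₂ x₁ x₂
    have e2 := law_QX₁ (channelPMF p A B G) t x₁
    have e3 := law_W₁QX₁ (channelPMF p A B G) t w₁ x₁
    have e4 := law_X₁X₂W₂ (channelPMF p A B G) t w₂ x₁ x₂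
    have c2 : ∑ w₁, ∑ w₂, ∑ x₂, source p x₁ x₂ * A x₁ w₁ * B x₂ w₂ = 1 / 2 := by
      simp only [Finset.sum_comm (s := (Finset.univ : Finset W₂)), ← Finset.mul_sum, sB, mul_one,
        ← Finset.sum_mul, sum_source_right, sA]
    have c3 : ∑ w₂, ∑ x₂, source p x₁ x₂ * A x₁ w₁ * B x₂ w₂ = 1 / 2 * A x₁ w₁ := by
      simp only [Finset.sum_comm (s := (Finset.univ : Finset W₂)), ← Finset.mul_sum, sB, mul_one,
        ← Finset.sum_mul, sum_source_right]
    simp only [hval, ← Finset.mul_sum, sG, mul_one] at e1 e2 e3 e4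
    rw [e1, e2, e3, e4]
    simp only [← Finset.mul_sum, ← Finset.sum_mul, sA, mul_one] at c2 c3 ⊢
    rw [c2, c3]
    ring
  · rintro ⟨w₁, ⟨t, x₁⟩⟩ ⟨t', x₂⟩ w₂
    obtain rfl := Subsingleton.elim t t'
    have e1 := law_encoder₂ (channelPMF p A B G) t w₁ w₂ x₁ x₂
    have e2 := law_QX₂ (channelPMF p A B G) t x₂
    have e3 := law_W₁X₁X₂ (channelPMF p A B G) t w₁ x₁ x₂
    have e4 := law_QX₂W₂ (channelPMF p A B G) t w₂ x₂
    have c4 : ∀ w₂, ∑ w₁, ∑ x₁, source p x₁ x₂ * A x₁ w₁ * B x₂ w₂ = 1 / 2 * B x₂ w₂ := by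
      intro w₂
      simp only [Finset.sum_comm (s := (Finset.univ : Finset W₁)), ← Finset.mul_sum, sA, mul_one,
        ← Finset.sum_mul, sum_source_left]
    have c2 : ∑ w₁, ∑ w₂, ∑ x₁, source p x₁ x₂ * A x₁ w₁ * B x₂ w₂ = 1 / 2 := by
      rw [Finset.sum_comm]
      simp only [c4, ← Finset.mul_sum, sB, mul_one]
    simp only [hval, ← Finset.mul_sum, sG, mul_one] at e1 e2 e3 e4
    simp only [sB, mul_one] at e3
    rw [e1, e2, e3, e4, c2, c4]
    ring
  · rintro ⟨x₁, x₂⟩ ⟨t, w₁, w₂⟩ y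
    rw [law_decoder, law_QW, law_XQW, law_QWY]
    simp only [hval, ← Finset.mul_sum, sG, mul_one, ← Finset.sum_mul]
    ring

theorem condMI_channelPMF :
    condMI (channelPMF p A B G) rvXY rvW rvQ = massMI (channelMass p A B G) / log 2 := by
  rw [condMI_eq_sum_massMI, Finset.univ_unique, Finset.sum_singleton]
  congr 2
  ext ⟨x₁, x₂, y⟩ ⟨w₁, w₂⟩
  exact law_XYWQ _ _ _ _ _ _ _

end Construction

/-- The test channel whose auxiliary variables are the sources. -/
theorem isTestChannel_kron {q : ℝ} (p : ℝ) (hq0 : 0 ≤ q) (hq1 : q ≤ 1) :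
    IsTestChannel p q (fun x w : ZMod 2 => kron x w) (fun x w : ZMod 2 => kron x w)
      (fun w₁ w₂ => target q (w₁ + w₂)) := by
  have hk : ∀ x : ZMod 2, IsPMF (fun w : ZMod 2 => kron x w) := fun x =>
    ⟨fun w => by show 0 ≤ kron x w; unfold kron; split_ifs <;> norm_num, by simp [kron]⟩
  refine ⟨hk, hk, fun w₁ w₂ => ⟨fun y => ?_, sum_target _ _⟩, fun x₁ x₂ y => by simp [kron]⟩
  unfold target
  split_ifs <;> linarith

theorem exists_isAdmissible_eq_sources {p q : ℝ} (hp0 : 0 < p) (hp1 : p < 1) (hq0 : 0 ≤ q)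
    (hq1 : q ≤ 1) :
    ∃ P : Outcome (Fin 1) (ZMod 2) (ZMod 2) (ZMod 2) (ZMod 2) (ZMod 2) → ℝ,
      IsAdmissible (dsbs p q) P ∧ ∀ ω, P ω ≠ 0 → rvW₁ ω = rvX₁ ω ∧ rvW₂ ω = rvX₂ ω := by
  refine ⟨_, (isTestChannel_kron p hq0 hq1).isAdmissible hp0 hp1 le_rfl le_rfl, fun ω hω => ?_⟩
  simp only [channelPMF, channelMass, kron, ne_eq, mul_eq_zero, not_or] at hω
  constructor
  · by_contra hne
    exact hω.1.1.2 (if_neg (Ne.symm hne))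
  · by_contra hne
    exact hω.1.2 (if_neg (Ne.symm hne))

theorem isClosed_rates (h : ℝ) :
    IsClosed {t : ℝ × ℝ × ℝ | h ≤ t.1 ∧ h ≤ t.2.1 ∧ 0 ≤ t.2.2} := by
  have h1 : IsClosed {t : ℝ × ℝ × ℝ | h ≤ t.1} := isClosed_le (by fun_prop) (by fun_prop)
  have h2 : IsClosed {t : ℝ × ℝ × ℝ | h ≤ t.2.1} := isClosed_le (by fun_prop) (by fun_prop)
  have h3 : IsClosed {t : ℝ × ℝ × ℝ | 0 ≤ t.2.2} := isClosed_le (by fun_prop) (by fun_prop)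
  exact h1.inter (h2.inter h3)

theorem isClosed_rates_sum (h s : ℝ) :
    IsClosed {t : ℝ × ℝ × ℝ | h ≤ t.1 ∧ h ≤ t.2.1 ∧ s ≤ t.1 + t.2.1 ∧ 0 ≤ t.2.2} := by
  have h1 : IsClosed {t : ℝ × ℝ × ℝ | h ≤ t.1} := isClosed_le (by fun_prop) (by fun_prop)
  have h2 : IsClosed {t : ℝ × ℝ × ℝ | h ≤ t.2.1} := isClosed_le (by fun_prop) (by fun_prop)
  have h3 : IsClosed {t : ℝ × ℝ × ℝ | s ≤ t.1 + t.2.1} := isClosed_le (by fun_prop) (by fun_prop)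
  have h4 : IsClosed {t : ℝ × ℝ × ℝ | 0 ≤ t.2.2} := isClosed_le (by fun_prop) (by fun_prop)
  exact h1.inter (h2.inter (h3.inter h4))

/-- Adding the two sources with a common linear code needs only the rates `h_b(p)`. -/
theorem subset_Rs {p q : ℝ} (hp0 : 0 < p) (hp1 : p < 1) (hq0 : 0 ≤ q) (hq1 : q ≤ 1) :
    {t : ℝ × ℝ × ℝ | hb p ≤ t.1 ∧ hb p ≤ t.2.1 ∧ 0 ≤ t.2.2} ⊆ Rs (dsbs p q) := by
  rintro t ⟨h1, h2, h3⟩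
  obtain ⟨P, hP, hW⟩ := exists_isAdmissible_eq_sources hp0 hp1 hq0 hq1
  have hr : Recovers P := fun ω ω' h0 h0' _ => by
    rw [(hW ω h0).1, (hW ω h0).2, (hW ω' h0').1, (hW ω' h0').2]
    exact ⟨Iff.rfl, Iff.rfl⟩
  refine subset_closure ⟨1, 2, ⟨Nat.prime_two⟩, P, hP, ?_⟩
  refine (hr.mem_structuredRates_iff hP t).2 ?_
  obtain ⟨z1, z2⟩ := hP.condMI_sum_eq_zero hW
  rw [z1, z2]
  refine ⟨?_, ?_, ?_, ?_, ?_, ?_⟩ <;> linarith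

theorem Rs_noiseless {p : ℝ} (hp0 : 0 < p) (hp1 : p < 1) :
    Rs (dsbs p 0) = {t : ℝ × ℝ × ℝ | hb p ≤ t.1 ∧ hb p ≤ t.2.1 ∧ 0 ≤ t.2.2} := by
  refine Set.Subset.antisymm (closure_minimal ?_ (isClosed_rates _))
    (subset_Rs hp0 hp1 le_rfl zero_le_one)
  rintro t ⟨k, r, hr, P, hP, ht⟩
  obtain ⟨h1, h2, -, -, -, h6⟩ := ((hP.recovers hp0 hp1).mem_structuredRates_iff hP t).1 ht
  have z1 := condMI_nonneg hP.isPMF.1 rvZ rvW₁ rvQ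
  have z2 := condMI_nonneg hP.isPMF.1 rvZ rvW₂ rvQ
  exact ⟨by linarith, by linarith, h6⟩

theorem Ru_noiseless {p : ℝ} (hp0 : 0 < p) (hp1 : p < 1) :
    Ru (dsbs p 0) = {t : ℝ × ℝ × ℝ | hb p ≤ t.1 ∧ hb p ≤ t.2.1 ∧
      1 + hb p ≤ t.1 + t.2.1 ∧ 0 ≤ t.2.2} := by
  refine Set.Subset.antisymm (closure_minimal ?_ (isClosed_rates_sum _ _)) fun t ht => ?_
  · rintro t ⟨k, m₁, m₂, P, hP, ht⟩
    rwa [(hP.recovers hp0 hp1).unstructuredRates_eq hP] at ht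
  · obtain ⟨P, hP, -⟩ := exists_isAdmissible_eq_sources hp0 hp1 le_rfl zero_le_one
    rw [← (hP.recovers hp0 hp1).unstructuredRates_eq hP] at ht
    -- `ZMod 2` is `Fin 2`
    exact subset_closure ⟨1, 2, 2, P, hP, ht⟩

/-! ### The unstructured bound for `p = q = 1 / 10` -/

theorem isPMF_target {e : ℝ} (h0 : 0 ≤ e) (h1 : e ≤ 1) (s : ZMod 2) : IsPMF (target e s) :=
  ⟨fun y => by unfold target; split_ifs <;> linarith, sum_target e s⟩

/-- The symmetric test channel, optimal up to rounding: both encoders flip their source with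
probability `4113 / 200000`, and the decoder flips the sum of the auxiliary
variables as often as the target demands. -/
theorem isTestChannel_symmetric :
    IsTestChannel (1 / 10) (1 / 10) (target (4113 / 200000)) (target (4113 / 200000))
      (fun w₁ w₂ => target (1194316769 / 18388633538) (w₁ + w₂)) := by
  refine ⟨isPMF_target (by norm_num) (by norm_num), isPMF_target (by norm_num) (by norm_num),
    fun w₁ w₂ => isPMF_target (by norm_num) (by norm_num) _, fun x₁ x₂ y => ?_⟩
  simp only [sum_zmod_two]
  rcases zmod_two_cases x₁ with rfl | rfl <;> rcases zmod_two_cases x₂ with rfl | rfl <;>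
    rcases zmod_two_cases y with rfl | rfl <;>
    simp [target, show (1 : ZMod 2) + 1 = 0 from rfl] <;> norm_num

theorem massMI_symmetric :
    massMI (channelMass (1 / 10) (target (4113 / 200000)) (target (4113 / 200000))
      (fun w₁ w₂ => target (1194316769 / 18388633538) (w₁ + w₂)))
      = binEntropy (1 / 10) - optimalValue := by
  have haux : ∀ w₁ w₂, auxMass (1 / 10) (target (4113 / 200000)) (target (4113 / 200000)) w₁ w₂
      = source (3305683231 / 25000000000) w₁ w₂ := by
    intro w₁ w₂
    simp only [auxMass, sum_zmod_two]
    rcases zmod_two_cases w₁ with rfl | rfl <;> rcases zmod_two_cases w₂ with rfl | rfl <;>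
      norm_num [target, source]
  rw [isTestChannel_symmetric.massMI_eq]
  simp only [haux, sum_negMulLog_target, sum_negMulLog_source, ← Finset.sum_mul, sum_source_right]
  rw [optimalValue]
  simp
  ring

theorem optimal_information_bounds :
    1.3964999 * log 2 ≤ binEntropy (1 / 10) - optimalValue ∧
      binEntropy (1 / 10) - optimalValue ≤ 1.3965499 * log 2 := by
  have h2 := log_two_gt_d9
  have h2' := log_two_lt_d9
  have h3 := log_three_bounds
  have h5 := log_five_bounds
  have b1 := log_flip_bounds
  have b2 := log_one_sub_flip_bounds
  have b3 := log_disagree_bounds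
  have b4 := log_one_sub_disagree_bounds
  have b5 := log_miss_bounds
  have b6 := log_one_sub_miss_bounds
  have l1 : log (1 / 10) = -log 2 - log 5 := by
    rw [show (1 / 10 : ℝ) = (2 * 5)⁻¹ by norm_num, log_inv, log_mul (by norm_num) (by norm_num)]
    ring
  have l9 : log (9 / 10) = 2 * log 3 - log 2 - log 5 := by
    rw [show (9 / 10 : ℝ) = 3 ^ 2 * (2 * 5)⁻¹ by norm_num, log_mul (by norm_num) (by norm_num),
      log_inv, log_mul (by norm_num) (by norm_num), log_pow]
    push_cast
    ring
  rw [optimalValue]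
  simp only [binEntropy_eq]
  rw [show (1 : ℝ) - 1 / 10 = 9 / 10 by norm_num,
    show (1 : ℝ) - 4113 / 200000 = 195887 / 200000 by norm_num,
    show (1 : ℝ) - 3305683231 / 25000000000 = 21694316769 / 25000000000 by norm_num,
    show (1 : ℝ) - 1194316769 / 18388633538 = 17194316769 / 18388633538 by norm_num, l1, l9]
  constructor <;> linarith [h3.1, h3.2, h5.1, h5.2, b1.1, b1.2, b2.1, b2.2, b3.1, b3.2, b4.1,
    b4.2, b5.1, b5.2, b6.1, b6.2]

theorem hb_one_tenth_le : hb (1 / 10) ≤ 0.4798 := by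
  have h2 := log_two_gt_d9
  have h2' := log_two_lt_d9
  have h3 := log_three_bounds
  have h5 := log_five_bounds
  have l1 : log (1 / 10) = -log 2 - log 5 := by
    rw [show (1 / 10 : ℝ) = (2 * 5)⁻¹ by norm_num, log_inv, log_mul (by norm_num) (by norm_num)]
    ring
  have l9 : log (9 / 10) = 2 * log 3 - log 2 - log 5 := by
    rw [show (9 / 10 : ℝ) = 3 ^ 2 * (2 * 5)⁻¹ by norm_num, log_mul (by norm_num) (by norm_num),
      log_inv, log_mul (by norm_num) (by norm_num), log_pow]
    push_cast
    ring
  rw [hb, div_le_iff₀ (log_pos (by norm_num)), binEntropy_eq,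
    show (1 : ℝ) - 1 / 10 = 9 / 10 by norm_num, l1, l9]
  linarith [h3.1, h3.2, h5.1, h5.2]

section LowerBound

variable {Q W₁ W₂ : Type} [Fintype Q] [Fintype W₁] [Fintype W₂]
  [DecidableEq Q] [DecidableEq W₁] [DecidableEq W₂]
  {P : Outcome Q W₁ W₂ (ZMod 2) (ZMod 2) (ZMod 2) → ℝ}

theorem IsAdmissible.le_condMI (h : IsAdmissible (dsbs (1 / 10) (1 / 10)) P) :
    (binEntropy (1 / 10) - optimalValue - 0.00003) / log 2 ≤ condMI P rvXY rvW rvQ := by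
  rw [condMI_eq_sum_massMI]
  refine div_le_div_of_nonneg_right ?_ (log_nonneg (by norm_num))
  -- the information is an average over `Q` of informations of test channels
  have key : ∀ t, law P rvQ t * (binEntropy (1 / 10) - optimalValue - 0.00003)
      ≤ massMI fun a b => law P (fun ω => (rvXY ω, rvW ω, rvQ ω)) (a, b, t) := by
    intro t
    rcases eq_or_ne (law P rvQ t) 0 with h0 | h0
    · rw [h0, zero_mul]
      exact massMI_nonneg fun a b => law_nonneg h.isPMF.1 _ _
    · obtain ⟨A, B, G, hch, hform⟩ := h.exists_testChannel (by norm_num) (by norm_num) h0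
      have hm : (fun a b => law P (fun ω => (rvXY ω, rvW ω, rvQ ω)) (a, b, t))
          = fun a b => law P rvQ t * channelMass (1 / 10) A B G a b := by
        ext ⟨x₁, x₂, y⟩ ⟨w₁, w₂⟩
        rw [law_XYWQ, hform]
        rfl
      rw [hm, massMI_smul]
      exact mul_le_mul_of_nonneg_left (hch.le_massMI h.card_W₁ h.card_W₂)
        (law_nonneg h.isPMF.1 _ _)
  have hs := Finset.sum_le_sum fun t (_ : t ∈ Finset.univ) => key t
  rwa [← Finset.sum_mul, (sum_law P rvQ).trans h.isPMF.2, one_mul] at hs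

end LowerBound

theorem rates_nonneg_of_mem_Ru {X₁ X₂ Y : Type} [Fintype X₁] [Fintype X₂] [Fintype Y]
    [DecidableEq X₁] [DecidableEq X₂] [DecidableEq Y] {p : X₁ × X₂ × Y → ℝ} {t : ℝ × ℝ × ℝ}
    (ht : t ∈ Ru p) : 0 ≤ t.1 ∧ 0 ≤ t.2.1 ∧ 0 ≤ t.2.2 := by
  refine closure_minimal (t := {t : ℝ × ℝ × ℝ | 0 ≤ t.1 ∧ 0 ≤ t.2.1 ∧ 0 ≤ t.2.2}) ?_
    (isClosed_rates 0) ht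
  rintro t ⟨k, m₁, m₂, P, hP, h1, h2, -, -, -, -, h7⟩
  have := hP.condMI_W_le₁
  have := hP.condMI_W_le₂
  exact ⟨by linarith, by linarith, h7⟩

theorem isLeast_sum_Ru : ∃ m : ℝ,
    IsLeast ((fun t : ℝ × ℝ × ℝ => t.1 + t.2.1 + t.2.2) '' Ru (dsbs (1 / 10) (1 / 10))) m ∧
      |m - 1.3965| ≤ 0.00005 := by
  have hadm := isTestChannel_symmetric.isAdmissible (by norm_num) (by norm_num) le_rfl le_rfl
  obtain ⟨t₀, ht₀, hs₀⟩ := exists_mem_unstructuredRates hadm.isPMF.1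
  rw [condMI_channelPMF, massMI_symmetric] at hs₀
  -- `ZMod 2` is `Fin 2`
  have hmem : t₀ ∈ Ru (dsbs (1 / 10) (1 / 10)) := subset_closure ⟨1, 2, 2, _, hadm, ht₀⟩
  have hlow : ∀ t ∈ Ru (dsbs (1 / 10) (1 / 10)),
      (binEntropy (1 / 10) - optimalValue - 0.00003) / log 2 ≤ t.1 + t.2.1 + t.2.2 := by
    intro t ht
    refine closure_minimal (t := {t : ℝ × ℝ × ℝ |
      (binEntropy (1 / 10) - optimalValue - 0.00003) / log 2 ≤ t.1 + t.2.1 + t.2.2}) ?_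
      (isClosed_le (by fun_prop) (by fun_prop)) ht
    rintro t ⟨k, m₁, m₂, P, hP, -, -, -, -, -, h6, -⟩
    exact hP.le_condMI.trans h6
  -- rates are nonnegative on `Ru`, so the points with a small sum form a compact set
  set K := Ru (dsbs (1 / 10) (1 / 10)) ∩
    {t : ℝ × ℝ × ℝ | t.1 + t.2.1 + t.2.2 ≤ t₀.1 + t₀.2.1 + t₀.2.2}
    with hK
  have hKc : IsCompact K := by
    refine IsCompact.of_isClosed_subset (isCompact_Icc (a := ((0 : ℝ), (0 : ℝ), (0 : ℝ)))
      (b := (t₀.1 + t₀.2.1 + t₀.2.2, t₀.1 + t₀.2.1 + t₀.2.2, t₀.1 + t₀.2.1 + t₀.2.2)))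
      (isClosed_closure.inter (isClosed_le (by fun_prop) (by fun_prop))) ?_
    rintro t ⟨ht, hle⟩
    obtain ⟨h1, h2, h3⟩ := rates_nonneg_of_mem_Ru ht
    have hle' : t.1 + t.2.1 + t.2.2 ≤ t₀.1 + t₀.2.1 + t₀.2.2 := hle
    exact ⟨⟨h1, h2, h3⟩, ⟨by dsimp only; linarith, by dsimp only; linarith,
      by dsimp only; linarith⟩⟩
  obtain ⟨t₁, ⟨ht₁, hle₁⟩, hmin⟩ := hKc.exists_isMinOn (f := fun t => t.1 + t.2.1 + t.2.2)
    ⟨t₀, hmem, le_refl (t₀.1 + t₀.2.1 + t₀.2.2)⟩ (by fun_prop)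
  have hle₁' : t₁.1 + t₁.2.1 + t₁.2.2 ≤ t₀.1 + t₀.2.1 + t₀.2.2 := hle₁
  refine ⟨t₁.1 + t₁.2.1 + t₁.2.2, ⟨⟨t₁, ht₁, rfl⟩, ?_⟩, ?_⟩
  · rintro _ ⟨t, ht, rfl⟩
    dsimp only
    rcases le_total (t.1 + t.2.1 + t.2.2) (t₀.1 + t₀.2.1 + t₀.2.2) with h | h
    · exact hmin ⟨ht, h⟩
    · exact hle₁'.trans h
  · have hl := hlow t₁ ht₁
    obtain ⟨n1, n2⟩ := optimal_information_bounds
    have h2 := log_two_gt_d9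
    have hpos : 0 < log 2 := by linarith
    rw [hs₀] at hle₁'
    rw [le_div_iff₀ hpos] at hle₁'
    rw [div_le_iff₀ hpos] at hl
    rw [abs_le]
    constructor
    · refine le_of_mul_le_mul_right ?_ hpos
      linarith
    · refine le_of_mul_le_mul_right ?_ hpos
      linarith

theorem exists_mem_Rs_sum_eq :
    ∃ t ∈ Rs (dsbs (1 / 10) (1 / 10)), t.1 + t.2.1 + t.2.2 = 0.9596 := by
  refine ⟨(hb (1 / 10), hb (1 / 10), 0.9596 - 2 * hb (1 / 10)),
    subset_Rs (by norm_num) (by norm_num) (by norm_num) (by norm_num) ⟨le_rfl, le_rfl, ?_⟩, ?_⟩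
  · have := hb_one_tenth_le
    dsimp only
    linarith
  · dsimp only
    ring

/-! ### The weak law of large numbers for a memoryless noise -/

section WeakLaw

variable {α : Type} [Fintype α] {b f : α → ℝ}

theorem sum_fin_succ {n : ℕ} (F : (Fin (n + 1) → α) → ℝ) :
    ∑ z, F z = ∑ a, ∑ z : Fin n → α, F (Fin.cons a z) := by
  rw [← (Fin.consEquiv fun _ => α).sum_comp, Fintype.sum_prod_type]
  rfl

theorem sum_prod_eq_one [DecidableEq α] (hb : ∑ a, b a = 1) (n : ℕ) :
    ∑ z : Fin n → α, ∏ i, b (z i) = 1 := by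
  rw [← Fintype.piFinset_univ, ← Finset.prod_univ_sum]
  simp [hb]

theorem sum_prod_mul_sum_eq_zero [DecidableEq α] (hb : ∑ a, b a = 1) (hf : ∑ a, b a * f a = 0)
    (n : ℕ) : ∑ z : Fin n → α, (∏ i, b (z i)) * ∑ i, f (z i) = 0 := by
  induction n with
  | zero => simp
  | succ n ih =>
    rw [sum_fin_succ]
    simp only [Fin.prod_univ_succ, Fin.sum_univ_succ, Fin.cons_zero, Fin.cons_succ]
    have h1 : ∀ a, ∑ z : Fin n → α, b a * (∏ i, b (z i)) * (f a + ∑ i, f (z i)) = b a * f a := by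
      intro a
      calc ∑ z : Fin n → α, b a * (∏ i, b (z i)) * (f a + ∑ i, f (z i))
          = b a * f a * ∑ z : Fin n → α, ∏ i, b (z i)
            + b a * ∑ z : Fin n → α, (∏ i, b (z i)) * ∑ i, f (z i) := by
            rw [Finset.mul_sum, Finset.mul_sum, ← Finset.sum_add_distrib]
            exact Finset.sum_congr rfl fun _ _ => by ring
        _ = b a * f a := by rw [ih, sum_prod_eq_one hb]; ring
    simp only [h1, hf]

theorem sum_prod_mul_sum_sq [DecidableEq α] (hb : ∑ a, b a = 1) (hf : ∑ a, b a * f a = 0) (n : ℕ) :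
    ∑ z : Fin n → α, (∏ i, b (z i)) * (∑ i, f (z i)) ^ 2 = n * ∑ a, b a * f a ^ 2 := by
  induction n with
  | zero => simp
  | succ n ih =>
    rw [sum_fin_succ]
    simp only [Fin.prod_univ_succ, Fin.sum_univ_succ, Fin.cons_zero, Fin.cons_succ]
    have h1 : ∀ a, ∑ z : Fin n → α, b a * (∏ i, b (z i)) * (f a + ∑ i, f (z i)) ^ 2
        = b a * f a ^ 2 + b a * (n * ∑ a, b a * f a ^ 2) := by
      intro a
      calc ∑ z : Fin n → α, b a * (∏ i, b (z i)) * (f a + ∑ i, f (z i)) ^ 2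
          = b a * f a ^ 2 * ∑ z : Fin n → α, ∏ i, b (z i)
            + 2 * b a * f a * ∑ z : Fin n → α, (∏ i, b (z i)) * ∑ i, f (z i)
            + b a * ∑ z : Fin n → α, (∏ i, b (z i)) * (∑ i, f (z i)) ^ 2 := by
            rw [Finset.mul_sum, Finset.mul_sum, Finset.mul_sum, ← Finset.sum_add_distrib,
              ← Finset.sum_add_distrib]
            exact Finset.sum_congr rfl fun _ _ => by ring
        _ = _ := by rw [ih, sum_prod_eq_one hb, sum_prod_mul_sum_eq_zero hb hf]; ring
    simp only [h1, Finset.sum_add_distrib, ← Finset.sum_mul, hb]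
    push_cast
    ring

/-- Chebyshev's inequality for a sum of i.i.d. centred variables. -/
theorem sum_deviation_le [DecidableEq α] (hb0 : ∀ a, 0 ≤ b a) (hb : ∑ a, b a = 1)
    (hf : ∑ a, b a * f a = 0) {n : ℕ} (hn : 0 < n) {δ : ℝ} (hδ : 0 < δ) :
    ∑ z : Fin n → α with n * δ < |∑ i, f (z i)|, ∏ i, b (z i)
      ≤ (∑ a, b a * f a ^ 2) / (n * δ ^ 2) := by
  have hn' : (0 : ℝ) < n := by exact_mod_cast hn
  rw [le_div_iff₀ (by positivity)]
  refine le_of_mul_le_mul_left ?_ hn'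
  rw [← sum_prod_mul_sum_sq hb hf n, mul_comm, mul_assoc, Finset.sum_mul]
  calc _ ≤ ∑ z : Fin n → α with n * δ < |∑ i, f (z i)|, (∏ i, b (z i)) * (∑ i, f (z i)) ^ 2 := by
        refine Finset.sum_le_sum fun z hz => ?_
        refine mul_le_mul_of_nonneg_left ?_ (Finset.prod_nonneg fun i _ => hb0 _)
        rw [← sq_abs (∑ i, f (z i))]
        have h1 := (Finset.mem_filter.1 hz).2
        have h2 : 0 < (n : ℝ) * δ := by positivity
        calc (n : ℝ) * δ ^ 2 * n = (n * δ) ^ 2 := by ring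
          _ ≤ _ := pow_le_pow_left₀ h2.le h1.le 2
    _ ≤ _ := Finset.sum_le_sum_of_subset_of_nonneg (Finset.filter_subset _ _) fun z _ _ =>
        mul_nonneg (Finset.prod_nonneg fun i _ => hb0 _) (sq_nonneg _)

end WeakLaw

/-- The PMF of `n` i.i.d. `Bernoulli(p)` noise bits. -/
noncomputable def noise (p : ℝ) {n : ℕ} (z : Fin n → ZMod 2) : ℝ := ∏ i, target p 0 (z i)

/-- The weakly typical noise sequences: those whose probability is `exp (-n (H ± δ))`, where `H` is
the entropy of a noise bit in nats. -/
noncomputable def typical (p δ : ℝ) (n : ℕ) : Finset (Fin n → ZMod 2) :=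
  {z | |∑ i, (-log (target p 0 (z i)) - binEntropy p)| ≤ n * δ}

section Noise

variable {p δ : ℝ} {n : ℕ}

theorem target_pos (h0 : 0 < p) (h1 : p < 1) (s y : ZMod 2) : 0 < target p s y := by
  unfold target; split_ifs <;> linarith

theorem noise_pos (h0 : 0 < p) (h1 : p < 1) (z : Fin n → ZMod 2) : 0 < noise p z :=
  Finset.prod_pos fun _ _ => target_pos h0 h1 _ _

theorem sum_noise (p : ℝ) (n : ℕ) : ∑ z : Fin n → ZMod 2, noise p z = 1 :=
  sum_prod_eq_one (sum_target p 0) n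

theorem noise_eq_exp (h0 : 0 < p) (h1 : p < 1) (z : Fin n → ZMod 2) :
    noise p z = exp (-(n * binEntropy p)
      - ∑ i, (-log (target p 0 (z i)) - binEntropy p)) := by
  rw [noise, Finset.sum_sub_distrib, Finset.sum_neg_distrib, Finset.sum_const, Finset.card_univ,
    Fintype.card_fin, nsmul_eq_mul, ← log_prod fun i _ => (target_pos h0 h1 _ _).ne']
  rw [show ∀ a b : ℝ, -a - (-b - a) = b by intros; ring,
    exp_log (Finset.prod_pos fun _ _ => target_pos h0 h1 _ _)]

theorem noise_le_of_mem_typical (h0 : 0 < p) (h1 : p < 1) {z : Fin n → ZMod 2}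
    (hz : z ∈ typical p δ n) : noise p z ≤ exp (-(n * (binEntropy p - δ))) := by
  rw [noise_eq_exp h0 h1, exp_le_exp]
  have := (abs_le.1 (Finset.mem_filter.1 hz).2).1
  linarith

theorem card_typical_le (h0 : 0 < p) (h1 : p < 1) (δ : ℝ) (n : ℕ) :
    ((typical p δ n).card : ℝ) ≤ exp (n * (binEntropy p + δ)) := by
  have hle : ∀ z ∈ typical p δ n, exp (-(n * (binEntropy p + δ))) ≤ noise p z := by
    intro z hz
    rw [noise_eq_exp h0 h1, exp_le_exp]
    have := (abs_le.1 (Finset.mem_filter.1 hz).2).2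
    linarith
  have h2 := Finset.card_nsmul_le_sum _ _ _ hle
  have h3 : ∑ z ∈ typical p δ n, noise p z ≤ 1 := by
    rw [← sum_noise p n]
    exact Finset.sum_le_sum_of_subset_of_nonneg (Finset.subset_univ _) fun z _ _ =>
      (noise_pos h0 h1 z).le
  rw [nsmul_eq_mul, exp_neg, ← div_eq_mul_inv] at h2
  have := h2.trans h3
  rwa [div_le_one (exp_pos _)] at this

/-- The noise is typical with high probability. -/
theorem exists_sum_not_typical_le (h0 : 0 < p) (h1 : p < 1) (hδ : 0 < δ) {ε : ℝ} (hε : 0 < ε) :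
    ∃ n₀ : ℕ, ∀ n ≥ n₀, ∑ z with z ∉ typical p δ n, noise p z ≤ ε := by
  set f : ZMod 2 → ℝ := fun a => -log (target p 0 a) - binEntropy p with hf
  set v := ∑ a, target p 0 a * f a ^ 2 with hv
  have hcent : ∑ a, target p 0 a * f a = 0 := by
    simp only [hf, mul_sub, Finset.sum_sub_distrib, ← Finset.sum_mul, sum_target, one_mul]
    rw [sub_eq_zero, ← sum_negMulLog_target p 0]
    exact Finset.sum_congr rfl fun a _ => by rw [negMulLog]; ring
  obtain ⟨n₀, hn₀⟩ := exists_nat_gt (v / (δ ^ 2 * ε))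
  refine ⟨n₀ + 1, fun n hn => ?_⟩
  have hn0 : 0 < n := by omega
  have hn0' : (0 : ℝ) < n := by exact_mod_cast hn0
  have hset : (Finset.univ.filter fun z : Fin n → ZMod 2 => z ∉ typical p δ n)
      = Finset.univ.filter fun z : Fin n → ZMod 2 => n * δ < |∑ i, f (z i)| := by
    ext z
    simp [typical, hf]
  rw [hset]
  refine (sum_deviation_le (fun a => (target_pos h0 h1 0 a).le) (sum_target p 0) hcent hn0
    hδ).trans ?_
  rw [← hv, div_le_iff₀ (by positivity)]
  have h2 : (n₀ : ℝ) ≤ n := by exact_mod_cast (by omega : n₀ ≤ n)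
  have h3 := (div_lt_iff₀ (by positivity)).1 (hn₀.trans_le h2)
  linarith

/-- The PMF of the two source sequences. -/
noncomputable def pairMass (p : ℝ) {n : ℕ} (x₁ x₂ : Fin n → ZMod 2) : ℝ :=
  (1 / 2) ^ n * noise p (x₁ + x₂)

theorem pairMass_nonneg (h0 : 0 < p) (h1 : p < 1) (x₁ x₂ : Fin n → ZMod 2) :
    0 ≤ pairMass p x₁ x₂ := mul_nonneg (by positivity) (noise_pos h0 h1 _).le

theorem source_eq_target (p : ℝ) (x₁ x₂ : ZMod 2) :
    source p x₁ x₂ = 1 / 2 * target p 0 (x₁ + x₂) := by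
  unfold source target
  congr 1
  rcases zmod_two_cases x₁ with rfl | rfl <;> rcases zmod_two_cases x₂ with rfl | rfl <;>
    simp [show (1 : ZMod 2) + 1 = 0 from rfl]

theorem prod_source (p : ℝ) (x₁ x₂ : Fin n → ZMod 2) :
    ∏ i, source p (x₁ i) (x₂ i) = pairMass p x₁ x₂ := by
  simp [source_eq_target, Finset.prod_mul_distrib, pairMass, noise]

theorem prod_sum_dsbs (p q : ℝ) (x₁ x₂ : Fin n → ZMod 2) :
    ∏ i, ∑ y, dsbs p q (x₁ i, x₂ i, y) = pairMass p x₁ x₂ := by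
  simp only [dsbs_eq, ← Finset.mul_sum, sum_target, mul_one, prod_source]

theorem prod_dsbs_zero (p : ℝ) (x₁ x₂ y : Fin n → ZMod 2) :
    ∏ i, dsbs p 0 (x₁ i, x₂ i, y i) = pairMass p x₁ x₂ * kron (x₁ + x₂) y := by
  simp only [dsbs_eq, Finset.prod_mul_distrib, prod_source]
  congr 1
  unfold kron target
  split_ifs with h
  · subst h
    simp
  · obtain ⟨i, hi⟩ := Function.ne_iff.1 h
    exact Finset.prod_eq_zero (Finset.mem_univ i) (by simpa using Ne.symm hi)

theorem sum_shift (x : Fin n → ZMod 2) (g : (Fin n → ZMod 2) → ℝ) :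
    ∑ x', g (x + x') = ∑ z, g z :=
  Fintype.sum_equiv (Equiv.addLeft x) _ _ fun _ => rfl

theorem sum_pairMass_mul (p : ℝ) (g : (Fin n → ZMod 2) → ℝ) :
    ∑ x₁, ∑ x₂, pairMass p x₁ x₂ * g (x₁ + x₂) = ∑ z, noise p z * g z := by
  simp only [pairMass, mul_assoc, ← Finset.mul_sum]
  simp only [sum_shift _ fun z => noise p z * g z]
  rw [Finset.sum_const, Finset.card_univ, nsmul_eq_mul, ← mul_assoc]
  simp

end Noise

/-! ### The converse for the achievable region -/

theorem IsPMF.le_one {Ω : Type} [Fintype Ω] {P : Ω → ℝ} (h : IsPMF P) (ω : Ω) : P ω ≤ 1 :=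
  h.2 ▸ Finset.single_le_sum (fun i _ => h.1 i) (Finset.mem_univ ω)

theorem sum_pair_eq_one {ι κ : Type} [Fintype ι] [Fintype κ] {a : ι → ℝ} {b : κ → ℝ}
    (ha : IsPMF a) (hb : IsPMF b) : ∑ m : ι × κ, a m.1 * b m.2 = 1 := by
  rw [Fintype.sum_prod_type]
  simp only [← Finset.mul_sum, hb.2, mul_one, ha.2]

/-- The probability that the decoder outputs the sum of the sources is small unless the first
message takes many values: given `X₂` and both messages, the output of the decoder is the right
one for just one value of `X₁`, and typical values of `X₁` are equally unlikely. -/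
theorem sum_correct_le {p : ℝ} (h0 : 0 < p) (h1 : p < 1) (δ : ℝ) {n Θ₁ Θ₂ : ℕ}
    {E₁ : (Fin n → ZMod 2) → Fin Θ₁ → ℝ} {E₂ : (Fin n → ZMod 2) → Fin Θ₂ → ℝ}
    {D : Fin Θ₁ × Fin Θ₂ → (Fin n → ZMod 2) → ℝ} (hE₁ : ∀ x, IsPMF (E₁ x))
    (hE₂ : ∀ x, IsPMF (E₂ x)) (hD : ∀ m, IsPMF (D m)) :
    ∑ x₁, ∑ x₂, ∑ m, pairMass p x₁ x₂ * E₁ x₁ m.1 * E₂ x₂ m.2 * D m (x₁ + x₂)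
      ≤ ∑ z with z ∉ typical p δ n, noise p z + exp (-(n * (binEntropy p - δ))) * Θ₁ := by
  set β := exp (-(n * (binEntropy p - δ))) with hβ
  set g : (Fin n → ZMod 2) → ℝ := fun z => if z ∉ typical p δ n then 1 else 0 with hg
  have hg0 : ∀ z, 0 ≤ g z := fun z => by simp only [hg]; split_ifs <;> norm_num
  have hpt : ∀ x₁ x₂ m, pairMass p x₁ x₂ * E₁ x₁ m.1 * E₂ x₂ m.2 * D m (x₁ + x₂)
      ≤ pairMass p x₁ x₂ * g (x₁ + x₂) * (E₁ x₁ m.1 * E₂ x₂ m.2)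
        + (1 / 2) ^ n * (β * (E₂ x₂ m.2 * D m (x₁ + x₂))) := by
    intro x₁ x₂ m
    have a0 := (hE₁ x₁).1 m.1
    have b0 := (hE₂ x₂).1 m.2
    have d0 := (hD m).1 (x₁ + x₂)
    have a1 := (hE₁ x₁).le_one m.1
    have d1 := (hD m).le_one (x₁ + x₂)
    have s0 := pairMass_nonneg h0 h1 x₁ x₂
    have hβ0 : 0 ≤ β := (exp_pos _).le
    by_cases hz : x₁ + x₂ ∈ typical p δ n
    · have e : g (x₁ + x₂) = 0 := by simp [hg, hz]
      have hs : pairMass p x₁ x₂ ≤ (1 / 2) ^ n * β :=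
        mul_le_mul_of_nonneg_left (noise_le_of_mem_typical h0 h1 hz) (by positivity)
      rw [e, mul_zero, zero_mul, zero_add]
      calc pairMass p x₁ x₂ * E₁ x₁ m.1 * E₂ x₂ m.2 * D m (x₁ + x₂)
          ≤ (1 / 2) ^ n * β * 1 * E₂ x₂ m.2 * D m (x₁ + x₂) := by gcongr
        _ = _ := by ring
    · have e : g (x₁ + x₂) = 1 := by simp [hg, hz]
      rw [e]
      calc pairMass p x₁ x₂ * E₁ x₁ m.1 * E₂ x₂ m.2 * D m (x₁ + x₂)
          ≤ pairMass p x₁ x₂ * E₁ x₁ m.1 * E₂ x₂ m.2 * 1 := by gcongr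
        _ = pairMass p x₁ x₂ * 1 * (E₁ x₁ m.1 * E₂ x₂ m.2) := by ring
        _ ≤ _ := le_add_of_nonneg_right (by positivity)
  have hsum := Finset.sum_le_sum fun x₁ (_ : x₁ ∈ Finset.univ) =>
    Finset.sum_le_sum fun x₂ (_ : x₂ ∈ Finset.univ) =>
      Finset.sum_le_sum fun m (_ : m ∈ Finset.univ) => hpt x₁ x₂ m
  refine hsum.trans (le_of_eq ?_)
  simp only [Finset.sum_add_distrib, ← Finset.mul_sum, sum_pair_eq_one (hE₁ _) (hE₂ _), mul_one]
  congr 1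
  · rw [sum_pairMass_mul p g, Finset.sum_filter]
    exact Finset.sum_congr rfl fun z _ => by simp only [hg, mul_ite, mul_one, mul_zero]
  · rw [Finset.sum_comm]
    have hx : ∀ x₂, ∑ x₁, ∑ m : Fin Θ₁ × Fin Θ₂, E₂ x₂ m.2 * D m (x₁ + x₂) = Θ₁ := by
      intro x₂
      rw [Finset.sum_comm]
      simp only [← Finset.mul_sum, add_comm _ x₂, sum_shift x₂, (hD _).2, mul_one]
      rw [Fintype.sum_prod_type]
      simp [(hE₂ x₂).2]
    simp only [hx]
    rw [Finset.sum_const, Finset.card_univ]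
    simp
    field_simp

/-- Solving the bound of `sum_correct_le` for the number `Θ` of messages. -/
theorem le_logb_div {H δ : ℝ} {n Θ : ℕ} (hn : 0 < n)
    (h : 1 / 4 ≤ exp (-(n * (H - δ))) * Θ) :
    H / log 2 - δ / log 2 - 2 / n ≤ logb 2 Θ / n := by
  have hn' : (0 : ℝ) < n := by exact_mod_cast hn
  have h2 : 0 < log 2 := log_pos (by norm_num)
  have hΘ : (0 : ℝ) < Θ := by
    rcases Nat.eq_zero_or_pos Θ with rfl | hp
    · norm_num at h
    · exact_mod_cast hp
  have hl := log_le_log (by norm_num) h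
  rw [log_mul (exp_pos _).ne' hΘ.ne', log_exp, show (1 / 4 : ℝ) = (2 ^ 2)⁻¹ by norm_num, log_inv,
    log_pow] at hl
  push_cast at hl
  rw [← log_div_log, le_div_iff₀ hn', le_div_iff₀ h2]
  have e : (H / log 2 - δ / log 2 - 2 / n) * n * log 2 = n * (H - δ) - 2 * log 2 := by
    field_simp
  rw [e]
  linarith

theorem IsAchievable.hb_le {p R₁ R₂ C : ℝ} (h0 : 0 < p) (h1 : p < 1)
    (h : IsAchievable (dsbs p 0) R₁ R₂ C) : hb p ≤ R₁ ∧ hb p ≤ R₂ := by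
  have hl2 : 0 < log 2 := log_pos (by norm_num)
  have main : ∀ ε : ℝ, 0 < ε → ε ≤ 1 / 4 → hb p - 3 * ε ≤ R₁ ∧ hb p - 3 * ε ≤ R₂ := by
    intro ε hε hε4
    obtain ⟨n₁, hn₁⟩ := h.2 ε hε
    obtain ⟨n₂, hn₂⟩ := exists_sum_not_typical_le h0 h1 (δ := ε * log 2) (by positivity) hε
    obtain ⟨n₃, hn₃⟩ := exists_nat_gt (2 / ε)
    obtain ⟨n, hn, hn', hn''⟩ : ∃ n, n₁ ≤ n ∧ n₂ ≤ n ∧ n₃ ≤ n :=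
      ⟨max n₁ (max n₂ n₃), by simp, by simp, by simp⟩
    have hn3 : 2 / ε < n := hn₃.trans_le (by exact_mod_cast hn'')
    have hnpos' : (0 : ℝ) < n := lt_trans (by positivity) hn3
    have hnpos : 0 < n := by exact_mod_cast hnpos'
    have h2n : 2 / (n : ℝ) ≤ ε := by
      rw [div_lt_iff₀ hε] at hn3
      rw [div_le_iff₀ hnpos']
      linarith
    obtain ⟨Θ₁, Θ₂, E₁, E₂, D, hE₁, hE₂, hD, htv, hr₁, hr₂⟩ := hn₁ n hn
    -- the synthesized PMF puts mass at least `1 - 2 * ε` on `y = x₁ + x₂`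
    have hmass : 1 - 2 * ε ≤ ∑ x₁, ∑ x₂, inducedPMF (dsbs p 0) E₁ E₂ D x₁ x₂ (x₁ + x₂) := by
      have hd : ∑ x₁ : Fin n → ZMod 2, ∑ x₂ : Fin n → ZMod 2,
          ((∏ i, dsbs p 0 (x₁ i, x₂ i, (x₁ + x₂) i))
            - inducedPMF (dsbs p 0) E₁ E₂ D x₁ x₂ (x₁ + x₂))
          ≤ ∑ x₁ : Fin n → ZMod 2, ∑ x₂ : Fin n → ZMod 2, ∑ y : Fin n → ZMod 2,
            |(∏ i, dsbs p 0 (x₁ i, x₂ i, y i)) - inducedPMF (dsbs p 0) E₁ E₂ D x₁ x₂ y| := by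
        refine Finset.sum_le_sum fun x₁ _ => Finset.sum_le_sum fun x₂ _ => (le_abs_self _).trans ?_
        exact Finset.single_le_sum (f := fun y : Fin n → ZMod 2 =>
          |(∏ i, dsbs p 0 (x₁ i, x₂ i, y i)) - inducedPMF (dsbs p 0) E₁ E₂ D x₁ x₂ y|)
          (fun _ _ => abs_nonneg _) (Finset.mem_univ (x₁ + x₂))
      have ht : ∑ x₁ : Fin n → ZMod 2, ∑ x₂ : Fin n → ZMod 2,
          ∏ i, dsbs p 0 (x₁ i, x₂ i, (x₁ + x₂) i) = 1 := by
        have := sum_pairMass_mul (n := n) p fun _ => 1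
        simp only [prod_dsbs_zero]
        simpa [kron, sum_noise] using this
      simp only [Finset.sum_sub_distrib] at hd
      rw [ht] at hd
      linarith
    have hN : ∑ _μ : Fin ⌊(2 : ℝ) ^ ((n : ℝ) * C)⌋₊,
        (1 / (⌊(2 : ℝ) ^ ((n : ℝ) * C)⌋₊ : ℝ)) ≤ 1 := by
      rw [Finset.sum_const, Finset.card_univ, Fintype.card_fin, nsmul_eq_mul, mul_one_div]
      exact div_self_le_one _
    -- a bound for each value of the common randomness bounds the average
    have havg : ∀ b : ℝ, 0 ≤ b → (∀ μ, ∑ x₁, ∑ x₂, ∑ m,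
        pairMass p x₁ x₂ * E₁ μ x₁ m.1 * E₂ μ x₂ m.2 * D μ m (x₁ + x₂) ≤ b) →
        1 - 2 * ε ≤ b := by
      intro b hb0 hb
      refine hmass.trans ?_
      simp only [inducedPMF, prod_sum_dsbs]
      calc _ = ∑ μ, (1 / (⌊(2 : ℝ) ^ ((n : ℝ) * C)⌋₊ : ℝ)) * ∑ x₁, ∑ x₂, ∑ m,
            pairMass p x₁ x₂ * E₁ μ x₁ m.1 * E₂ μ x₂ m.2 * D μ m (x₁ + x₂) := by
            rw [Finset.sum_congr rfl fun x₁ _ => Finset.sum_comm, Finset.sum_comm]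
            simp only [Finset.mul_sum]
        _ ≤ ∑ μ, (1 / (⌊(2 : ℝ) ^ ((n : ℝ) * C)⌋₊ : ℝ)) * b :=
            Finset.sum_le_sum fun μ _ => mul_le_mul_of_nonneg_left (hb μ) (by positivity)
        _ = (∑ _μ : Fin ⌊(2 : ℝ) ^ ((n : ℝ) * C)⌋₊,
            (1 / (⌊(2 : ℝ) ^ ((n : ℝ) * C)⌋₊ : ℝ))) * b := (Finset.sum_mul _ _ _).symm
        _ ≤ 1 * b := mul_le_mul_of_nonneg_right hN hb0
        _ = b := one_mul b
    have hat := hn₂ n hn'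
    have hat0 : 0 ≤ ∑ z with z ∉ typical p (ε * log 2) n, noise p z :=
      Finset.sum_nonneg fun z _ => (noise_pos h0 h1 z).le
    have k₁ := havg _ (add_nonneg hat0 (mul_nonneg (exp_pos _).le (Nat.cast_nonneg _))) fun μ =>
      sum_correct_le h0 h1 (ε * log 2) (hE₁ μ) (hE₂ μ) (hD μ)
    have k₂ := havg _ (add_nonneg hat0 (mul_nonneg (exp_pos _).le (Nat.cast_nonneg _))) fun μ => by
      have hsw := sum_correct_le h0 h1 (ε * log 2) (hE₂ μ) (hE₁ μ) (D := fun m => D μ m.swap)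
        fun m => hD μ m.swap
      refine le_trans (le_of_eq ?_) hsw
      rw [Finset.sum_comm]
      refine Finset.sum_congr rfl fun x₂ _ => Finset.sum_congr rfl fun x₁ _ => ?_
      refine Fintype.sum_equiv (Equiv.prodComm _ _) _ _ fun m => ?_
      simp only [Equiv.prodComm_apply, Prod.fst_swap, Prod.snd_swap, Prod.swap_swap, pairMass,
        add_comm x₁ x₂]
      ring
    have l₁ := le_logb_div (Θ := Θ₁) (H := binEntropy p) (δ := ε * log 2) hnpos (by linarith)
    have l₂ := le_logb_div (Θ := Θ₂) (H := binEntropy p) (δ := ε * log 2) hnpos (by linarith)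
    rw [mul_div_assoc, div_self hl2.ne', mul_one, ← hb] at l₁ l₂
    constructor <;> linarith
  constructor
  · by_contra! hcon
    have := (main (min (1 / 4) ((hb p - R₁) / 6)) (lt_min (by norm_num) (by linarith))
      (min_le_left _ _)).1
    have := min_le_right (1 / 4) ((hb p - R₁) / 6)
    linarith
  · by_contra! hcon
    have := (main (min (1 / 4) ((hb p - R₂) / 6)) (lt_min (by norm_num) (by linarith))
      (min_le_left _ _)).2
    have := min_le_right (1 / 4) ((hb p - R₂) / 6)
    linarith

/-! ### Achievability by random linear codes -/

section LinearCode

variable {k n : ℕ}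

/-- The syndrome of `z` under the binary matrix with rows `M j`. -/
def syndrome (M : Fin k → Fin n → ZMod 2) (z : Fin n → ZMod 2) (j : Fin k) : ZMod 2 :=
  ∑ i, M j i * z i

theorem syndrome_add (M : Fin k → Fin n → ZMod 2) (z z' : Fin n → ZMod 2) :
    syndrome M (z + z') = syndrome M z + syndrome M z' := by
  ext j
  simp [syndrome, mul_add, Finset.sum_add_distrib]

/-- Half of all rows are orthogonal to a given nonzero vector. -/
theorem two_mul_card_orthogonal {v : Fin n → ZMod 2} (hv : v ≠ 0) :
    2 * (Finset.univ.filter fun r : Fin n → ZMod 2 => ∑ i, r i * v i = 0).card = 2 ^ n := by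
  obtain ⟨i, hi⟩ := Function.ne_iff.1 hv
  have hi1 : v i = 1 := (zmod_two_cases (v i)).resolve_left hi
  have hflip : ∀ r : Fin n → ZMod 2,
      ∑ j, (r + Pi.single i 1 : Fin n → ZMod 2) j * v j = ∑ j, r j * v j + 1 := by
    intro r
    simp [add_mul, Finset.sum_add_distrib, Pi.single_apply, hi1]
  have hcard : (Finset.univ.filter fun r : Fin n → ZMod 2 => ∑ i, r i * v i = 0).card
      = (Finset.univ.filter fun r : Fin n → ZMod 2 => ¬ ∑ i, r i * v i = 0).card := by
    refine Finset.card_equiv (Equiv.addRight (Pi.single i 1)) fun r => ?_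
    simp only [Finset.mem_filter, Finset.mem_univ, true_and, Equiv.coe_addRight, hflip]
    rcases zmod_two_cases (∑ j, r j * v j) with h | h <;> rw [h] <;> decide
  have htot := Finset.card_filter_add_card_filter_not (s := (Finset.univ : Finset (Fin n → ZMod 2)))
    (fun r => ∑ i, r i * v i = 0)
  rw [← hcard, Finset.card_univ, Fintype.card_fun, ZMod.card, Fintype.card_fin] at htot
  omega

/-- A random matrix annihilates a given nonzero vector with probability `2 ^ (-k)`. -/
theorem card_syndrome_eq_zero {v : Fin n → ZMod 2} (hv : v ≠ 0) (k : ℕ) :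
    ((Finset.univ.filter fun M : Fin k → Fin n → ZMod 2 => syndrome M v = 0).card : ℝ)
      = Fintype.card (Fin k → Fin n → ZMod 2) * (1 / 2) ^ k := by
  have hset : (Finset.univ.filter fun M : Fin k → Fin n → ZMod 2 => syndrome M v = 0)
      = Fintype.piFinset fun _ : Fin k =>
          Finset.univ.filter fun r : Fin n → ZMod 2 => ∑ i, r i * v i = 0 := by
    ext M
    simp [funext_iff, syndrome]
  have h2 := two_mul_card_orthogonal hv
  rw [hset, Fintype.card_piFinset, Finset.prod_const, Finset.card_univ, Fintype.card_fin,
    Fintype.card_fun, Fintype.card_fun, ZMod.card, Fintype.card_fin, Fintype.card_fin, ← h2]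
  push_cast
  rw [← mul_pow]
  congr 1
  ring

open Classical in
/-- The decoder of a syndrome: some typical sequence that has it, or `0` if there is none. -/
noncomputable def decode (p δ : ℝ) (M : Fin k → Fin n → ZMod 2) (s : Fin k → ZMod 2) :
    Fin n → ZMod 2 :=
  if h : ∃ z ∈ typical p δ n, syndrome M z = s then h.choose else 0

theorem decode_ne {p δ : ℝ} {M : Fin k → Fin n → ZMod 2} {z : Fin n → ZMod 2}
    (hz : z ∈ typical p δ n) (hne : decode p δ M (syndrome M z) ≠ z) :
    ∃ z' ∈ typical p δ n, z' ≠ z ∧ syndrome M (z' - z) = 0 := by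
  have hex : ∃ z' ∈ typical p δ n, syndrome M z' = syndrome M z := ⟨z, hz, rfl⟩
  rw [decode, dif_pos hex] at hne
  refine ⟨hex.choose, hex.choose_spec.1, hne, ?_⟩
  have h1 := syndrome_add M (hex.choose - z) z
  rw [sub_add_cancel, hex.choose_spec.2] at h1
  exact right_eq_add.1 h1

/-- Some matrix is as good as a random one, for which the union bound over the typical sequences
bounds the probability of a decoding error. -/
theorem exists_linear_code {p δ : ℝ} (h0 : 0 < p) (h1 : p < 1) (k n : ℕ) :
    ∃ M : Fin k → Fin n → ZMod 2,
      ∑ z with decode p δ M (syndrome M z) ≠ z, noise p z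
        ≤ ∑ z with z ∉ typical p δ n, noise p z + (typical p δ n).card * (1 / 2) ^ k := by
  classical
  set T := typical p δ n with hT
  set K : ℝ := (Fintype.card (Fin k → Fin n → ZMod 2) : ℝ) with hK
  have hn0 : ∀ z : Fin n → ZMod 2, 0 ≤ noise p z := fun z => (noise_pos h0 h1 z).le
  -- the union bound for a fixed matrix
  have herr : ∀ M : Fin k → Fin n → ZMod 2,
      ∑ z with decode p δ M (syndrome M z) ≠ z, noise p z
        ≤ ∑ z with z ∉ T, noise p z
          + ∑ z, noise p z * ∑ z' ∈ T with z' ≠ z, if syndrome M (z' - z) = 0 then 1 else 0 := by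
    intro M
    rw [Finset.sum_filter, Finset.sum_filter, ← Finset.sum_add_distrib]
    refine Finset.sum_le_sum fun z _ => ?_
    have hs : 0 ≤ ∑ z' ∈ T with z' ≠ z, (if syndrome M (z' - z) = 0 then (1 : ℝ) else 0) :=
      Finset.sum_nonneg fun _ _ => by split_ifs <;> norm_num
    have hs' := mul_nonneg (hn0 z) hs
    by_cases hz : z ∈ T
    · by_cases hd : decode p δ M (syndrome M z) ≠ z
      · obtain ⟨z', hz', hne, hsyn⟩ := decode_ne hz hd
        have hone : (1 : ℝ)
            ≤ ∑ z' ∈ T with z' ≠ z, (if syndrome M (z' - z) = 0 then (1 : ℝ) else 0) := by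
          have := Finset.single_le_sum
            (f := fun z' => if syndrome M (z' - z) = 0 then (1 : ℝ) else 0)
            (fun _ _ => by split_ifs <;> norm_num)
            (Finset.mem_filter.2 ⟨hz', hne⟩ : z' ∈ T.filter fun z' => z' ≠ z)
          simpa [hsyn] using this
        rw [if_pos hd, if_neg (not_not.2 hz), zero_add]
        exact le_mul_of_one_le_right (hn0 z) hone
      · rw [if_neg hd, if_neg (not_not.2 hz), zero_add]
        exact hs'
    · rw [if_pos hz]
      split_ifs
      · linarith
      · linarith [hn0 z]
  have havg : ∑ M : Fin k → Fin n → ZMod 2,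
      ∑ z with decode p δ M (syndrome M z) ≠ z, noise p z
        ≤ ∑ _M : Fin k → Fin n → ZMod 2,
          (∑ z with z ∉ T, noise p z + T.card * (1 / 2) ^ k) := by
    refine (Finset.sum_le_sum fun M _ => herr M).trans ?_
    rw [Finset.sum_add_distrib, Finset.sum_add_distrib]
    refine add_le_add le_rfl ?_
    rw [Finset.sum_comm, Finset.sum_const, Finset.card_univ, nsmul_eq_mul, ← hK]
    calc ∑ z, ∑ M : Fin k → Fin n → ZMod 2, noise p z *
          ∑ z' ∈ T with z' ≠ z, (if syndrome M (z' - z) = 0 then (1 : ℝ) else 0)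
        ≤ ∑ z : Fin n → ZMod 2, noise p z * (T.card * (K * (1 / 2) ^ k)) := by
          refine Finset.sum_le_sum fun z _ => ?_
          rw [← Finset.mul_sum, Finset.sum_comm]
          refine mul_le_mul_of_nonneg_left ?_ (hn0 z)
          calc ∑ z' ∈ T with z' ≠ z, ∑ M : Fin k → Fin n → ZMod 2,
                (if syndrome M (z' - z) = 0 then (1 : ℝ) else 0)
              = ∑ z' ∈ T with z' ≠ z, K * (1 / 2) ^ k := by
                refine Finset.sum_congr rfl fun z' hz' => ?_
                rw [← card_syndrome_eq_zero (sub_ne_zero.2 (Finset.mem_filter.1 hz').2) k,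
                  Finset.sum_boole]
            _ ≤ ∑ z' ∈ T, K * (1 / 2) ^ k :=
                Finset.sum_le_sum_of_subset_of_nonneg (Finset.filter_subset _ _)
                  fun _ _ _ => by positivity
            _ = T.card * (K * (1 / 2) ^ k) := by rw [Finset.sum_const, nsmul_eq_mul]
      _ = K * (T.card * (1 / 2) ^ k) := by
          rw [← Finset.sum_mul, sum_noise]
          ring
  obtain ⟨M, -, hM⟩ := Finset.exists_le_of_sum_le Finset.univ_nonempty havg
  exact ⟨M, hM⟩

end LinearCode

theorem isPMF_kron {α : Type} [Fintype α] [DecidableEq α] (a : α) : IsPMF fun b => kron a b :=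
  ⟨fun b => by show 0 ≤ kron a b; unfold kron; split_ifs <;> norm_num, by simp [kron]⟩

/-- If both users send the syndrome of their source, the distance to the target is the probability
that the sum of the sources is decoded wrongly. -/
theorem exists_linear_scheme {p δ : ℝ} (h0 : 0 < p) (h1 : p < 1) {k n N : ℕ} (hN : 0 < N)
    (M : Fin k → Fin n → ZMod 2) :
    ∃ (E : Fin N → (Fin n → ZMod 2) → Fin (2 ^ k) → ℝ)
      (D : Fin N → Fin (2 ^ k) × Fin (2 ^ k) → (Fin n → ZMod 2) → ℝ),
      (∀ μ x, IsPMF (E μ x)) ∧ (∀ μ m, IsPMF (D μ m)) ∧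
      (1 / 2) * ∑ x₁ : Fin n → ZMod 2, ∑ x₂ : Fin n → ZMod 2, ∑ y : Fin n → ZMod 2,
        |(∏ i, dsbs p 0 (x₁ i, x₂ i, y i)) - inducedPMF (dsbs p 0) E E D x₁ x₂ y|
        ≤ ∑ z with decode p δ M (syndrome M z) ≠ z, noise p z := by
  have e : (Fin k → ZMod 2) ≃ Fin (2 ^ k) := Fintype.equivFinOfCardEq (by simp [ZMod.card])
  refine ⟨fun _ x m => kron (e (syndrome M x)) m,
    fun _ m y => kron (decode p δ M (e.symm m.1 + e.symm m.2)) y,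
    fun _ _ => isPMF_kron _, fun _ _ => isPMF_kron _, ?_⟩
  have hind : ∀ x₁ x₂ y : Fin n → ZMod 2, inducedPMF (dsbs p 0)
      (fun (_ : Fin N) x m => kron (e (syndrome M x)) m)
      (fun (_ : Fin N) x m => kron (e (syndrome M x)) m)
      (fun (_ : Fin N) m y => kron (decode p δ M (e.symm m.1 + e.symm m.2)) y) x₁ x₂ y
      = pairMass p x₁ x₂ * kron (decode p δ M (syndrome M (x₁ + x₂))) y := by
    intro x₁ x₂ y
    have hN' : (N : ℝ) ≠ 0 := by exact_mod_cast hN.ne'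
    rw [inducedPMF, Finset.sum_const, Finset.card_univ, Fintype.card_fin, nsmul_eq_mul, ← mul_assoc,
      mul_one_div_cancel hN', one_mul, prod_sum_dsbs, Fintype.sum_prod_type,
      Finset.sum_eq_single (e (syndrome M x₁)), Finset.sum_eq_single (e (syndrome M x₂))]
    · simp [kron, syndrome_add]
    · intro m _ hm
      simp [kron, hm.symm]
    · simp
    · intro m _ hm
      simp [kron, hm.symm]
    · simp
  have habs : ∀ z d : Fin n → ZMod 2, ∑ y, |kron z y - kron d y| ≤ 2 * if d ≠ z then 1 else 0 := by
    intro z d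
    by_cases hd : d = z
    · simp [hd]
    · rw [if_pos hd]
      calc ∑ y, |kron z y - kron d y| ≤ ∑ y, (kron z y + kron d y) := by
            refine Finset.sum_le_sum fun y _ => ?_
            have a := (isPMF_kron z).1 y
            have b := (isPMF_kron d).1 y
            rw [abs_le]
            constructor <;> linarith
        _ = 2 * 1 := by
            rw [Finset.sum_add_distrib, (isPMF_kron z).2, (isPMF_kron d).2]
            norm_num
  calc (1 / 2) * ∑ x₁ : Fin n → ZMod 2, ∑ x₂ : Fin n → ZMod 2, ∑ y : Fin n → ZMod 2, _
      ≤ (1 / 2) * ∑ x₁ : Fin n → ZMod 2, ∑ x₂ : Fin n → ZMod 2, pairMass p x₁ x₂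
        * (fun z => 2 * if decode p δ M (syndrome M z) ≠ z then 1 else 0) (x₁ + x₂) := by
        refine mul_le_mul_of_nonneg_left ?_ (by norm_num)
        refine Finset.sum_le_sum fun x₁ _ => Finset.sum_le_sum fun x₂ _ => ?_
        simp only [prod_dsbs_zero, hind, ← mul_sub, abs_mul,
          abs_of_nonneg (pairMass_nonneg h0 h1 _ _), ← Finset.mul_sum]
        exact mul_le_mul_of_nonneg_left (habs _ _) (pairMass_nonneg h0 h1 _ _)
    _ = ∑ z with decode p δ M (syndrome M z) ≠ z, noise p z := by
        rw [sum_pairMass_mul p fun z => 2 * if decode p δ M (syndrome M z) ≠ z then 1 else 0,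
          Finset.mul_sum, Finset.sum_filter]
        refine Finset.sum_congr rfl fun z _ => ?_
        split_ifs <;> ring

theorem isAchievable_of_hb_le {p R₁ R₂ C : ℝ} (h0 : 0 < p) (h1 : p < 1) (hR₁ : hb p ≤ R₁)
    (hR₂ : hb p ≤ R₂) (hC : 0 ≤ C) : IsAchievable (dsbs p 0) R₁ R₂ C := by
  refine ⟨hC, fun ε hε => ?_⟩
  have hl2 : 0 < log 2 := log_pos (by norm_num)
  set δ := ε * log 2 / 4 with hδ
  have hδ0 : 0 < δ := by positivity
  obtain ⟨n₁, hn₁⟩ := exists_sum_not_typical_le h0 h1 hδ0 (half_pos hε)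
  obtain ⟨n₂, hn₂⟩ := exists_nat_gt (2 / (ε * δ))
  obtain ⟨n₃, hn₃⟩ := exists_nat_gt (2 / ε)
  refine ⟨max n₁ (max n₂ n₃), fun n hn => ?_⟩
  have hn1 : n₁ ≤ n := (le_max_left _ _).trans hn
  have hn2 : 2 / (ε * δ) < n := hn₂.trans_le (by
    exact_mod_cast ((le_max_left n₂ n₃).trans (le_max_right n₁ _)).trans hn)
  have hn3 : 2 / ε < n := hn₃.trans_le (by
    exact_mod_cast ((le_max_right n₂ n₃).trans (le_max_right n₁ _)).trans hn)
  have hnpos : (0 : ℝ) < n := lt_trans (by positivity) hn3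
  have hH : 0 ≤ hb p := div_nonneg (binEntropy_nonneg h0.le h1.le) hl2.le
  -- the blocklength of the linear code
  set k := ⌈(n : ℝ) * (hb p + ε / 2)⌉₊ with hk
  have hk1 : (n : ℝ) * (hb p + ε / 2) ≤ k := Nat.le_ceil _
  have hk2 : (k : ℝ) < n * (hb p + ε / 2) + 1 := Nat.ceil_lt_add_one (by positivity)
  have hrate : logb 2 ((2 ^ k : ℕ) : ℝ) / n ≤ hb p + ε := by
    push_cast
    rw [logb_pow, logb_self_eq_one (by norm_num), mul_one, div_le_iff₀ hnpos]
    rw [div_lt_iff₀ hε] at hn3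
    linarith
  have hN : 0 < ⌊(2 : ℝ) ^ ((n : ℝ) * C)⌋₊ :=
    Nat.floor_pos.2 (one_le_rpow (by norm_num) (by positivity))
  obtain ⟨M, hM⟩ := exists_linear_code (δ := δ) h0 h1 k n
  obtain ⟨E, D, hE, hD, htv⟩ := exists_linear_scheme (δ := δ) h0 h1 hN M
  refine ⟨2 ^ k, 2 ^ k, E, E, D, hE, hE, hD, ?_, by linarith, by linarith⟩
  refine htv.trans (hM.trans ?_)
  have ha := hn₁ n hn1
  have hb' : ((typical p δ n).card : ℝ) * (1 / 2) ^ k ≤ ε / 2 := by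
    have hpow : ((1 : ℝ) / 2) ^ k ≤ exp (-(n * (binEntropy p + 2 * δ))) := by
      rw [show ((1 : ℝ) / 2) ^ k = exp (-(k * log 2)) by
        rw [exp_neg, ← log_pow, exp_log (by positivity)]; simp, exp_le_exp, neg_le_neg_iff]
      have e : n * (binEntropy p + 2 * δ) = n * (hb p + ε / 2) * log 2 := by
        rw [hb, hδ]; field_simp; ring
      rw [e]
      exact mul_le_mul_of_nonneg_right hk1 hl2.le
    calc ((typical p δ n).card : ℝ) * (1 / 2) ^ k
        ≤ exp (n * (binEntropy p + δ)) * exp (-(n * (binEntropy p + 2 * δ))) :=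
          mul_le_mul (card_typical_le h0 h1 δ n) hpow (by positivity) (exp_pos _).le
      _ = (exp (n * δ))⁻¹ := by
          rw [← exp_add, ← exp_neg]
          congr 1
          ring
      _ ≤ (2 / ε)⁻¹ := by
          refine inv_anti₀ (by positivity) ?_
          have h3 := add_one_le_exp (n * δ)
          rw [div_lt_iff₀ (by positivity)] at hn2
          have h4 : 2 / ε < n * δ := by
            rw [div_lt_iff₀ hε]
            linarith
          linarith
      _ = ε / 2 := inv_div _ _
  linarith

theorem Rd_noiseless {p : ℝ} (hp0 : 0 < p) (hp1 : p < 1) :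
    Rd (dsbs p 0) = {t : ℝ × ℝ × ℝ | hb p ≤ t.1 ∧ hb p ≤ t.2.1 ∧ 0 ≤ t.2.2} := by
  ext t
  constructor
  · intro h
    obtain ⟨a, b⟩ := IsAchievable.hb_le hp0 hp1 h
    exact ⟨a, b, h.1⟩
  · rintro ⟨a, b, c⟩
    exact isAchievable_of_hb_le hp0 hp1 a b c

end CorrSynth

theorem mainTheorem3 :
    -- the noiseless case `q = 0`, for every crossover probability
    (∀ p : ℝ, 0 < p → p < 1 / 2 →
      CorrSynth.Ru (CorrSynth.dsbs p 0) =
          {t : ℝ × ℝ × ℝ | CorrSynth.hb p ≤ t.1 ∧ CorrSynth.hb p ≤ t.2.1 ∧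
            1 + CorrSynth.hb p ≤ t.1 + t.2.1 ∧ 0 ≤ t.2.2} ∧
        CorrSynth.Rs (CorrSynth.dsbs p 0) =
          {t : ℝ × ℝ × ℝ | CorrSynth.hb p ≤ t.1 ∧ CorrSynth.hb p ≤ t.2.1 ∧ 0 ≤ t.2.2} ∧
        CorrSynth.Rd (CorrSynth.dsbs p 0) =
          {t : ℝ × ℝ × ℝ | CorrSynth.hb p ≤ t.1 ∧ CorrSynth.hb p ≤ t.2.1 ∧ 0 ≤ t.2.2} ∧
        (CorrSynth.Rs (CorrSynth.dsbs p 0) \ CorrSynth.Ru (CorrSynth.dsbs p 0)).Nonempty) ∧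
    -- the numerical case `p = q = 0.1`
    (∃ m : ℝ,
      IsLeast ((fun t : ℝ × ℝ × ℝ => t.1 + t.2.1 + t.2.2) ''
        CorrSynth.Ru (CorrSynth.dsbs (1 / 10) (1 / 10))) m ∧ |m - 1.3965| ≤ 0.00005) ∧
    (∃ t ∈ CorrSynth.Rs (CorrSynth.dsbs (1 / 10) (1 / 10)), t.1 + t.2.1 + t.2.2 = 0.9596) ∧
    (CorrSynth.Rs (CorrSynth.dsbs (1 / 10) (1 / 10)) \
      CorrSynth.Ru (CorrSynth.dsbs (1 / 10) (1 / 10))).Nonempty := by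
  refine ⟨fun p hp0 hp2 => ?_, CorrSynth.isLeast_sum_Ru, CorrSynth.exists_mem_Rs_sum_eq, ?_⟩
  · have hp1 : p < 1 := by linarith
    refine ⟨CorrSynth.Ru_noiseless hp0 hp1, CorrSynth.Rs_noiseless hp0 hp1,
      CorrSynth.Rd_noiseless hp0 hp1, ?_⟩
    rw [CorrSynth.Ru_noiseless hp0 hp1, CorrSynth.Rs_noiseless hp0 hp1]
    refine ⟨(CorrSynth.hb p, CorrSynth.hb p, 0), ⟨le_rfl, le_rfl, le_rfl⟩, fun hmem => ?_⟩
    -- the sum rate `2 h_b(p)` is below `1 + h_b(p)`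
    have hlt : CorrSynth.hb p < 1 :=
      (div_lt_one (log_pos (by norm_num))).2 (binEntropy_lt_log_two.2 (by linarith))
    have hsum : 1 + CorrSynth.hb p ≤ CorrSynth.hb p + CorrSynth.hb p := hmem.2.2.1
    linarith
  · obtain ⟨m, hm, hval⟩ := CorrSynth.isLeast_sum_Ru
    obtain ⟨t, ht, hsum⟩ := CorrSynth.exists_mem_Rs_sum_eq
    refine ⟨t, ht, fun hmem => ?_⟩
    have hle := hm.2 ⟨t, hmem, rfl⟩
    dsimp only at hle
    linarith [(abs_le.1 hval).1]
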